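/- **Setting.** Let $p\ge 3$, $n\ge 1$, and let $X\sim N_p(\theta,\sigma^2 I_p)$ and $S\sim\sigma^2\chi^2_n$ be independent, with $\theta\in\mathbb R^p$ and $\sigma^2>0$ unknown. Put $W=\|X\|^2/S$. Let $\phi:(0,\infty)\to\mathbb R$ be bounded and Lipschitz (equivalently: $\phi$ is bounded and locally absolutely continuous with bounded derivative $\phi'$), and suppose that the shrinkage estimator $\delta_\phi=(1-\phi(W)/W)X$ improves on $X$ under squared error loss, i.e. $E\|\delta_\phi-\theta\|^2\le p\sigma^2$ for all $(\theta,\sigma^2)$. Let $M=M(\delta_\phi)=E[(\delta_\phi-\theta)(\delta_\phi-\theta)']$ be its MSE matrix. Define $$g_i(W)=W^{n/2}\int_W^\infty t^{-n/2}\,\frac{h_i(t)}{t}\,dt\ \ (i=1,2),\quad h_1(W)=\frac{\phi(W)}W,\quad h_2(W)=2\Big(\frac{\phi(W)}W-\phi'(W)\Big),\quad g_3(W)=g_2(W)+\frac{\phi^2(W)}W,$$ $$b(W)=\frac{4\phi(W)}{W}+\frac{(n+2)\phi^2(W)}{W}-4\phi'(W)-4\phi(W)\phi'(W),$$ and, for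 $j=0,1,2,\dots$ and independent $u\sim\chi^2_{p+2j}$, $v\sim\chi^2_n$, $$\beta^{(1)}_{p,n}=\inf_{j\ge0}E\Big[\frac{2(p-1)\phi(u/v)}{u/v}-\frac{(p+2j-1)\,b(u/v)}{p+2j}\Big],\qquad \beta^{(2)}_{p,n}=\sup_{j\ge0}E\Big[\frac{2\phi(u/v)}{u/v}-\frac{b(u/v)}{p+2j}\Big].$$ Assume that $g_1$ is nonincreasing and nowhere zero on $(0,\infty)$. For functions $\xi,\eta$ let $$\hat M(\xi,\eta;\delta_\phi)=S\Big\{\Big(\tfrac1n-g_1(W)\xi(W)\Big)\Big(I_p-\frac{XX'}{\|X\|^2}\Big)+\Big(\tfrac1n-g_1(W)\eta(W)+g_3(W)\Big)\frac{XX'}{\|X\|^2}\Big\}.$$ Let $W^\xi>0$ and $W^\eta>0$ be solutions of $$\frac{1+W}{n+p+2}\cdot\frac{\beta^{(2)}_{p,n}}{g_1(W)}=1,\qquad \frac1{g_1(W)}\Big(g_3(W)+\frac{1+W}{n+p+2}\,\beta^{(2)}_{p,n}\Big)=1$$ (if $g_3\ge g_1$ on $(0,\infty)$, $W^\eta$ need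 not be a solution and may be any positive number; then $\eta_1\equiv1$), and put $$\xi_1(W)=\min\Big(1,\frac{1+W^\xi}{n+p+2}\cdot\frac{\beta^{(2)}_{p,n}}{g_1(W)}\Big),\qquad \eta_1(W)=\min\Big[1,\frac1{g_1(W)}\Big(g_3(W)+\frac{1+W^\eta}{n+p+2}\beta^{(2)}_{p,n}\Big)\Big],$$ $$\xi_2(W)=\min\Big(1,\frac1{g_1(W)}\cdot\frac{\beta^{(2)}_{p,n}}{n+2}\Big),\qquad \eta_2(W)=\min\Big[1,\frac1{g_1(W)}\Big(g_3(W)+\frac{\beta^{(2)}_{p,n}}{n+2}\Big)\Big].$$ (The solutions $W^\xi,W^\eta$ are needed for $i=1$ only.) **Theorem.** Suppose $\beta^{(1)}_{p,n}\ge0$. Let $i\in\{1,2\}$, let $$\tau(W)=\frac1{g_1(W)}\Big(\frac1n-\frac{1+W}{n+p+1}\Big),\qquad \xi_i^{TR}(W)=\max\{\xi_i(W),\tau(W)\},$$ and suppose that $\{W>0:\xi_i^{TR}(W)=\tau(W)\}\ne\emptyset$. Then $\hat M(\xi_i^{TR},\eta_i;\delta_\phi)$ improves on $\hat M(\xi_i,\eta_i;\delta_\phi)$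 under the loss $L(\hat M;M)=\operatorname{tr}(\hat M-M)^2$: for all $(\theta,\sigma^2)$, $$E\,L\big(\hat M(\xi_i^{TR},\eta_i;\delta_\phi);M\big)\le E\,L\big(\hat M(\xi_i,\eta_i;\delta_\phi);M\big)\quad\text{in }[0,\infty].$$ If moreover the truncation changes $\xi_i$ somewhere, i.e. $\{W>0:\xi_i(W)<\tau(W)\}\neq\emptyset$, then for every $(\theta,\sigma^2)$ the difference $L(\hat M(\xi_i,\eta_i;\delta_\phi);M)-L(\hat M(\xi_i^{TR},\eta_i;\delta_\phi);M)$ is integrable with strictly positive expectation, so that the inequality of risks is strict whenever the risk on the right is finite. -/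

import Mathlib

open MeasureTheory ProbabilityTheory Set
open scoped ENNReal NNReal

noncomputable section

namespace ShrinkageMSE

/-- The chi-square distribution with `k` degrees of freedom. -/
def chiSq (k : ℕ) : Measure ℝ := gammaMeasure ((k : ℝ) / 2) (1 / 2)

/-- The joint law of the independent pair `(X, S)` with `X ∼ N_p(θ, σ² I_p)` and `S ∼ σ² χ²_n`;
the parameter `σ2` is the variance `σ²`. -/
def model {p : ℕ} (n : ℕ) (θ : EuclideanSpace ℝ (Fin p)) (σ2 : ℝ) :
    Measure (EuclideanSpace ℝ (Fin p) × ℝ) :=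
  (multivariateGaussian θ (σ2 • (1 : Matrix (Fin p) (Fin p) ℝ))).prod
    ((chiSq n).map (fun t => σ2 * t))

/-- The statistic `W = ‖X‖² / S`. -/
def stat {p : ℕ} (x : EuclideanSpace ℝ (Fin p)) (s : ℝ) : ℝ := ‖x‖ ^ 2 / s

/-- The shrinkage estimator `δ_φ = (1 - φ(W) / W) X`. -/
def shrink {p : ℕ} (φ : ℝ → ℝ) (x : EuclideanSpace ℝ (Fin p)) (s : ℝ) :
    EuclideanSpace ℝ (Fin p) :=
  (1 - φ (stat x s) / stat x s) • x

/-- The MSE matrix `E[(δ - θ)(δ - θ)']` of an estimator `δ(X, S)` of `θ`. -/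
def mseMatrix {p : ℕ} (n : ℕ)
    (δ : EuclideanSpace ℝ (Fin p) → ℝ → EuclideanSpace ℝ (Fin p))
    (θ : EuclideanSpace ℝ (Fin p)) (σ2 : ℝ) : Matrix (Fin p) (Fin p) ℝ :=
  Matrix.of fun i j => ∫ z, (δ z.1 z.2 i - θ i) * (δ z.1 z.2 j - θ j) ∂(model n θ σ2)

/-- The MSE of `δ`, the trace of its MSE matrix. -/
def mse {p : ℕ} (n : ℕ)
    (δ : EuclideanSpace ℝ (Fin p) → ℝ → EuclideanSpace ℝ (Fin p))
    (θ : EuclideanSpace ℝ (Fin p)) (σ2 : ℝ) : ℝ :=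
  (mseMatrix n δ θ σ2).trace

/-- The function `h₁(W) = φ(W) / W`. -/
def h₁ (φ : ℝ → ℝ) (w : ℝ) : ℝ := φ w / w

/-- The function `h₂(W) = 2 (φ(W) / W - φ'(W))`. -/
def h₂ (φ : ℝ → ℝ) (w : ℝ) : ℝ := 2 * (φ w / w - deriv φ w)

/-- The operator `h ↦ W^{n/2} ∫_W^∞ t^{-n/2} h(t) / t dt`. -/
def tailTransform (n : ℕ) (h : ℝ → ℝ) (w : ℝ) : ℝ :=
  w ^ ((n : ℝ) / 2) * ∫ t in Ioi w, t ^ (-((n : ℝ) / 2)) * (h t / t)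

def g₁ (n : ℕ) (φ : ℝ → ℝ) : ℝ → ℝ := tailTransform n (h₁ φ)

def g₂ (n : ℕ) (φ : ℝ → ℝ) : ℝ → ℝ := tailTransform n (h₂ φ)

def g₃ (n : ℕ) (φ : ℝ → ℝ) (w : ℝ) : ℝ := g₂ n φ w + φ w ^ 2 / w

/-- The function `b(W) = 4 φ(W)/W + (n+2) φ²(W)/W - 4 φ'(W) - 4 φ(W) φ'(W)`. -/
def bFun (n : ℕ) (φ : ℝ → ℝ) (w : ℝ) : ℝ :=
  4 * φ w / w + ((n : ℝ) + 2) * φ w ^ 2 / w - 4 * deriv φ w - 4 * φ w * deriv φ w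

/-- `β⁽¹⁾_{p,n}(j; δ_φ)`: an expectation over independent `u ∼ χ²_{p+2j}` and `v ∼ χ²_n`. -/
def betaOne (p n : ℕ) (φ : ℝ → ℝ) (j : ℕ) : ℝ :=
  ∫ z : ℝ × ℝ,
    (2 * ((p : ℝ) - 1) * φ (z.1 / z.2) / (z.1 / z.2)
      - ((p : ℝ) + 2 * j - 1) * bFun n φ (z.1 / z.2) / ((p : ℝ) + 2 * j))
    ∂((chiSq (p + 2 * j)).prod (chiSq n))

/-- `β⁽¹⁾_{p,n}(δ_φ) = inf_{j ≥ 0} β⁽¹⁾_{p,n}(j; δ_φ)`. -/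
def betaOneInf (p n : ℕ) (φ : ℝ → ℝ) : ℝ := ⨅ j : ℕ, betaOne p n φ j

/-- `β⁽²⁾_{p,n}(j; δ_φ)`: an expectation over independent `u ∼ χ²_{p+2j}` and `v ∼ χ²_n`. -/
def betaTwo (p n : ℕ) (φ : ℝ → ℝ) (j : ℕ) : ℝ :=
  ∫ z : ℝ × ℝ,
    (2 * φ (z.1 / z.2) / (z.1 / z.2) - bFun n φ (z.1 / z.2) / ((p : ℝ) + 2 * j))
    ∂((chiSq (p + 2 * j)).prod (chiSq n))

/-- `β⁽²⁾_{p,n}(δ_φ) = sup_{j ≥ 0} β⁽²⁾_{p,n}(j; δ_φ)`. -/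
def betaTwoSup (p n : ℕ) (φ : ℝ → ℝ) : ℝ := ⨆ j : ℕ, betaTwo p n φ j

/-- `w` is a (positive) root `W^ξ_{p,n}` of the equation that calibrates `ξ₁`. -/
def IsXiRoot (p n : ℕ) (φ : ℝ → ℝ) (w : ℝ) : Prop :=
  0 < w ∧ (1 + w) / ((n : ℝ) + p + 2) * (betaTwoSup p n φ / g₁ n φ w) = 1

/-- `w` is a (positive) root `W^η_{p,n}` of the equation that calibrates `η₁`. -/
def IsEtaRoot (p n : ℕ) (φ : ℝ → ℝ) (w : ℝ) : Prop :=
  0 < w ∧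
    1 / g₁ n φ w * (g₃ n φ w + (1 + w) / ((n : ℝ) + p + 2) * betaTwoSup p n φ) = 1

/-- The function `ξ₁`, where `Wξ` stands for `W^ξ_{p,n}(δ_φ)`. -/
def xiOne (p n : ℕ) (φ : ℝ → ℝ) (Wξ : ℝ) (w : ℝ) : ℝ :=
  min 1 ((1 + Wξ) / ((n : ℝ) + p + 2) * (betaTwoSup p n φ / g₁ n φ w))

/-- The function `η₁`, where `Wη` stands for `W^η_{p,n}(δ_φ)`. -/
def etaOne (p n : ℕ) (φ : ℝ → ℝ) (Wη : ℝ) (w : ℝ) : ℝ :=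
  min 1 (1 / g₁ n φ w * (g₃ n φ w + (1 + Wη) / ((n : ℝ) + p + 2) * betaTwoSup p n φ))

def xiTwo (p n : ℕ) (φ : ℝ → ℝ) (w : ℝ) : ℝ :=
  min 1 (1 / g₁ n φ w * (betaTwoSup p n φ / ((n : ℝ) + 2)))

def etaTwo (p n : ℕ) (φ : ℝ → ℝ) (w : ℝ) : ℝ :=
  min 1 (1 / g₁ n φ w * (g₃ n φ w + betaTwoSup p n φ / ((n : ℝ) + 2)))

/-- The lower truncation level `(1 / g₁(W)) (1 / n - (1 + W) / (n + p + 1))`. -/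
def level (p n : ℕ) (φ : ℝ → ℝ) (w : ℝ) : ℝ :=
  1 / g₁ n φ w * (1 / (n : ℝ) - (1 + w) / ((n : ℝ) + p + 1))

/-- The truncation `ξ^TR = max(ξ, level)`. -/
def truncXi (p n : ℕ) (φ ξ : ℝ → ℝ) (w : ℝ) : ℝ := max (ξ w) (level p n φ w)

/-- The matrix `X X' / ‖X‖²`. -/
def dirProj {p : ℕ} (x : EuclideanSpace ℝ (Fin p)) : Matrix (Fin p) (Fin p) ℝ :=
  Matrix.of fun i j => x i * x j / ‖x‖ ^ 2

/-- The diagonal entry `l₁(ξ) = 1/n - g₁(W) ξ(W)`. -/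
def ell₁ (n : ℕ) (φ ξ : ℝ → ℝ) (w : ℝ) : ℝ := 1 / (n : ℝ) - g₁ n φ w * ξ w

/-- The diagonal entry `l₀(η) = 1/n - g₁(W) η(W) + g₃(W)`. -/
def ell₀ (n : ℕ) (φ η : ℝ → ℝ) (w : ℝ) : ℝ := 1 / (n : ℝ) - g₁ n φ w * η w + g₃ n φ w

/-- The estimator `M̂(ξ, η; δ_φ) = S Γ' diag(l₀(η), l₁(ξ), …, l₁(ξ)) Γ` of the MSE matrix, where
`Γ` is orthogonal and `Γ X = (‖X‖, 0, …, 0)'`. It is written without `Γ` through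
`Γ' E₁₁ Γ = X X' / ‖X‖²`; the two forms agree by `mHat_eq` below. -/
def mHat {p : ℕ} (n : ℕ) (φ ξ η : ℝ → ℝ) (x : EuclideanSpace ℝ (Fin p)) (s : ℝ) :
    Matrix (Fin p) (Fin p) ℝ :=
  s • (ell₁ n φ ξ (stat x s) • (1 - dirProj x) + ell₀ n φ η (stat x s) • dirProj x)

theorem mHat_eq {p : ℕ} (n : ℕ) (φ ξ η : ℝ → ℝ) (x : EuclideanSpace ℝ (Fin p)) (hx : x ≠ 0)
    (s : ℝ) (i₀ : Fin p) (Γ : Matrix (Fin p) (Fin p) ℝ) (hΓ : Γ.transpose * Γ = 1)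
    (hΓx : Γ.mulVec x.ofLp = Pi.single i₀ ‖x‖) :
    mHat n φ ξ η x s =
      s • (Γ.transpose *
        Matrix.diagonal (fun i =>
          if i = i₀ then ell₀ n φ η (stat x s) else ell₁ n φ ξ (stat x s)) * Γ) := by
  have hn : ‖x‖ ≠ 0 := norm_ne_zero_iff.mpr hx
  have hrow : ∀ i, x i = Γ i₀ i * ‖x‖ := by
    have h : (Γ.transpose * Γ).mulVec x.ofLp = Γ.transpose.mulVec (Pi.single i₀ ‖x‖) := by
      rw [← Matrix.mulVec_mulVec, hΓx]
    rw [hΓ, Matrix.one_mulVec] at h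
    intro i
    have := congrFun h i
    simpa using this
  have hP : dirProj x = Γ.transpose * Matrix.single i₀ i₀ (1 : ℝ) * Γ := by
    ext i j
    rw [Matrix.mul_apply, Finset.sum_eq_single i₀]
    · simp [dirProj, Matrix.mul_apply, hrow i, hrow j, Matrix.single_apply]
      field_simp
    · intro k _ hk
      simp [Matrix.mul_apply, Ne.symm hk]
    · simp
  have hD : Matrix.diagonal (fun i =>
      if i = i₀ then ell₀ n φ η (stat x s) else ell₁ n φ ξ (stat x s)) =
      ell₁ n φ ξ (stat x s) • (1 - Matrix.single i₀ i₀ (1 : ℝ)) +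
        ell₀ n φ η (stat x s) • Matrix.single i₀ i₀ (1 : ℝ) := by
    ext i j
    by_cases hij : i = j
    · subst hij
      by_cases hi : i = i₀
      · subst hi; simp
      · simp [hi, Ne.symm hi]
    · simp only [Matrix.diagonal_apply_ne _ hij, Matrix.add_apply, Matrix.smul_apply,
        Matrix.sub_apply, Matrix.one_apply_ne hij, Matrix.single_apply]
      have : ¬ (i₀ = i ∧ i₀ = j) := fun h => hij (h.1.symm.trans h.2)
      simp [this]
  have key : ∀ (a b : ℝ) (E : Matrix (Fin p) (Fin p) ℝ),
      Γ.transpose * (a • (1 - E) + b • E) * Γ =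
        a • (1 - Γ.transpose * E * Γ) + b • (Γ.transpose * E * Γ) := by
    intro a b E
    simp only [Matrix.mul_add, Matrix.add_mul, Matrix.mul_smul, Matrix.smul_mul, Matrix.mul_sub,
      Matrix.sub_mul, Matrix.mul_one, hΓ]
  rw [mHat, hD, key, hP]

/-- The loss `tr (A - M(δ_φ))²` of an estimate `A` of the MSE matrix of `δ_φ`. -/
def loss {p : ℕ} (n : ℕ) (φ : ℝ → ℝ) (θ : EuclideanSpace ℝ (Fin p)) (σ2 : ℝ)
    (A : Matrix (Fin p) (Fin p) ℝ) : ℝ :=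
  ((A - mseMatrix n (shrink φ) θ σ2) ^ 2).trace

/-- The risk (expected loss, possibly infinite) of an estimator `A(X, S)` of the MSE matrix. -/
def risk {p : ℕ} (n : ℕ) (φ : ℝ → ℝ)
    (A : EuclideanSpace ℝ (Fin p) → ℝ → Matrix (Fin p) (Fin p) ℝ)
    (θ : EuclideanSpace ℝ (Fin p)) (σ2 : ℝ) : ℝ≥0∞ :=
  ∫⁻ z, ENNReal.ofReal (loss n φ θ σ2 (A z.1 z.2)) ∂(model n θ σ2)

/-- `A` improves on `B`: its risk is nowhere larger. -/
def ImprovesOn {p : ℕ} (n : ℕ) (φ : ℝ → ℝ)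
    (A B : EuclideanSpace ℝ (Fin p) → ℝ → Matrix (Fin p) (Fin p) ℝ) : Prop :=
  ∀ (θ : EuclideanSpace ℝ (Fin p)) (σ2 : ℝ), 0 < σ2 → risk n φ A θ σ2 ≤ risk n φ B θ σ2

/-- `A` improves strictly on `B` at every parameter value: the loss saved by `A` is integrable with
positive expectation, and the risk of `A` is strictly smaller wherever that of `B` is finite. -/
def StrictlyImprovesOn {p : ℕ} (n : ℕ) (φ : ℝ → ℝ)
    (A B : EuclideanSpace ℝ (Fin p) → ℝ → Matrix (Fin p) (Fin p) ℝ) : Prop :=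
  ∀ (θ : EuclideanSpace ℝ (Fin p)) (σ2 : ℝ), 0 < σ2 →
    Integrable (fun z => loss n φ θ σ2 (B z.1 z.2) - loss n φ θ σ2 (A z.1 z.2)) (model n θ σ2) ∧
    0 < ∫ z, (loss n φ θ σ2 (B z.1 z.2) - loss n φ θ σ2 (A z.1 z.2)) ∂(model n θ σ2) ∧
    (risk n φ B θ σ2 ≠ ∞ → risk n φ A θ σ2 < risk n φ B θ σ2)

end ShrinkageMSE

end

open ShrinkageMSE

/-! Let P = XX'/‖X‖² and Q = I - P. Since QP = 0, the loss of S(aQ + cP) is a quadratic in a plus a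
term in c alone, so the entry with η cancels from the comparison (`loss_mHat_sub`). Truncation
lowers a = l₁ by a gap D(W) ≥ 0, and wherever D > 0 the new entry is exactly (1 + W)/(n + p + 1),
which times S is (‖X‖² + S)/(n + p + 1). The loss saved is therefore S·D·[(p - 1)(2(‖X‖² + S)/(n + p
+ 1) + S·D) - 2 tr(QM)] (`lossGain`), and two facts make its expectation nonnegative.

The first is tr(QM) ≤ (p - 1)σ² for every X ≠ 0 (`trace_compl_dirProj_mul_le`). By rotational
symmetry about θ, M has an eigenvalue λ₀ along θ and an eigenvalue λ₁ across it, so tr(QM) is a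
convex combination of (p - 1)λ₁ and λ₀ + (p - 2)λ₁. The noncentral model is a Poisson mixture of
central ones with p + 2j degrees of freedom. Through it and an integration by parts
(`integral_betaTwo`), for σ² = 1 these two numbers fall short of p - 1 by (p - 1) times the mixture
of the β⁽²⁾(j) and by the mixture of the β⁽¹⁾(j), respectively. The β⁽¹⁾(j) are nonnegative by
hypothesis. The β⁽²⁾(j) follow from β⁽¹⁾(j) = (p + 2j - 1)β⁽²⁾(j) - 4j E[φ(W)/W], because g₁ > 0
forces E[φ(W)/W] ≥ 0 (`integral_div_nonneg`).

The second is E[S·D(W)(‖X‖² + S - (n + p + 1)σ²)] ≥ 0. For σ² = 1, in the j-th mixture component u +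
v is independent of u/v, and weighting with v replaces its mean by p + 2j + n + 2. That component
thus contributes 2j + 1 times E[v D(u/v)] (`integral_dilation`). The term j = 0 always carries
positive weight, which gives strictness once D > 0 on an interval.

All that is used of ξ₁ and ξ₂ is g₁ξ = min(g₁, κ) with a constant κ ≥ 0 (`truncXi_improves`). -/

namespace ShrinkageMSE

/-! ### Gaussian densities, polar coordinates and chi-square laws -/

section GaussianDensity

variable {E : Type*} [NormedAddCommGroup E] [InnerProductSpace ℝ E] [FiniteDimensional ℝ E]
  [MeasurableSpace E] [BorelSpace E]

/-- The normalising constant of the standard Gaussian density in dimension `d`. -/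
noncomputable def gaussConst (d : ℕ) : ℝ := (2 * Real.pi) ^ (-((d : ℝ) / 2))

lemma gaussConst_pos (d : ℕ) : 0 < gaussConst d := by unfold gaussConst; positivity

lemma integrable_exp_neg_half_sq_norm :
    Integrable (fun x : E => Real.exp (-‖x‖ ^ 2 / 2)) := by
  have h := (GaussianFourier.integrable_cexp_neg_mul_sq_norm_add (V := E) (b := 1 / 2)
    (by norm_num) 0 0).norm
  refine h.congr (Filter.Eventually.of_forall fun x => ?_)
  simp only [Complex.norm_exp]
  congr 1
  simp [← Complex.ofReal_pow]
  ring

/-- The standard Gaussian measure in terms of its Lebesgue density. -/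
lemma stdGaussian_eq_withDensity :
    stdGaussian E = (volume : Measure E).withDensity
      (fun x => ENNReal.ofReal (gaussConst (Module.finrank ℝ E) * Real.exp (-‖x‖ ^ 2 / 2))) := by
  set d := Module.finrank ℝ E
  have hint : Integrable (fun x : E => gaussConst d * Real.exp (-‖x‖ ^ 2 / 2)) :=
    integrable_exp_neg_half_sq_norm.const_mul _
  have : IsFiniteMeasure ((volume : Measure E).withDensity
      (fun x => ENNReal.ofReal (gaussConst d * Real.exp (-‖x‖ ^ 2 / 2)))) :=
    isFiniteMeasure_withDensity_ofReal hint.2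
  -- The two measures are compared through characteristic functions, which is why finiteness of the
  -- weighted Lebesgue measure is needed beforehand.
  apply Measure.ext_of_charFun
  ext t
  rw [charFun_stdGaussian, charFun_apply, integral_withDensity_eq_integral_toReal_smul
    (by fun_prop) (Filter.Eventually.of_forall fun _ => ENNReal.ofReal_lt_top)]
  have hpos := gaussConst_pos d
  have h := GaussianFourier.integral_cexp_neg_mul_sq_norm_add (V := E) (b := 1 / 2)
    (by norm_num) Complex.I t
  have e : ∀ x : E, (ENNReal.ofReal (gaussConst d * Real.exp (-‖x‖ ^ 2 / 2))).toReal •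
      Complex.exp (inner ℝ x t * Complex.I) = (gaussConst d : ℂ) *
        Complex.exp (-(1 / 2 : ℂ) * ‖x‖ ^ 2 + Complex.I * inner ℝ t x) := by
    intro x
    rw [ENNReal.toReal_ofReal (by positivity), Complex.real_smul, Complex.exp_add,
      real_inner_comm]
    push_cast
    ring_nf
  simp_rw [e]
  rw [integral_const_mul, h, gaussConst]
  have h2 : ((Real.pi : ℂ) / (1 / 2)) = ((2 * Real.pi : ℝ) : ℂ) := by push_cast; ring
  rw [h2, ← mul_assoc]
  have h3 : (((2 * Real.pi : ℝ) : ℂ) ^ ((Module.finrank ℝ E : ℂ) / 2)) =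
      (((2 * Real.pi) ^ ((d : ℝ) / 2) : ℝ) : ℂ) := by
    rw [Complex.ofReal_cpow (by positivity)]; simp [d]
  rw [h3, ← Complex.ofReal_mul, ← Real.rpow_add (by positivity)]
  simp
  ring_nf

/-- Completing the square, ‖x - θ‖² = ‖x‖² - 2⟨x, θ⟩ + ‖θ‖². This exponential tilt moves every
noncentral expectation to the central law, where it can be expanded in powers of ⟨x, θ⟩. -/
lemma map_add_stdGaussian (θ : E) :
    (stdGaussian E).map (fun x => θ + x) = (stdGaussian E).withDensity
      (fun x => ENNReal.ofReal (Real.exp (inner ℝ x θ - ‖θ‖ ^ 2 / 2))) := by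
  have hpos := gaussConst_pos (Module.finrank ℝ E)
  ext s hs
  rw [Measure.map_apply (by fun_prop) hs, withDensity_apply _ hs, stdGaussian_eq_withDensity,
    withDensity_apply _ (by measurability), setLIntegral_withDensity_eq_setLIntegral_mul _
      (by fun_prop) (by fun_prop) hs, ← lintegral_indicator (by measurability),
    ← lintegral_indicator hs, ← lintegral_add_left_eq_self _ (-θ)]
  refine lintegral_congr fun x => ?_
  by_cases hx : x ∈ s
  · rw [indicator_of_mem (by simpa using hx), indicator_of_mem hx, Pi.mul_apply,
      ← ENNReal.ofReal_mul (by positivity), mul_assoc, ← Real.exp_add]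
    congr 3
    rw [← sub_eq_neg_add, norm_sub_sq_real]
    ring
  · rw [indicator_of_notMem (by simpa using hx), indicator_of_notMem hx]

lemma polar_lintegral [Nontrivial E] (F : E → ℝ≥0∞) (hF : Measurable F) :
    ∫⁻ x, F x = ∫⁻ ω, (∫⁻ r in Ioi (0 : ℝ),
      ENNReal.ofReal (r ^ (Module.finrank ℝ E - 1)) * F (r • (ω : E)))
        ∂((volume : Measure E).toSphere) := by
  have h := (volume : Measure E).measurePreserving_homeomorphUnitSphereProd
  conv_lhs => rw [← restrict_compl_singleton (μ := volume) (0 : E),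
    ← lintegral_subtype_comap (measurableSet_singleton _).compl]
  have h1 := h.lintegral_comp_emb (Homeomorph.measurableEmbedding _)
    (fun y => F ((y.2 : ℝ) • (y.1 : E)))
  have h2 : ∀ x : ({(0 : E)}ᶜ : Set E), F x = F (((homeomorphUnitSphereProd E x).2 : ℝ) •
      ((homeomorphUnitSphereProd E x).1 : E)) := by
    intro x
    have : ‖(x : E)‖ ≠ 0 := norm_ne_zero_iff.2 x.2
    simp [smul_smul, this]
  rw [lintegral_congr h2, h1, lintegral_prod _ (by fun_prop)]
  refine lintegral_congr fun ω => ?_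
  rw [Measure.volumeIoiPow, lintegral_withDensity_eq_lintegral_mul _ (by fun_prop) (by fun_prop),
    ← lintegral_subtype_comap measurableSet_Ioi]
  rfl

/-- The normalising constant of the `χ²_k` density. -/
noncomputable def chiConst (k : ℕ) : ℝ := (1 / 2) ^ ((k : ℝ) / 2) / Real.Gamma ((k : ℝ) / 2)

lemma chiConst_pos {k : ℕ} (hk : 0 < k) : 0 < chiConst k := by
  have : 0 < Real.Gamma ((k : ℝ) / 2) := Real.Gamma_pos_of_pos (by positivity)
  unfold chiConst
  positivity

lemma chiSq_eq_withDensity (k : ℕ) :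
    chiSq k = (volume.restrict (Ioi (0 : ℝ))).withDensity
      (fun u => ENNReal.ofReal (chiConst k * (u ^ ((k : ℝ) / 2 - 1) * Real.exp (-u / 2)))) := by
  rw [chiSq, gammaMeasure, ← withDensity_indicator measurableSet_Ioi]
  refine withDensity_congr_ae ?_
  have h0 : ∀ᵐ u : ℝ, u ≠ 0 := by simp [ae_iff]
  filter_upwards [h0] with u hu
  rcases lt_or_gt_of_ne hu with h | h
  · rw [gammaPDF_of_neg h, indicator_of_notMem (by simpa using h.le)]
  · rw [gammaPDF_of_nonneg h.le, indicator_of_mem (by simpa using h), chiConst]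
    congr 1
    rw [show -(1 / 2 * u) = -u / 2 by ring]
    ring

lemma isProbabilityMeasure_chiSq {k : ℕ} (hk : 0 < k) : IsProbabilityMeasure (chiSq k) :=
  isProbabilityMeasure_gammaMeasure (by positivity) (by norm_num)

instance sFinite_chiSq (k : ℕ) : SFinite (chiSq k) := by
  rw [chiSq_eq_withDensity]; infer_instance

lemma ae_pos_chiSq (k : ℕ) : ∀ᵐ u ∂(chiSq k), 0 < u := by
  rw [chiSq_eq_withDensity]
  exact (withDensity_absolutelyContinuous _ _).ae_le (ae_restrict_mem measurableSet_Ioi)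

/-- The substitution u = r² puts the chi-square law in the form in which a radial integral in polar
coordinates produces it. -/
lemma chiSq_apply_eq_lintegral_sq (k : ℕ) (s : Set ℝ) (hs : MeasurableSet s) :
    chiSq k s = ∫⁻ r in Ioi (0 : ℝ), s.indicator 1 (r ^ 2) *
      ENNReal.ofReal (2 * chiConst k * (r ^ ((k : ℝ) - 1) * Real.exp (-r ^ 2 / 2))) := by
  have himg : (fun r : ℝ => r ^ 2) '' Ioi 0 = Ioi 0 := by
    ext u
    constructor
    · rintro ⟨r, hr, rfl⟩
      have : (0 : ℝ) < r := hr
      exact pow_pos this 2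
    · intro hu
      exact ⟨√u, Real.sqrt_pos.2 hu, Real.sq_sqrt (le_of_lt hu)⟩
  rw [chiSq_eq_withDensity, withDensity_apply _ hs, ← lintegral_indicator hs]
  conv_lhs => rw [← himg]
  rw [lintegral_image_eq_lintegral_abs_deriv_mul measurableSet_Ioi
    (f' := fun r => 2 * r) (fun r _ => by
      simpa using (hasDerivAt_pow 2 r).hasDerivWithinAt)
    (fun a ha b hb h => by
      have ha' : (0 : ℝ) < a := ha
      have hb' : (0 : ℝ) < b := hb
      exact (pow_left_inj₀ ha'.le hb'.le two_ne_zero).1 h)]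
  refine setLIntegral_congr_fun measurableSet_Ioi fun r hr => ?_
  have hr' : (0 : ℝ) < r := hr
  by_cases h : r ^ 2 ∈ s
  · simp only [indicator_of_mem h, Pi.one_apply, one_mul]
    rw [← ENNReal.ofReal_mul (by positivity), abs_of_pos (by positivity),
      ← Real.rpow_natCast r 2, ← Real.rpow_mul hr'.le]
    congr 1
    have : r * r ^ ((2 : ℕ) * ((k : ℝ) / 2 - 1)) = r ^ ((k : ℝ) - 1) := by
      nth_rewrite 1 [← Real.rpow_one r]
      rw [← Real.rpow_add hr']
      congr 1; push_cast; ring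
    rw [← this]
    ring
  · simp [indicator_of_notMem h]

/-- Under the standard Gaussian measure weighted with `⟨x, e⟩^{2j}`, the squared norm is
proportional to a chi-square variable with `2j` additional degrees of freedom. -/
lemma exists_map_normSq_withDensity [Nontrivial E] (e : E) (j : ℕ) :
    ∃ D : ℝ≥0∞, ((stdGaussian E).withDensity
      (fun x => ENNReal.ofReal ((inner ℝ x e) ^ (2 * j)))).map (fun x => ‖x‖ ^ 2) =
        D • chiSq (Module.finrank ℝ E + 2 * j) := by
  set d := Module.finrank ℝ E with hd
  have hdpos : 0 < d := Module.finrank_pos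
  have hcc := chiConst_pos (k := d + 2 * j) (by omega)
  have hg := gaussConst_pos d
  -- The angular integral times the quotient of the radial normalising constants. Its value is found
  -- later by comparing total masses.
  refine ⟨(∫⁻ ω : Metric.sphere (0 : E) 1, ENNReal.ofReal ((inner ℝ (ω : E) e) ^ (2 * j))
    ∂((volume : Measure E).toSphere)) *
      ENNReal.ofReal (gaussConst d / (2 * chiConst (d + 2 * j))), ?_⟩
  ext s hs
  have hpre : MeasurableSet ((fun x : E => ‖x‖ ^ 2) ⁻¹' s) :=
    (by fun_prop : Measurable fun x : E => ‖x‖ ^ 2) hs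
  have hind : Measurable (s.indicator (1 : ℝ → ℝ≥0∞)) := measurable_one.indicator hs
  rw [Measure.map_apply (by fun_prop) hs, withDensity_apply _ hpre, stdGaussian_eq_withDensity,
    setLIntegral_withDensity_eq_setLIntegral_mul _ (by fun_prop) (by fun_prop) hpre,
    ← lintegral_indicator hpre, Measure.smul_apply, chiSq_apply_eq_lintegral_sq _ _ hs,
    smul_eq_mul, mul_assoc, ← lintegral_const_mul _ (by fun_prop),
    ← lintegral_mul_const _ (by fun_prop)]
  rw [polar_lintegral _ (Measurable.indicator (by fun_prop) hpre)]
  refine lintegral_congr fun ω => ?_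
  rw [← lintegral_const_mul _ (by fun_prop)]
  refine setLIntegral_congr_fun measurableSet_Ioi fun r hr => ?_
  have hr' : (0 : ℝ) < r := hr
  have hω : ‖(ω : E)‖ = 1 := by simp
  have hn : ‖r • (ω : E)‖ ^ 2 = r ^ 2 := by rw [norm_smul, hω]; simp
  have hev : Even (2 * j) := even_two_mul j
  by_cases h : r ^ 2 ∈ s
  · rw [indicator_of_mem (by simpa [hn] using h), indicator_of_mem h]
    simp only [Pi.mul_apply, Pi.one_apply, one_mul]
    rw [neg_div, hn, real_inner_smul_left, mul_pow]
    rw [← ENNReal.ofReal_mul (by positivity), ← ENNReal.ofReal_mul (by positivity),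
      ← ENNReal.ofReal_mul (by positivity), ← ENNReal.ofReal_mul (hev.pow_nonneg _)]
    congr 1
    -- The polar Jacobian contributes r^(d-1) and the homogeneous weight r^(2j), together the radial
    -- density for d + 2j degrees of freedom.
    have : r ^ (((d + 2 * j : ℕ) : ℝ) - 1) = r ^ (d - 1) * r ^ (2 * j) := by
      rw [← pow_add, ← Real.rpow_natCast]
      congr 1
      push_cast [Nat.cast_sub (show 1 ≤ d from hdpos)]
      ring
    rw [this, ← hd]
    field_simp
  · rw [indicator_of_notMem (by simpa [hn] using h), indicator_of_notMem h]
    simp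

/-- The even moments of the standard normal distribution. -/
noncomputable def evenMoment (j : ℕ) : ℝ := ∫ y, y ^ (2 * j) ∂(gaussianReal 0 1)

lemma evenMoment_nonneg (j : ℕ) : 0 ≤ evenMoment j :=
  integral_nonneg fun y => (even_two_mul j).pow_nonneg y

@[simp]
lemma evenMoment_zero : evenMoment 0 = 1 := by simp [evenMoment]

lemma evenMoment_eq_Gamma (j : ℕ) :
    evenMoment j = (√(2 * Real.pi))⁻¹ * ((1 / 2 : ℝ) ^ (-((j : ℝ) + 1 / 2)) *
      Real.Gamma ((j : ℝ) + 1 / 2)) := by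
  have h := integral_rpow_mul_exp_neg_mul_rpow (p := 2) (q := 2 * j) (b := 1 / 2) (by norm_num)
    (by have : (0 : ℝ) ≤ j := Nat.cast_nonneg j
        linarith) (by norm_num)
  have h2 := integral_comp_abs (f := fun x : ℝ => x ^ (2 * j) * Real.exp (-x ^ 2 / 2))
  have h3 : ∫ x in Ioi (0 : ℝ), x ^ (2 * j) * Real.exp (-x ^ 2 / 2) =
      ∫ x in Ioi (0 : ℝ), x ^ (2 * j : ℝ) * Real.exp (-(1 / 2) * x ^ (2 : ℝ)) := by
    refine setIntegral_congr_fun measurableSet_Ioi fun x hx => ?_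
    rw [Real.rpow_two, ← Real.rpow_natCast]
    push_cast
    ring_nf
  rw [evenMoment, integral_gaussianReal_eq_integral_smul (by norm_num)]
  have h4 : ∀ x : ℝ, gaussianPDFReal 0 1 x • x ^ (2 * j) =
      (√(2 * Real.pi))⁻¹ * (|x| ^ (2 * j) * Real.exp (-|x| ^ 2 / 2)) := by
    intro x
    rw [gaussianPDFReal, (even_two_mul j).pow_abs, sq_abs]
    simp
    ring
  simp_rw [h4]
  rw [integral_const_mul, h2, h3, h]
  rw [show -(2 * (j : ℝ) + 1) / 2 = -((j : ℝ) + 1 / 2) by ring,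
    show (2 * (j : ℝ) + 1) / 2 = (j : ℝ) + 1 / 2 by ring]
  ring

lemma evenMoment_succ (j : ℕ) : evenMoment (j + 1) = (2 * j + 1) * evenMoment j := by
  have hj : (j : ℝ) + 1 / 2 ≠ 0 := by positivity
  rw [evenMoment_eq_Gamma, evenMoment_eq_Gamma]
  push_cast
  rw [show (j : ℝ) + 1 + 1 / 2 = (j + 1 / 2) + 1 by ring, Real.Gamma_add_one hj,
    show -((j : ℝ) + 1 / 2 + 1) = -(j + 1 / 2) + (-1) by ring, Real.rpow_add (by norm_num)]
  norm_num
  ring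

lemma map_inner_stdGaussian {e : E} (he : ‖e‖ = 1) :
    (stdGaussian E).map (fun x => inner ℝ x e) = gaussianReal 0 1 := by
  have h := IsGaussian.map_eq_gaussianReal (μ := stdGaussian E) (innerSL ℝ e)
  rw [integral_strongDual_stdGaussian, variance_dual_stdGaussian, innerSL_apply_norm, he] at h
  simp only [one_pow, Real.toNNReal_one] at h
  rw [← h]
  congr 1
  ext x
  simp [real_inner_comm]

/-- Under the standard Gaussian measure weighted with `⟨x, e⟩^{2j}`, the squared norm is
proportional to a chi-square variable with `2j` additional degrees of freedom. -/
lemma map_normSq_withDensity [Nontrivial E] {e : E} (he : ‖e‖ = 1) (j : ℕ) :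
    ((stdGaussian E).withDensity
      (fun x => ENNReal.ofReal ((inner ℝ x e) ^ (2 * j)))).map (fun x => ‖x‖ ^ 2) =
        ENNReal.ofReal (evenMoment j) • chiSq (Module.finrank ℝ E + 2 * j) := by
  obtain ⟨D, hD⟩ := exists_map_normSq_withDensity e j
  have hdpos : 0 < Module.finrank ℝ E := Module.finrank_pos
  have := isProbabilityMeasure_chiSq (k := Module.finrank ℝ E + 2 * j) (by omega)
  -- The chi-square law has mass one, so D is the total mass E⟨x, e⟩^(2j), a moment of the
  -- one-dimensional standard normal law.
  have h1 : D = ENNReal.ofReal (evenMoment j) := by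
    have h := congrArg (fun μ => μ univ) hD
    simp only [Measure.smul_apply, measure_univ, smul_eq_mul, mul_one] at h
    rw [← h, Measure.map_apply (by fun_prop) MeasurableSet.univ, preimage_univ,
      withDensity_apply _ MeasurableSet.univ, Measure.restrict_univ, evenMoment,
      ← map_inner_stdGaussian he, integral_map (by fun_prop) (by fun_prop),
      ofReal_integral_eq_lintegral_ofReal]
    · have h5 : Integrable (fun y : ℝ => y ^ (2 * j)) (gaussianReal 0 1) := by
        have := (memLp_id_gaussianReal (μ := 0) (v := 1) ((2 * j : ℕ) : ℝ≥0)).integrable_norm_pow'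
        refine (integrable_norm_iff (by fun_prop)).1 ?_
        simpa using this
      rw [← map_inner_stdGaussian he] at h5
      exact h5.comp_measurable (by fun_prop)
    · exact Filter.Eventually.of_forall fun x => (even_two_mul j).pow_nonneg _
  rw [hD, h1]

end GaussianDensity

end ShrinkageMSE

namespace ShrinkageMSE

/-! ### The model: exponential tilt, scaling, dominating functions -/

section Model

variable {p : ℕ}

open scoped MatrixOrder in
lemma multivariateGaussian_smul_one (θ : EuclideanSpace ℝ (Fin p)) {σ2 : ℝ} (hσ : 0 < σ2) :
    multivariateGaussian θ (σ2 • (1 : Matrix (Fin p) (Fin p) ℝ)) =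
      (stdGaussian (EuclideanSpace ℝ (Fin p))).map (fun x => θ + √σ2 • x) := by
  have h : CFC.sqrt (σ2 • (1 : Matrix (Fin p) (Fin p) ℝ)) = √σ2 • 1 := by
    refine CFC.sqrt_unique ?_ ?_
    · rw [smul_mul_smul_comm, Real.mul_self_sqrt hσ.le, one_mul]
    · exact (Matrix.PosSemidef.one.smul (Real.sqrt_nonneg _)).nonneg
  rw [multivariateGaussian, h]
  congr 1
  ext x : 1
  simp

lemma model_eq_map (n : ℕ) (θ : EuclideanSpace ℝ (Fin p)) {σ2 : ℝ} (hσ : 0 < σ2) :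
    model n θ σ2 = ((stdGaussian (EuclideanSpace ℝ (Fin p))).prod (chiSq n)).map
      (fun z => (θ + √σ2 • z.1, σ2 * z.2)) := by
  rw [model, multivariateGaussian_smul_one θ hσ, Measure.map_prod_map _ _ (by fun_prop)
    (by fun_prop)]
  rfl

/-- The model with unit variance, in terms of its density with respect to the central one. -/
lemma model_one_eq_withDensity (n : ℕ) (θ : EuclideanSpace ℝ (Fin p)) :
    model n θ 1 = ((stdGaussian (EuclideanSpace ℝ (Fin p))).prod (chiSq n)).withDensity
      (fun z => ENNReal.ofReal (Real.exp (inner ℝ z.1 θ - ‖θ‖ ^ 2 / 2))) := by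
  rw [model, multivariateGaussian_smul_one θ one_pos]
  simp only [Real.sqrt_one, one_smul, one_mul, Measure.map_id']
  rw [map_add_stdGaussian, prod_withDensity_left (by fun_prop)]

lemma integral_model_one {F : Type*} [NormedAddCommGroup F] [NormedSpace ℝ F] (n : ℕ)
    (θ : EuclideanSpace ℝ (Fin p)) (f : EuclideanSpace ℝ (Fin p) × ℝ → F) :
    ∫ z, f z ∂(model n θ 1) = ∫ z, Real.exp (inner ℝ z.1 θ - ‖θ‖ ^ 2 / 2) • f z
      ∂((stdGaussian (EuclideanSpace ℝ (Fin p))).prod (chiSq n)) := by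
  rw [model_one_eq_withDensity, integral_withDensity_eq_integral_toReal_smul (by fun_prop)
    (Filter.Eventually.of_forall fun _ => ENNReal.ofReal_lt_top)]
  simp_rw [ENNReal.toReal_ofReal (Real.exp_pos _).le]

lemma integrable_model_one_iff (n : ℕ)
    (θ : EuclideanSpace ℝ (Fin p)) (f : EuclideanSpace ℝ (Fin p) × ℝ → ℝ) :
    Integrable f (model n θ 1) ↔
      Integrable (fun z => Real.exp (inner ℝ z.1 θ - ‖θ‖ ^ 2 / 2) * f z)
        ((stdGaussian (EuclideanSpace ℝ (Fin p))).prod (chiSq n)) := by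
  rw [model_one_eq_withDensity, integrable_withDensity_iff_integrable_smul₀' (by fun_prop)
    (Filter.Eventually.of_forall fun _ => ENNReal.ofReal_lt_top)]
  simp_rw [ENNReal.toReal_ofReal (Real.exp_pos _).le, smul_eq_mul]

/-- Scale equivariance. Since W is invariant under this scaling, all the estimates below can be made
for unit variance. -/
lemma model_eq_map_model_one (n : ℕ) (θ : EuclideanSpace ℝ (Fin p)) {σ2 : ℝ} (hσ : 0 < σ2) :
    model n θ σ2 = (model n ((√σ2)⁻¹ • θ) 1).map (fun z => (√σ2 • z.1, σ2 * z.2)) := by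
  have hs : √σ2 ≠ 0 := (Real.sqrt_pos.2 hσ).ne'
  rw [model_eq_map n θ hσ, model_eq_map n _ one_pos, Measure.map_map (by fun_prop) (by fun_prop)]
  congr 1
  ext z
  · simp [smul_smul, hs]
  · simp

lemma measurableEmbedding_scale {σ2 : ℝ} (hσ : 0 < σ2) :
    MeasurableEmbedding (fun z : EuclideanSpace ℝ (Fin p) × ℝ => (√σ2 • z.1, σ2 * z.2)) :=
  (measurableEmbedding_const_smul₀ (Real.sqrt_pos.2 hσ).ne').prodMap
    (measurableEmbedding_mulLeft₀ hσ.ne')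

lemma isProbabilityMeasure_model {n : ℕ} (hn : 1 ≤ n) (θ : EuclideanSpace ℝ (Fin p)) {σ2 : ℝ}
    (hσ : 0 < σ2) : IsProbabilityMeasure (model n θ σ2) := by
  have := isProbabilityMeasure_chiSq (k := n) hn
  rw [model_eq_map n θ hσ]
  exact Measure.isProbabilityMeasure_map (by fun_prop)

lemma ae_ne_zero_stdGaussian (hp : 1 ≤ p) :
    ∀ᵐ x ∂(stdGaussian (EuclideanSpace ℝ (Fin p))), x ≠ 0 := by
  have : NeZero p := ⟨by omega⟩
  rw [stdGaussian_eq_withDensity]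
  refine (withDensity_absolutelyContinuous _ _).ae_le ?_
  exact compl_mem_ae_iff.2 (measure_singleton _)

lemma ae_prod_pos (hp : 1 ≤ p) (n : ℕ) :
    ∀ᵐ z ∂((stdGaussian (EuclideanSpace ℝ (Fin p))).prod (chiSq n)), z.1 ≠ 0 ∧ 0 < z.2 := by
  have h1 : ∀ᵐ z ∂((stdGaussian (EuclideanSpace ℝ (Fin p))).prod (chiSq n)), z.1 ≠ 0 :=
    Measure.quasiMeasurePreserving_fst.ae (ae_ne_zero_stdGaussian hp)
  have h2 : ∀ᵐ z ∂((stdGaussian (EuclideanSpace ℝ (Fin p))).prod (chiSq n)), 0 < z.2 :=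
    Measure.quasiMeasurePreserving_snd.ae (ae_pos_chiSq n)
  exact h1.and h2

lemma ae_model_pos (hp : 1 ≤ p) (n : ℕ) (θ : EuclideanSpace ℝ (Fin p)) {σ2 : ℝ} (hσ : 0 < σ2) :
    ∀ᵐ z ∂(model n θ σ2), z.1 ≠ 0 ∧ 0 < z.2 := by
  rw [model_eq_map_model_one n θ hσ, (measurableEmbedding_scale hσ).ae_map_iff,
    model_one_eq_withDensity]
  refine (withDensity_absolutelyContinuous _ _).ae_le ?_
  filter_upwards [ae_prod_pos hp n] with z hz
  exact ⟨smul_ne_zero (Real.sqrt_pos.2 hσ).ne' hz.1, mul_pos hσ hz.2⟩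

lemma integrable_rpow_chiSq {k : ℕ} {a : ℝ} (ha : 0 < (k : ℝ) / 2 + a) :
    Integrable (fun u => u ^ a) (chiSq k) := by
  rw [chiSq_eq_withDensity, integrable_withDensity_iff_integrable_smul₀' (by fun_prop)
    (Filter.Eventually.of_forall fun _ => ENNReal.ofReal_lt_top)]
  have h := (integrableOn_rpow_mul_exp_neg_mul_rpow (p := 1) (s := (k : ℝ) / 2 - 1 + a)
    (b := 1 / 2) (by linarith) one_pos (by norm_num)).const_mul |chiConst k|
  refine Integrable.mono h (by fun_prop) ?_
  filter_upwards [ae_restrict_mem measurableSet_Ioi] with u hu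
  have hu' : (0 : ℝ) < u := hu
  rw [smul_eq_mul, norm_mul, norm_mul, Real.norm_eq_abs (|chiConst k|), abs_abs]
  rw [Real.norm_of_nonneg ENNReal.toReal_nonneg, Real.norm_of_nonneg (by positivity),
    Real.norm_of_nonneg (by positivity), Real.rpow_one, Real.rpow_add hu']
  have : (ENNReal.ofReal (chiConst k * (u ^ ((k : ℝ) / 2 - 1) * Real.exp (-u / 2)))).toReal ≤
      |chiConst k| * (u ^ ((k : ℝ) / 2 - 1) * Real.exp (-u / 2)) := by
    rw [ENNReal.toReal_ofReal']
    refine max_le ?_ (by positivity)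
    gcongr
    exact le_abs_self _
  calc _ ≤ |chiConst k| * (u ^ ((k : ℝ) / 2 - 1) * Real.exp (-u / 2)) * u ^ a := by gcongr
    _ = _ := by ring_nf

lemma integrable_one_add_sq_chiSq {n : ℕ} (hn : 1 ≤ n) :
    Integrable (fun s => 1 + s ^ 2) (chiSq n) := by
  have := isProbabilityMeasure_chiSq (k := n) hn
  have hn' : (0 : ℝ) < n := by exact_mod_cast hn
  refine (integrable_const 1).add ?_
  have h := integrable_rpow_chiSq (k := n) (a := 2) (by positivity)
  simpa using h

/-- In polar coordinates the singularity 1/‖x‖² turns r^(p-1) into r^(p-3), harmless for p ≥ 3, and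
the Gaussian factor beats the exponential. -/
lemma integrable_exp_norm_stdGaussian (hp : 3 ≤ p) (c : ℝ) :
    Integrable (fun x => (1 + 1 / ‖x‖ ^ 2) * Real.exp (c * ‖x‖))
      (stdGaussian (EuclideanSpace ℝ (Fin p))) := by
  have : NeZero p := ⟨by omega⟩
  have hg := gaussConst_pos p
  rw [stdGaussian_eq_withDensity, integrable_withDensity_iff_integrable_smul₀' (by fun_prop)
    (Filter.Eventually.of_forall fun _ => ENNReal.ofReal_lt_top), finrank_euclideanSpace_fin]
  have h := integrable_fun_norm_addHaar (volume : Measure (EuclideanSpace ℝ (Fin p)))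
    (f := fun r => gaussConst p * Real.exp (-r ^ 2 / 2) * ((1 + 1 / r ^ 2) * Real.exp (c * r)))
  rw [finrank_euclideanSpace_fin] at h
  refine (h.2 ?_).congr (Filter.Eventually.of_forall fun x => ?_)
  · have h1 := integrableOn_rpow_mul_exp_neg_mul_sq (b := 1 / 4) (by norm_num)
      (s := (p : ℝ) - 1) (by have : (3 : ℝ) ≤ p := by exact_mod_cast hp
                             linarith)
    have h2 := integrableOn_rpow_mul_exp_neg_mul_sq (b := 1 / 4) (by norm_num)
      (s := (p : ℝ) - 3) (by have : (3 : ℝ) ≤ p := by exact_mod_cast hp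
                             linarith)
    refine Integrable.mono' ((h1.add h2).const_mul (gaussConst p * Real.exp (c ^ 2)))
      (by fun_prop) ?_
    filter_upwards [ae_restrict_mem measurableSet_Ioi] with r hr
    have hr' : (0 : ℝ) < r := hr
    have e1 : r ^ ((p : ℝ) - 1) = r ^ (p - 1) := by
      rw [← Real.rpow_natCast]
      push_cast [Nat.cast_sub (show 1 ≤ p by omega)]
      rfl
    have e2 : r ^ ((p : ℝ) - 3) * r ^ 2 = r ^ (p - 1) := by
      rw [← Real.rpow_natCast, ← Real.rpow_natCast, ← Real.rpow_add hr']
      push_cast [Nat.cast_sub (show 1 ≤ p by omega)]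
      ring_nf
    rw [Real.norm_of_nonneg (by positivity), smul_eq_mul, Pi.add_apply, e1, ← e2]
    -- From (c - r/2)² ≥ 0: half of the Gaussian exponent absorbs the linear term.
    have e3 : Real.exp (-r ^ 2 / 2) * Real.exp (c * r) ≤
        Real.exp (c ^ 2) * Real.exp (-(1 / 4) * r ^ 2) := by
      rw [← Real.exp_add, ← Real.exp_add]
      refine Real.exp_le_exp.2 ?_
      nlinarith [sq_nonneg (c - r / 2)]
    calc _ = gaussConst p * (r ^ ((p : ℝ) - 3) * (r ^ 2 + 1)) *
          (Real.exp (-r ^ 2 / 2) * Real.exp (c * r)) := by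
            field_simp
      _ ≤ gaussConst p * (r ^ ((p : ℝ) - 3) * (r ^ 2 + 1)) *
          (Real.exp (c ^ 2) * Real.exp (-(1 / 4) * r ^ 2)) := by gcongr
      _ = _ := by ring
  · simp only [smul_eq_mul]
    rw [ENNReal.toReal_ofReal (by positivity)]

/-- A dominating function, integrable under the central unit variance model. -/
noncomputable def envelope (c : ℝ) (z : EuclideanSpace ℝ (Fin p) × ℝ) : ℝ :=
  ((1 + 1 / ‖z.1‖ ^ 2) * Real.exp (c * ‖z.1‖)) * (1 + z.2 ^ 2)

lemma integrable_envelope (hp : 3 ≤ p) {n : ℕ} (hn : 1 ≤ n) (c : ℝ) :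
    Integrable (envelope (p := p) c)
      ((stdGaussian (EuclideanSpace ℝ (Fin p))).prod (chiSq n)) :=
  (integrable_exp_norm_stdGaussian hp c).mul_prod (integrable_one_add_sq_chiSq hn)

lemma integral_weighted (hp : 1 ≤ p) {κ : Measure ℝ} [SFinite κ]
    {e : EuclideanSpace ℝ (Fin p)} (he : ‖e‖ = 1) (j : ℕ) {k : ℝ × ℝ → ℝ} (hk : Measurable k) :
    ∫ z, k (‖z.1‖ ^ 2, z.2) * inner ℝ z.1 e ^ (2 * j)
      ∂((stdGaussian (EuclideanSpace ℝ (Fin p))).prod κ) =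
    evenMoment j * ∫ z, k z ∂((chiSq (p + 2 * j)).prod κ) := by
  have : NeZero p := ⟨by omega⟩
  have h := map_normSq_withDensity he j
  rw [finrank_euclideanSpace_fin] at h
  have h1 := congrArg (fun μ => ∫ z, k z ∂(Measure.prod μ κ)) h
  simp only [] at h1
  have hsf : SFinite ((stdGaussian (EuclideanSpace ℝ (Fin p))).withDensity
    (fun x => ENNReal.ofReal ((inner ℝ x e) ^ (2 * j)))) := inferInstance
  have h2 : (Measure.map (fun x => ‖x‖ ^ 2) ((stdGaussian (EuclideanSpace ℝ (Fin p))).withDensity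
    (fun x => ENNReal.ofReal ((inner ℝ x e) ^ (2 * j))))).prod κ =
    (((stdGaussian (EuclideanSpace ℝ (Fin p))).prod κ).withDensity
      (fun z => ENNReal.ofReal ((inner ℝ z.1 e) ^ (2 * j)))).map
      (fun z => (‖z.1‖ ^ 2, z.2)) := by
    conv_lhs => rw [← Measure.map_id (μ := κ)]
    rw [Measure.map_prod_map _ _ (by fun_prop) measurable_id,
      prod_withDensity_left (by fun_prop)]
    rfl
  rw [h2, integral_map (by fun_prop) hk.aestronglyMeasurable,
    integral_withDensity_eq_integral_toReal_smul (by fun_prop)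
      (Filter.Eventually.of_forall fun _ => ENNReal.ofReal_lt_top),
    Measure.prod_smul_left, integral_smul_measure, ENNReal.toReal_ofReal (evenMoment_nonneg j),
    smul_eq_mul] at h1
  rw [← h1]
  refine integral_congr_ae (Filter.Eventually.of_forall fun z => ?_)
  simp only [smul_eq_mul]
  rw [ENNReal.toReal_ofReal ((even_two_mul j).pow_nonneg _), mul_comm]

/-- All terms of the series of f are nonnegative, so its partial sums are at most f and the single
integrable function |k|·f dominates. Each term then turns ⟨x, e⟩^(2m) into 2m additional degrees of
freedom for ‖x‖². -/
lemma hasSum_integral_even (hp : 1 ≤ p) {κ : Measure ℝ} [SFinite κ]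
    {e : EuclideanSpace ℝ (Fin p)} (he : ‖e‖ = 1) {a : ℕ → ℝ} {m : ℕ → ℕ} {f : ℝ → ℝ}
    (ha : ∀ j, 0 ≤ a j) (hf : ∀ y, HasSum (fun j => a j * y ^ (2 * m j)) (f y))
    {k : ℝ × ℝ → ℝ} (hk : Measurable k)
    (hint : Integrable (fun z => k (‖z.1‖ ^ 2, z.2) * f (inner ℝ z.1 e))
      ((stdGaussian (EuclideanSpace ℝ (Fin p))).prod κ)) :
    HasSum (fun j => a j * evenMoment (m j) * ∫ z, k z ∂((chiSq (p + 2 * m j)).prod κ))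
      (∫ z, k (‖z.1‖ ^ 2, z.2) * f (inner ℝ z.1 e)
        ∂((stdGaussian (EuclideanSpace ℝ (Fin p))).prod κ)) := by
  have hF : ∀ j, a j * evenMoment (m j) * ∫ z, k z ∂((chiSq (p + 2 * m j)).prod κ) =
      ∫ z, k (‖z.1‖ ^ 2, z.2) * (a j * inner ℝ z.1 e ^ (2 * m j))
        ∂((stdGaussian (EuclideanSpace ℝ (Fin p))).prod κ) := by
    intro j
    rw [mul_assoc, ← integral_weighted hp he (m j) hk, ← integral_const_mul]
    congr 1
    ext z
    ring
  simp_rw [hF]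
  have hsum : ∀ z : EuclideanSpace ℝ (Fin p) × ℝ, HasSum
      (fun j => |k (‖z.1‖ ^ 2, z.2)| * (a j * inner ℝ z.1 e ^ (2 * m j)))
      (|k (‖z.1‖ ^ 2, z.2)| * f (inner ℝ z.1 e)) := fun z => (hf _).mul_left _
  refine hasSum_integral_of_dominated_convergence
    (fun j z => |k (‖z.1‖ ^ 2, z.2)| * (a j * inner ℝ z.1 e ^ (2 * m j))) ?_ ?_ ?_ ?_ ?_
  · intro j
    have : Measurable fun z : EuclideanSpace ℝ (Fin p) × ℝ => k (‖z.1‖ ^ 2, z.2) :=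
      hk.comp (by fun_prop)
    fun_prop
  · intro j
    refine Filter.Eventually.of_forall fun z => ?_
    rw [norm_mul, Real.norm_eq_abs, Real.norm_of_nonneg]
    exact mul_nonneg (ha j) ((even_two_mul _).pow_nonneg _)
  · exact Filter.Eventually.of_forall fun z => (hsum z).summable
  · refine hint.norm.congr (Filter.Eventually.of_forall fun z => ?_)
    simp only []
    rw [(hsum z).tsum_eq, norm_mul, Real.norm_eq_abs, Real.norm_of_nonneg]
    exact (hf _).nonneg fun j => mul_nonneg (ha j) ((even_two_mul _).pow_nonneg _)
  · exact Filter.Eventually.of_forall fun z => (hf _).mul_left _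

end Model

end ShrinkageMSE

namespace ShrinkageMSE

/-! ### The law of the ratio of two independent chi-square variables -/

section RatioLaw

/-- The unnormalised density of `u / v` under the law of `(u, v)` weighted with `v ^ a`, where
`u ∼ χ²_k` and `v ∼ χ²_n` are independent. -/
noncomputable def ratioDensity (k n a : ℕ) (w : ℝ) : ℝ :=
  w ^ ((k : ℝ) / 2 - 1) * (1 + w) ^ (-(((k : ℝ) + n) / 2 + a))

noncomputable def ratioConst (k n a : ℕ) : ℝ :=
  chiConst k * chiConst n *
    (2 ^ (((k : ℝ) + n) / 2 + a) * Real.Gamma (((k : ℝ) + n) / 2 + a))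

lemma ratioConst_pos {k n : ℕ} (hk : 0 < k) (hn : 0 < n) (a : ℕ) : 0 < ratioConst k n a := by
  have h1 := chiConst_pos hk
  have h2 := chiConst_pos hn
  have : 0 < Real.Gamma (((k : ℝ) + n) / 2 + a) := Real.Gamma_pos_of_pos (by positivity)
  unfold ratioConst
  positivity

/-- This is Γ(x + 1) = xΓ(x). Combined with `ratioDensity_succ` it says that u + v is independent of
u/v and has mean k + n + 2a under the law weighted with v^a. -/
lemma ratioConst_succ {k n : ℕ} (hk : 0 < k) (a : ℕ) :
    ratioConst k n (a + 1) = ((k : ℝ) + n + 2 * a) * ratioConst k n a := by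
  have h : ((k : ℝ) + n) / 2 + a ≠ 0 := by positivity
  unfold ratioConst
  push_cast
  rw [← add_assoc, Real.Gamma_add_one h, Real.rpow_add_one (by norm_num)]
  ring

lemma ratioDensity_nonneg (k n a : ℕ) {w : ℝ} (hw : 0 < w) : 0 ≤ ratioDensity k n a w := by
  unfold ratioDensity; positivity

lemma ratioDensity_pos (k n a : ℕ) {w : ℝ} (hw : 0 < w) : 0 < ratioDensity k n a w := by
  unfold ratioDensity; positivity

@[fun_prop]
lemma measurable_ratioDensity (k n a : ℕ) : Measurable (ratioDensity k n a) := by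
  unfold ratioDensity; fun_prop

lemma ratioDensity_succ (k n a : ℕ) {w : ℝ} (hw : 0 < w) :
    ratioDensity k n (a + 1) w = ratioDensity k n a w / (1 + w) := by
  unfold ratioDensity
  push_cast
  rw [show -(((k : ℝ) + n) / 2 + (a + 1)) = -(((k : ℝ) + n) / 2 + a) - 1 by ring,
    Real.rpow_sub_one (show 1 + w ≠ 0 by positivity)]
  ring

/-- For fixed w = u/v the integral over v is a Gamma integral with rate (1 + w)/2. The last factor v
is the Jacobian of u = vw. -/
lemma lintegral_inner_ratio {k n : ℕ} (hk : 0 < k) (hn : 0 < n) (a : ℕ) {w : ℝ} (hw : 0 < w) :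
    ∫⁻ v in Ioi (0 : ℝ), ENNReal.ofReal
      (chiConst n * (v ^ ((n : ℝ) / 2 - 1) * Real.exp (-v / 2)) *
        (chiConst k * ((v * w) ^ ((k : ℝ) / 2 - 1) * Real.exp (-(v * w) / 2))) * v ^ a * v) =
      ENNReal.ofReal (ratioConst k n a * ratioDensity k n a w) := by
  have hck := chiConst_pos hk
  have hcn := chiConst_pos hn
  have hpos : 0 < ((k : ℝ) + n) / 2 + a := by positivity
  have hr : 0 < (1 + w) / 2 := by positivity
  have e : ∀ v ∈ Ioi (0 : ℝ), chiConst n * (v ^ ((n : ℝ) / 2 - 1) * Real.exp (-v / 2)) *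
        (chiConst k * ((v * w) ^ ((k : ℝ) / 2 - 1) * Real.exp (-(v * w) / 2))) * v ^ a * v =
      (chiConst k * chiConst n * w ^ ((k : ℝ) / 2 - 1)) *
        (v ^ (((k : ℝ) + n) / 2 + a - 1) * Real.exp (-((1 + w) / 2 * v))) := by
    intro v hv
    have hv' : (0 : ℝ) < v := hv
    have e1 : v ^ (((k : ℝ) + n) / 2 + a - 1) =
        v ^ ((n : ℝ) / 2 - 1) * v ^ ((k : ℝ) / 2 - 1) * v ^ a * v := by
      nth_rewrite 5 [← Real.rpow_one v]
      rw [← Real.rpow_natCast v a, ← Real.rpow_add hv', ← Real.rpow_add hv', ← Real.rpow_add hv']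
      congr 1
      ring
    have e2 : Real.exp (-((1 + w) / 2 * v)) = Real.exp (-v / 2) * Real.exp (-(v * w) / 2) := by
      rw [← Real.exp_add]
      congr 1
      ring
    rw [e1, e2, Real.mul_rpow hv'.le hw.le]
    ring
  rw [setLIntegral_congr_fun measurableSet_Ioi (fun v hv => by rw [e v hv])]
  have hint : IntegrableOn (fun v : ℝ => v ^ (((k : ℝ) + n) / 2 + a - 1) *
      Real.exp (-((1 + w) / 2 * v))) (Ioi 0) := by
    have h := integrableOn_rpow_mul_exp_neg_mul_rpow (p := 1)
      (s := ((k : ℝ) + n) / 2 + a - 1) (b := (1 + w) / 2) (by linarith) one_pos hr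
    simpa using h
  rw [← ofReal_integral_eq_lintegral_ofReal (hint.const_mul _), integral_const_mul,
    Real.integral_rpow_mul_exp_neg_mul_Ioi hpos hr]
  · congr 1
    unfold ratioConst ratioDensity
    have : (1 / ((1 + w) / 2)) ^ (((k : ℝ) + n) / 2 + a) =
        2 ^ (((k : ℝ) + n) / 2 + a) * (1 + w) ^ (-(((k : ℝ) + n) / 2 + a)) := by
      rw [one_div_div, Real.div_rpow (by norm_num) (by positivity), Real.rpow_neg (by positivity)]
      ring
    rw [this]
    ring
  · filter_upwards [ae_restrict_mem measurableSet_Ioi] with v hv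
    have hv' : (0 : ℝ) < v := hv
    simp only [Pi.zero_apply]
    positivity

lemma lintegral_Ioi_comp_mul {v : ℝ} (hv : 0 < v) (G : ℝ → ℝ≥0∞) :
    ∫⁻ u in Ioi (0 : ℝ), G u = ∫⁻ w in Ioi (0 : ℝ), ENNReal.ofReal v * G (v * w) := by
  have himg : (fun w : ℝ => v * w) '' Ioi 0 = Ioi 0 := by
    simp [Set.image_mul_left_Ioi hv]
  conv_lhs => rw [← himg]
  rw [lintegral_image_eq_lintegral_abs_deriv_mul measurableSet_Ioi
    (f' := fun _ => v) (fun r _ => by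
      simpa using ((hasDerivAt_id r).const_mul v).hasDerivWithinAt)
    (fun a _ b _ h => mul_left_cancel₀ hv.ne' h)]
  simp [abs_of_pos hv]

/-- The law of `u / v` under the law of `(u, v)` weighted with `v ^ a`, where
`u ∼ χ²_k` and `v ∼ χ²_n` are independent. -/
lemma map_ratio_withDensity {k n : ℕ} (hk : 0 < k) (hn : 0 < n) (a : ℕ) :
    (((chiSq k).prod (chiSq n)).withDensity (fun z => ENNReal.ofReal (z.2 ^ a))).map
      (fun z => z.1 / z.2) =
    (volume.restrict (Ioi (0 : ℝ))).withDensity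
      (fun w => ENNReal.ofReal (ratioConst k n a * ratioDensity k n a w)) := by
  have hck := chiConst_pos hk
  have hcn := chiConst_pos hn
  ext s hs
  have hind : Measurable (s.indicator (1 : ℝ → ℝ≥0∞)) := measurable_one.indicator hs
  have hpre : MeasurableSet ((fun z : ℝ × ℝ => z.1 / z.2) ⁻¹' s) :=
    (by fun_prop : Measurable fun z : ℝ × ℝ => z.1 / z.2) hs
  rw [Measure.map_apply (by fun_prop) hs, withDensity_apply _ hpre, ← lintegral_indicator hpre,
    lintegral_prod_symm' _ (Measurable.indicator (by fun_prop) hpre),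
    withDensity_apply _ hs, ← lintegral_indicator hs, chiSq_eq_withDensity n,
    lintegral_withDensity_eq_lintegral_mul _ (by fun_prop) (Measurable.lintegral_prod_left'
      (f := fun z : ℝ × ℝ => ((fun z : ℝ × ℝ => z.1 / z.2) ⁻¹' s).indicator
        (fun z => ENNReal.ofReal (z.2 ^ a)) z) (Measurable.indicator (by fun_prop) hpre))]
  have step : ∀ v ∈ Ioi (0 : ℝ), ((fun v => ENNReal.ofReal
      (chiConst n * (v ^ ((n : ℝ) / 2 - 1) * Real.exp (-v / 2)))) * fun v =>
      ∫⁻ u, ((fun z : ℝ × ℝ => z.1 / z.2) ⁻¹' s).indicator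
        (fun z => ENNReal.ofReal (z.2 ^ a)) (u, v) ∂(chiSq k)) v =
      ∫⁻ w in Ioi (0 : ℝ), s.indicator 1 w * ENNReal.ofReal
      (chiConst n * (v ^ ((n : ℝ) / 2 - 1) * Real.exp (-v / 2)) *
        (chiConst k * ((v * w) ^ ((k : ℝ) / 2 - 1) * Real.exp (-(v * w) / 2))) * v ^ a * v) := by
    intro v hv
    have hv' : (0 : ℝ) < v := hv
    have hm : Measurable fun u : ℝ => ((fun z : ℝ × ℝ => z.1 / z.2) ⁻¹' s).indicator
        (fun z => ENNReal.ofReal (z.2 ^ a)) (u, v) :=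
      (Measurable.indicator (by fun_prop) hpre).comp (by fun_prop)
    rw [Pi.mul_apply, chiSq_eq_withDensity k,
      lintegral_withDensity_eq_lintegral_mul _ (by fun_prop) hm,
      lintegral_Ioi_comp_mul hv', ← lintegral_const_mul _ (by
        have : Measurable fun u : ℝ => ((fun z : ℝ × ℝ => z.1 / z.2) ⁻¹' s).indicator
          (fun z => ENNReal.ofReal (z.2 ^ a)) (v * u, v) := hm.comp (by fun_prop)
        simp only [Pi.mul_apply]
        fun_prop)]
    refine setLIntegral_congr_fun measurableSet_Ioi fun w hw => ?_
    have hw' : (0 : ℝ) < w := hw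
    have hdiv : v * w / v = w := by field_simp
    by_cases h : w ∈ s
    · simp only [Pi.mul_apply]
      rw [indicator_of_mem (by simpa [hdiv] using h), indicator_of_mem h, Pi.one_apply, one_mul,
        ← ENNReal.ofReal_mul (by positivity), ← ENNReal.ofReal_mul (by positivity),
        ← ENNReal.ofReal_mul (by positivity)]
      congr 1
      ring
    · simp only [Pi.mul_apply]
      rw [indicator_of_notMem (by simpa [hdiv] using h), indicator_of_notMem h]
      simp
  rw [setLIntegral_congr_fun measurableSet_Ioi step, lintegral_lintegral_swap (by fun_prop)]
  refine setLIntegral_congr_fun measurableSet_Ioi fun w hw => ?_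
  rw [lintegral_const_mul _ (by fun_prop), lintegral_inner_ratio hk hn a hw]
  by_cases h : w ∈ s
  · rw [indicator_of_mem h, indicator_of_mem h, Pi.one_apply, one_mul]
  · rw [indicator_of_notMem h, indicator_of_notMem h, zero_mul]

lemma ae_pos_prod_chiSq (k n : ℕ) :
    ∀ᵐ z ∂((chiSq k).prod (chiSq n)), 0 < z.1 ∧ 0 < z.2 := by
  have h1 : ∀ᵐ z ∂((chiSq k).prod (chiSq n)), 0 < z.1 :=
    Measure.quasiMeasurePreserving_fst.ae (ae_pos_chiSq k)
  have h2 : ∀ᵐ z ∂((chiSq k).prod (chiSq n)), 0 < z.2 :=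
    Measure.quasiMeasurePreserving_snd.ae (ae_pos_chiSq n)
  exact h1.and h2

lemma integral_ratio {k n : ℕ} (hk : 0 < k) (hn : 0 < n) (a : ℕ) {Φ : ℝ → ℝ}
    (hΦ : Measurable Φ) :
    ∫ z, z.2 ^ a * Φ (z.1 / z.2) ∂((chiSq k).prod (chiSq n)) =
      ratioConst k n a * ∫ w in Ioi (0 : ℝ), ratioDensity k n a w * Φ w := by
  have hc := ratioConst_pos hk hn a
  have h := congrArg (fun μ => ∫ w, Φ w ∂μ) (map_ratio_withDensity hk hn a)
  rw [integral_map (by fun_prop) hΦ.aestronglyMeasurable,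
    integral_withDensity_eq_integral_toReal_smul (by fun_prop)
      (Filter.Eventually.of_forall fun _ => ENNReal.ofReal_lt_top),
    integral_withDensity_eq_integral_toReal_smul (by fun_prop)
      (Filter.Eventually.of_forall fun _ => ENNReal.ofReal_lt_top)] at h
  rw [← integral_const_mul]
  refine Eq.trans ?_ (h.trans ?_)
  · refine integral_congr_ae ?_
    filter_upwards [ae_pos_prod_chiSq k n] with z hz
    rw [ENNReal.toReal_ofReal (pow_nonneg hz.2.le _), smul_eq_mul]
  · refine setIntegral_congr_fun measurableSet_Ioi fun w hw => ?_
    have := ratioDensity_nonneg k n a hw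
    rw [ENNReal.toReal_ofReal (by positivity), smul_eq_mul, mul_assoc]

lemma integrable_ratio_iff {k n : ℕ} (hk : 0 < k) (hn : 0 < n) (a : ℕ) {Φ : ℝ → ℝ}
    (hΦ : Measurable Φ) :
    Integrable (fun z => z.2 ^ a * Φ (z.1 / z.2)) ((chiSq k).prod (chiSq n)) ↔
      IntegrableOn (fun w => ratioDensity k n a w * Φ w) (Ioi (0 : ℝ)) := by
  have hc := ratioConst_pos hk hn a
  have h : Integrable Φ _ ↔ Integrable Φ _ :=
    iff_of_eq (congrArg (fun μ => Integrable Φ μ) (map_ratio_withDensity hk hn a))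
  rw [integrable_map_measure hΦ.aestronglyMeasurable (by fun_prop),
    integrable_withDensity_iff_integrable_smul₀' (by fun_prop)
      (Filter.Eventually.of_forall fun _ => ENNReal.ofReal_lt_top),
    integrable_withDensity_iff_integrable_smul₀' (by fun_prop)
      (Filter.Eventually.of_forall fun _ => ENNReal.ofReal_lt_top)] at h
  refine Iff.trans (integrable_congr ?_) (h.trans (Iff.trans (integrable_congr ?_)
    (integrable_const_mul_iff (c := ratioConst k n a) hc.ne'.isUnit _)))
  · filter_upwards [ae_pos_prod_chiSq k n] with z hz
    rw [ENNReal.toReal_ofReal (pow_nonneg hz.2.le _), smul_eq_mul]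
    rfl
  · filter_upwards [ae_restrict_mem measurableSet_Ioi] with w hw
    have := ratioDensity_nonneg k n a hw
    rw [ENNReal.toReal_ofReal (by positivity), smul_eq_mul, mul_assoc]

end RatioLaw

end ShrinkageMSE

namespace ShrinkageMSE

/-! ### Integration by parts on the half line -/

section HalfLine

open Filter Topology

/-- If the integrals of `G` over compact subintervals of the half line are bounded below by the
increments of `P`, then so is the integral over the half line. -/
lemma le_integral_Ioi_of_tendsto {G P : ℝ → ℝ} {l₀ l₁ : ℝ} (hG : IntegrableOn G (Ioi 0))
    (hP : ∀ a b, 0 < a → a ≤ b → P b - P a ≤ ∫ x in a..b, G x)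
    (h₀ : Tendsto P (𝓝[>] 0) (𝓝 l₀)) (h₁ : Tendsto P atTop (𝓝 l₁)) :
    l₁ - l₀ ≤ ∫ x in Ioi 0, G x := by
  have ha : Tendsto (fun i : ℕ => ((i : ℝ) + 1)⁻¹) atTop (𝓝[>] 0) :=
    tendsto_inv_atTop_nhdsGT_zero.comp
      (tendsto_atTop_add_const_right _ _ tendsto_natCast_atTop_atTop)
  have hb : Tendsto (fun i : ℕ => (i : ℝ) + 1) atTop atTop :=
    tendsto_atTop_add_const_right _ _ tendsto_natCast_atTop_atTop
  -- The intervals (1/(i+1), i+1] exhaust the half line and stay away from the singularity at 0.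
  have hcover : AECover (volume.restrict (Ioi (0 : ℝ))) atTop
      (fun i : ℕ => Ioc ((i : ℝ) + 1)⁻¹ ((i : ℝ) + 1)) := by
    refine ⟨?_, fun i => measurableSet_Ioc⟩
    filter_upwards [ae_restrict_mem measurableSet_Ioi] with x hx
    have h1 := (ha.mono_right nhdsWithin_le_nhds).eventually_lt_const (show 0 < x from hx)
    exact h1.and (hb.eventually_ge_atTop x)
  refine le_of_tendsto_of_tendsto ((h₁.comp hb).sub (h₀.comp ha))
    (hcover.integral_tendsto_of_countably_generated hG) (Eventually.of_forall fun i => ?_)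
  have hi : ((i : ℝ) + 1)⁻¹ ≤ (i : ℝ) + 1 :=
    (inv_le_one_of_one_le₀ (by simp)).trans (by simp)
  have hpos : 0 < ((i : ℝ) + 1)⁻¹ := by positivity
  have h := hP _ _ hpos hi
  rw [intervalIntegral.integral_of_le hi] at h
  beta_reduce
  rw [Measure.restrict_restrict measurableSet_Ioc,
    inter_eq_left.2 (show Ioc _ _ ⊆ Ioi (0 : ℝ) from fun x hx => hpos.trans hx.1)]
  exact h

lemma integral_Ioi_eq_of_tendsto {G P : ℝ → ℝ} {l₀ l₁ : ℝ} (hG : IntegrableOn G (Ioi 0))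
    (hP : ∀ a b, 0 < a → a ≤ b → ∫ x in a..b, G x = P b - P a)
    (h₀ : Tendsto P (𝓝[>] 0) (𝓝 l₀)) (h₁ : Tendsto P atTop (𝓝 l₁)) :
    ∫ x in Ioi 0, G x = l₁ - l₀ := by
  refine le_antisymm ?_ (le_integral_Ioi_of_tendsto hG (fun a b h h' => (hP a b h h').ge) h₀ h₁)
  have h := le_integral_Ioi_of_tendsto (G := -G) (P := -P) hG.neg (fun a b h h' => by
    simp only [Pi.neg_apply, intervalIntegral.integral_neg, hP a b h h']
    linarith) h₀.neg h₁.neg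
  simp only [Pi.neg_apply, integral_neg] at h
  linarith

lemma ratioDensity_le_rpow (k n : ℕ) {w : ℝ} (hw : 0 < w) :
    ratioDensity k n 0 w ≤ w ^ ((k : ℝ) / 2 - 1) := by
  unfold ratioDensity
  have : (1 + w) ^ (-(((k : ℝ) + n) / 2 + (0 : ℕ))) ≤ 1 :=
    Real.rpow_le_one_of_one_le_of_nonpos (by linarith) (by
      have : 0 ≤ ((k : ℝ) + n) / 2 := by positivity
      simpa using this)
  nlinarith [Real.rpow_nonneg hw.le ((k : ℝ) / 2 - 1)]

lemma ratioDensity_le_rpow_neg (k n : ℕ) {w : ℝ} (hw : 0 < w) :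
    ratioDensity k n 0 w ≤ w ^ (-((n : ℝ) / 2 + 1)) := by
  unfold ratioDensity
  have h : (1 + w) ^ (-(((k : ℝ) + n) / 2 + (0 : ℕ))) ≤ w ^ (-(((k : ℝ) + n) / 2 + (0 : ℕ))) :=
    Real.rpow_le_rpow_of_nonpos hw (by linarith) (by
      have : 0 ≤ ((k : ℝ) + n) / 2 := by positivity
      simpa using this)
  calc _ ≤ w ^ ((k : ℝ) / 2 - 1) * w ^ (-(((k : ℝ) + n) / 2 + (0 : ℕ))) := by gcongr
    _ = _ := by
      rw [← Real.rpow_add hw]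
      congr 1
      push_cast
      ring

/-- The exponent k/2 - 1 is positive for k ≥ 3, so boundary terms at 0 vanish in the integrations by
parts. -/
lemma tendsto_ratioDensity_zero {k : ℕ} (hk : 3 ≤ k) (n : ℕ) :
    Tendsto (ratioDensity k n 0) (𝓝[>] 0) (𝓝 0) := by
  have hk' : (3 : ℝ) ≤ k := by exact_mod_cast hk
  have hpos : 0 < (k : ℝ) / 2 - 1 := by linarith
  have h : Tendsto (fun w : ℝ => w ^ ((k : ℝ) / 2 - 1)) (𝓝[>] 0) (𝓝 0) := by
    have := (Real.continuousAt_rpow_const 0 ((k : ℝ) / 2 - 1) (Or.inr hpos.le)).tendsto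
    rw [Real.zero_rpow hpos.ne'] at this
    exact this.mono_left nhdsWithin_le_nhds
  refine tendsto_of_tendsto_of_tendsto_of_le_of_le' tendsto_const_nhds h ?_ ?_
  · filter_upwards [self_mem_nhdsWithin] with w hw using ratioDensity_nonneg k n 0 hw
  · filter_upwards [self_mem_nhdsWithin] with w hw using ratioDensity_le_rpow k n hw

lemma tendsto_ratioDensity_atTop (k n : ℕ) :
    Tendsto (ratioDensity k n 0) atTop (𝓝 0) := by
  have h := tendsto_rpow_neg_atTop (show 0 < (n : ℝ) / 2 + 1 by positivity)
  refine tendsto_of_tendsto_of_tendsto_of_le_of_le' tendsto_const_nhds h ?_ ?_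
  · filter_upwards [eventually_gt_atTop 0] with w hw using ratioDensity_nonneg k n 0 hw
  · filter_upwards [eventually_gt_atTop 0] with w hw using ratioDensity_le_rpow_neg k n hw

lemma hasDerivAt_ratioDensity (k n : ℕ) {w : ℝ} (hw : 0 < w) :
    HasDerivAt (ratioDensity k n 0) (ratioDensity k n 0 w *
      (((k : ℝ) / 2 - 1) / w - ((k : ℝ) + n) / 2 / (1 + w))) w := by
  have h1 := Real.hasDerivAt_rpow_const (x := w) (p := (k : ℝ) / 2 - 1) (Or.inl hw.ne')
  have h2 := ((hasDerivAt_id w).const_add 1).rpow_const (p := -(((k : ℝ) + n) / 2 + (0 : ℕ)))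
    (Or.inl (show 1 + id w ≠ 0 by simp only [id]; positivity))
  refine (h1.mul h2).congr_deriv ?_
  simp only [ratioDensity, id]
  rw [Real.rpow_sub_one hw.ne' ((k : ℝ) / 2 - 1),
    Real.rpow_sub_one (show 1 + w ≠ 0 by positivity) (-(((k : ℝ) + n) / 2 + (0 : ℕ)))]
  push_cast
  field_simp
  ring

lemma contDiffOn_ratioDensity (k n : ℕ) {a b : ℝ} (ha : 0 < a) (hab : a ≤ b) :
    ContDiffOn ℝ 1 (ratioDensity k n 0) (uIcc a b) := by
  intro w hw
  rw [uIcc_of_le hab] at hw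
  have hw0 : 0 < w := ha.trans_le hw.1
  refine ContDiffAt.contDiffWithinAt ?_
  unfold ratioDensity
  exact (Real.contDiffAt_rpow_const_of_ne hw0.ne').mul
    (ContDiffAt.rpow_const_of_ne (by fun_prop) (by positivity))

end HalfLine

/-! ### Moments of chi-square laws -/

section ChiSqMoments

lemma integral_rpow_chiSq {k : ℕ} {a : ℝ} (ha : 0 < (k : ℝ) / 2 + a) :
    ∫ u, u ^ a ∂(chiSq k) =
      2 ^ a * Real.Gamma ((k : ℝ) / 2 + a) / Real.Gamma ((k : ℝ) / 2) := by
  have h0 : 0 ≤ chiConst k := by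
    unfold chiConst
    have : 0 ≤ Real.Gamma ((k : ℝ) / 2) := Real.Gamma_nonneg_of_nonneg (by positivity)
    positivity
  rw [chiSq_eq_withDensity, integral_withDensity_eq_integral_toReal_smul (by fun_prop)
    (Filter.Eventually.of_forall fun _ => ENNReal.ofReal_lt_top)]
  have e : ∀ u ∈ Ioi (0 : ℝ), (ENNReal.ofReal
      (chiConst k * (u ^ ((k : ℝ) / 2 - 1) * Real.exp (-u / 2)))).toReal • u ^ a =
      chiConst k * (u ^ ((k : ℝ) / 2 + a - 1) * Real.exp (-(1 / 2 * u))) := by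
    intro u hu
    have hu' : (0 : ℝ) < u := hu
    rw [ENNReal.toReal_ofReal (by positivity), smul_eq_mul,
      show (k : ℝ) / 2 + a - 1 = (k : ℝ) / 2 - 1 + a by ring, Real.rpow_add hu',
      show -u / 2 = -(1 / 2 * u) by ring]
    ring
  rw [setIntegral_congr_fun measurableSet_Ioi e, integral_const_mul,
    Real.integral_rpow_mul_exp_neg_mul_Ioi ha (by norm_num), chiConst]
  norm_num
  rw [Real.rpow_add (by norm_num), Real.div_rpow (by norm_num) (by norm_num), Real.one_rpow]
  have : (2 : ℝ) ^ ((k : ℝ) / 2) ≠ 0 := by positivity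
  field_simp

lemma integral_id_chiSq {k : ℕ} (hk : 0 < k) : ∫ u, u ∂(chiSq k) = k := by
  have hk' : (0 : ℝ) < k := by exact_mod_cast hk
  have h := integral_rpow_chiSq (k := k) (a := 1) (by positivity)
  simp only [Real.rpow_one] at h
  rw [h, Real.Gamma_add_one (by positivity)]
  have : Real.Gamma ((k : ℝ) / 2) ≠ 0 := (Real.Gamma_pos_of_pos (by positivity)).ne'
  field_simp

lemma integral_inv_chiSq {k : ℕ} (hk : 3 ≤ k) : ∫ u, u⁻¹ ∂(chiSq k) = 1 / ((k : ℝ) - 2) := by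
  have hk' : (3 : ℝ) ≤ k := by exact_mod_cast hk
  have hpos : 0 < (k : ℝ) / 2 + -1 := by linarith
  have h := integral_rpow_chiSq (k := k) (a := -1) hpos
  simp only [Real.rpow_neg_one] at h
  have h2 : Real.Gamma ((k : ℝ) / 2) = ((k : ℝ) / 2 + -1) * Real.Gamma ((k : ℝ) / 2 + -1) := by
    rw [← Real.Gamma_add_one hpos.ne']
    congr 1
    ring
  have : Real.Gamma ((k : ℝ) / 2 + -1) ≠ 0 := (Real.Gamma_pos_of_pos hpos).ne'
  have h3 : (k : ℝ) - 2 ≠ 0 := by linarith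
  rw [h, h2]
  have h4 : (k : ℝ) / 2 + -1 = (k - 2) / 2 := by ring
  rw [h4] at this ⊢
  field_simp

lemma integrable_id_chiSq {k : ℕ} (hk : 0 < k) : Integrable (fun u => u) (chiSq k) := by
  simpa using integrable_rpow_chiSq (k := k) (a := 1) (by positivity)

lemma integrable_inv_chiSq {k : ℕ} (hk : 3 ≤ k) : Integrable (fun u => u⁻¹) (chiSq k) := by
  have hk' : (3 : ℝ) ≤ k := by exact_mod_cast hk
  have h := integrable_rpow_chiSq (k := k) (a := -1) (by linarith)
  simpa only [Real.rpow_neg_one] using h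

lemma integrable_div_prod_chiSq {k n : ℕ} (hk : 3 ≤ k) (hn : 1 ≤ n) :
    Integrable (fun z => z.2 / z.1) ((chiSq k).prod (chiSq n)) := by
  refine ((integrable_inv_chiSq hk).mul_prod (integrable_id_chiSq hn)).congr
    (Filter.Eventually.of_forall fun z => ?_)
  simp only []
  rw [div_eq_mul_inv, mul_comm]

lemma integral_div_prod_chiSq {k n : ℕ} (hk : 3 ≤ k) (hn : 1 ≤ n) :
    ∫ z, z.2 / z.1 ∂((chiSq k).prod (chiSq n)) = n / ((k : ℝ) - 2) := by
  have h := integral_prod_mul (μ := chiSq k) (ν := chiSq n) (fun u => u⁻¹) (fun v => v)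
  rw [integral_inv_chiSq hk, integral_id_chiSq hn] at h
  rw [div_eq_mul_one_div, mul_comm, ← h]
  refine integral_congr_ae (Filter.Eventually.of_forall fun z => ?_)
  simp only []
  rw [div_eq_mul_inv, mul_comm]

end ChiSqMoments

end ShrinkageMSE

namespace ShrinkageMSE

open Filter Topology

/-- A measurable function that is bounded and Lipschitz on the positive half line. -/
structure IsShrinkageFn (φ : ℝ → ℝ) (C : ℝ) (K : ℝ≥0) : Prop where
  meas : Measurable φ
  bound : ∀ w, 0 < w → |φ w| ≤ C
  lip : LipschitzOnWith K φ (Ioi 0)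

/-! ### Integration by parts for functions of the ratio -/

section Ratio

variable {φ : ℝ → ℝ} {C : ℝ} {K : ℝ≥0} {k n : ℕ}

lemma IsShrinkageFn.nonneg (h : IsShrinkageFn φ C K) : 0 ≤ C :=
  (abs_nonneg _).trans (h.bound 1 one_pos)

lemma IsShrinkageFn.abs_deriv_le (h : IsShrinkageFn φ C K) {w : ℝ} (hw : 0 < w) :
    |deriv φ w| ≤ K := by
  simpa using norm_deriv_le_of_lipschitzOn (Ioi_mem_nhds hw) h.lip

lemma IsShrinkageFn.sq_le (h : IsShrinkageFn φ C K) {w : ℝ} (hw : 0 < w) :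
    φ w ^ 2 ≤ C ^ 2 := by
  have := h.bound w hw
  exact sq_le_sq' (abs_le.1 this).1 (abs_le.1 this).2

lemma IsShrinkageFn.measurable_bFun (h : IsShrinkageFn φ C K) : Measurable (bFun n φ) := by
  have h1 := h.meas
  have h2 := measurable_deriv φ
  unfold bFun
  fun_prop

lemma IsShrinkageFn.abs_bFun_le (h : IsShrinkageFn φ C K) (n : ℕ) {w : ℝ} (hw : 0 < w) :
    |bFun n φ w| ≤ (4 * C + (n + 2) * C ^ 2 + 4 * K + 4 * C * K) * (1 + 1 / w) := by
  have hC := h.nonneg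
  have h1 := h.bound w hw
  have h2 := h.abs_deriv_le hw
  have h3 := h.sq_le hw
  have hK : (0 : ℝ) ≤ K := K.2
  have hw1 : 0 < 1 / w := by positivity
  have a1 : |4 * φ w / w| ≤ 4 * C * (1 / w) := by
    rw [abs_div, abs_mul, abs_of_pos hw, div_eq_mul_one_div]
    simp only [Nat.abs_ofNat]
    gcongr
  have a2 : |((n : ℝ) + 2) * φ w ^ 2 / w| ≤ (n + 2) * C ^ 2 * (1 / w) := by
    rw [abs_of_nonneg (by positivity), div_eq_mul_one_div]
    gcongr
  have a3 : |4 * deriv φ w| ≤ 4 * K := by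
    rw [abs_mul]; simp only [Nat.abs_ofNat]; gcongr
  have a4 : |4 * φ w * deriv φ w| ≤ 4 * C * K := by
    rw [abs_mul, abs_mul]; simp only [Nat.abs_ofNat]; gcongr
  have t : |bFun n φ w| ≤ |4 * φ w / w| + |((n : ℝ) + 2) * φ w ^ 2 / w| + |4 * deriv φ w| +
      |4 * φ w * deriv φ w| := by
    unfold bFun
    exact (abs_sub _ _).trans (add_le_add_left ((abs_sub _ _).trans
      (add_le_add_left (abs_add_le _ _) _)) _)
  refine t.trans ((add_le_add (add_le_add (add_le_add a1 a2) a3) a4).trans ?_)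
  have : 0 ≤ (4 * K + 4 * C * K) * (1 / w) := by positivity
  have : 0 ≤ 4 * C + (n + 2) * C ^ 2 := by positivity
  linarith

lemma integrable_comp_ratio (hk : 3 ≤ k) (hn : 1 ≤ n) {Φ : ℝ → ℝ} (hΦ : Measurable Φ) {B : ℝ}
    (hB : ∀ w, 0 < w → |Φ w| ≤ B * (1 + 1 / w)) :
    Integrable (fun z => Φ (z.1 / z.2)) ((chiSq k).prod (chiSq n)) := by
  have := isProbabilityMeasure_chiSq (k := k) (by omega)
  have := isProbabilityMeasure_chiSq (k := n) hn
  refine Integrable.mono' (((integrable_const (1 : ℝ)).add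
    (integrable_div_prod_chiSq hk hn)).const_mul B) (hΦ.comp (by fun_prop)).aestronglyMeasurable ?_
  filter_upwards [ae_pos_prod_chiSq k n] with z hz
  simpa using hB (z.1 / z.2) (div_pos hz.1 hz.2)

lemma integral_comp_ratio (hk : 0 < k) (hn : 0 < n) {Φ : ℝ → ℝ} (hΦ : Measurable Φ) :
    ∫ z, Φ (z.1 / z.2) ∂((chiSq k).prod (chiSq n)) =
      ratioConst k n 0 * ∫ w in Ioi (0 : ℝ), ratioDensity k n 0 w * Φ w := by
  simpa using integral_ratio hk hn 0 hΦ

lemma integrableOn_ratioDensity_mul (hk : 3 ≤ k) (hn : 1 ≤ n) {Φ : ℝ → ℝ} (hΦ : Measurable Φ)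
    {B : ℝ} (hB : ∀ w, 0 < w → |Φ w| ≤ B * (1 + 1 / w)) :
    IntegrableOn (fun w => ratioDensity k n 0 w * Φ w) (Ioi 0) := by
  rw [← integrable_ratio_iff (by omega) (by omega) 0 hΦ]
  simpa using integrable_comp_ratio hk hn hΦ hB

lemma tendsto_zero_of_abs_le_mul {f g : ℝ → ℝ} {l : Filter ℝ} {B : ℝ}
    (hg : Tendsto g l (𝓝 0)) (h : ∀ᶠ x in l, |f x| ≤ B * g x) : Tendsto f l (𝓝 0) := by
  refine squeeze_zero_norm' (a := fun x => B * g x) h ?_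
  simpa using hg.const_mul B

/-- Integration by parts against the density of the ratio. -/
lemma integral_ratioDensity_parts (h : IsShrinkageFn φ C K) (hk : 3 ≤ k) (hn : 1 ≤ n) :
    ∫ w in Ioi (0 : ℝ), ratioDensity k n 0 w *
      ((4 * deriv φ w + 4 * φ w * deriv φ w) + (4 * φ w + 2 * φ w ^ 2) *
        (((k : ℝ) / 2 - 1) / w - ((k : ℝ) + n) / 2 / (1 + w))) = 0 := by
  have hC := h.nonneg
  have hK : (0 : ℝ) ≤ K := K.2
  have hmeas := h.meas
  have hderiv := measurable_deriv φ
  have hk' : (3 : ℝ) ≤ k := by exact_mod_cast hk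
  have hΛ : ∀ w, 0 < w → |4 * φ w + 2 * φ w ^ 2| ≤ 4 * C + 2 * C ^ 2 := by
    intro w hw
    refine (abs_add_le _ _).trans ?_
    rw [abs_mul, abs_mul, abs_of_nonneg (sq_nonneg (φ w))]
    simp only [Nat.abs_ofNat]
    have := h.bound w hw
    have := h.sq_le hw
    linarith
  have hint := integrableOn_ratioDensity_mul (k := k) (n := n) hk hn
    (Φ := fun w => ((4 * deriv φ w + 4 * φ w * deriv φ w) + (4 * φ w + 2 * φ w ^ 2) *
        (((k : ℝ) / 2 - 1) / w - ((k : ℝ) + n) / 2 / (1 + w)))) (by fun_prop)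
    (B := 4 * K + 4 * C * K + (4 * C + 2 * C ^ 2) * (k + n)) (by
      intro w hw
      have h1 := hΛ w hw
      have a3 : |4 * deriv φ w| ≤ 4 * K := by
        rw [abs_mul]; simp only [Nat.abs_ofNat]; gcongr; exact h.abs_deriv_le hw
      have a4 : |4 * φ w * deriv φ w| ≤ 4 * C * K := by
        rw [abs_mul, abs_mul]; simp only [Nat.abs_ofNat]
        gcongr
        · exact h.bound w hw
        · exact h.abs_deriv_le hw
      have a5 : |((k : ℝ) / 2 - 1) / w - ((k : ℝ) + n) / 2 / (1 + w)| ≤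
          ((k : ℝ) + n) * (1 + 1 / w) := by
        have e1 : 0 ≤ ((k : ℝ) / 2 - 1) / w := div_nonneg (by linarith) hw.le
        have e2 : 0 ≤ ((k : ℝ) + n) / 2 / (1 + w) := by positivity
        have e3 : ((k : ℝ) / 2 - 1) / w ≤ (k + n) * (1 / w) := by
          rw [div_eq_mul_one_div]
          gcongr
          have : (0 : ℝ) ≤ n := by positivity
          linarith
        have e4 : ((k : ℝ) + n) / 2 / (1 + w) ≤ k + n := by
          rw [div_div, div_le_iff₀ (by positivity)]
          have : (0 : ℝ) ≤ k + n := by positivity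
          nlinarith
        have e5 : 0 ≤ ((k : ℝ) + n) * (1 / w) := by positivity
        have e6 : 0 ≤ (k : ℝ) + n := by positivity
        rw [abs_le]
        constructor <;> linarith
      have a6 : |(4 * φ w + 2 * φ w ^ 2) *
          (((k : ℝ) / 2 - 1) / w - ((k : ℝ) + n) / 2 / (1 + w))| ≤
          (4 * C + 2 * C ^ 2) * ((k + n) * (1 + 1 / w)) := by
        rw [abs_mul]
        gcongr
      refine (abs_add_le _ _).trans (le_trans (add_le_add ((abs_add_le _ _).trans
        (add_le_add a3 a4)) a6) ?_)
      have : 0 ≤ (4 * K + 4 * C * K) * (1 / w) := by positivity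
      linarith)
  -- The integrand is the derivative of density·(4φ + 2φ²), whose limits at 0 and ∞ are 0 because φ
  -- is bounded. The primitive 4φ + 2φ² is chosen so that its derivative 4φ' + 4φφ' is minus the
  -- derivative part of b.
  have := integral_Ioi_eq_of_tendsto (l₀ := 0) (l₁ := 0) hint
    (P := fun w => ratioDensity k n 0 w * (4 * φ w + 2 * φ w ^ 2)) ?_ ?_ ?_
  · simpa using this
  · intro a b ha hab
    have hsub : uIcc a b ⊆ Ioi 0 := by
      rw [uIcc_of_le hab]
      exact fun x hx => ha.trans_le hx.1
    have hφ := (h.lip.mono hsub).absolutelyContinuousOnInterval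
    have hm := (contDiffOn_ratioDensity k n ha hab).absolutelyContinuousOnInterval
    have hΛac : AbsolutelyContinuousOnInterval (fun w => 4 * φ w + 2 * φ w ^ 2) a b := by
      have h1 := (hφ.const_mul 4).add ((hφ.mul hφ).const_mul 2)
      have e : (fun w => 4 * φ w + 2 * φ w ^ 2) =
          ((fun w => 4 * φ w) + fun w => 2 * (φ * φ) w) := by
        ext w; simp only [Pi.add_apply, Pi.mul_apply]; ring
      rw [e]
      exact h1
    -- A Lipschitz φ need only be differentiable almost everywhere, so the product rule is
    -- integrated for absolutely continuous functions.
    rw [← hm.integral_deriv_mul_eq_sub hΛac]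
    refine intervalIntegral.integral_congr_ae ?_
    filter_upwards [hφ.ae_differentiableAt] with w hw hwab
    have hw1 := (hw (uIoc_subset_uIcc hwab)).hasDerivAt
    have hw0 : 0 < w := hsub (uIoc_subset_uIcc hwab)
    have hΛd : HasDerivAt (fun w => 4 * φ w + 2 * φ w ^ 2) _ w :=
      (hw1.const_mul 4).add ((hw1.pow 2).const_mul 2)
    rw [(hasDerivAt_ratioDensity k n hw0).deriv, hΛd.deriv]
    push_cast
    ring
  · refine tendsto_zero_of_abs_le_mul (tendsto_ratioDensity_zero hk n)
      (B := 4 * C + 2 * C ^ 2) ?_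
    filter_upwards [self_mem_nhdsWithin] with w hw
    have hw : 0 < w := hw
    rw [abs_mul, abs_of_nonneg (ratioDensity_nonneg k n 0 hw), mul_comm]
    gcongr
    · exact ratioDensity_nonneg k n 0 hw
    · exact hΛ w hw
  · refine tendsto_zero_of_abs_le_mul (tendsto_ratioDensity_atTop k n)
      (B := 4 * C + 2 * C ^ 2) ?_
    filter_upwards [eventually_gt_atTop 0] with w hw
    rw [abs_mul, abs_of_nonneg (ratioDensity_nonneg k n 0 hw), mul_comm]
    gcongr
    · exact ratioDensity_nonneg k n 0 hw
    · exact hΛ w hw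

lemma IsShrinkageFn.abs_div_le (h : IsShrinkageFn φ C K) {w : ℝ} (hw : 0 < w) :
    |φ w / w| ≤ C * (1 + 1 / w) := by
  have hC := h.nonneg
  rw [abs_div, abs_of_pos hw, div_eq_mul_one_div]
  have := h.bound w hw
  gcongr
  linarith

lemma IsShrinkageFn.integrable_betaTwo (h : IsShrinkageFn φ C K) (hk : 3 ≤ k) (hn : 1 ≤ n)
    (c d : ℝ) :
    Integrable (fun z : ℝ × ℝ => c * (φ (z.1 / z.2) / (z.1 / z.2)) -
      d * bFun n φ (z.1 / z.2)) ((chiSq k).prod (chiSq n)) := by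
  have h1 := h.meas
  have h2 := h.measurable_bFun (n := n)
  exact ((integrable_comp_ratio (Φ := fun w => φ w / w) hk hn (by fun_prop)
    (fun w hw => h.abs_div_le hw)).const_mul c).sub
    ((integrable_comp_ratio hk hn h2 (fun w hw => h.abs_bFun_le n hw)).const_mul d)

/-- The chi-square identity behind `β⁽²⁾`. -/
lemma IsShrinkageFn.integral_betaTwo (h : IsShrinkageFn φ C K) (hk : 3 ≤ k) (hn : 1 ≤ n) :
    ∫ z : ℝ × ℝ, (2 * k * (φ (z.1 / z.2) / (z.1 / z.2)) - bFun n φ (z.1 / z.2))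
      ∂((chiSq k).prod (chiSq n)) =
    ∫ z : ℝ × ℝ, z.2 * (2 * φ (z.1 / z.2) - φ (z.1 / z.2) ^ 2 / (z.1 / z.2))
      ∂((chiSq k).prod (chiSq n)) := by
  have hC := h.nonneg
  have h1 := h.meas
  have h2 := h.measurable_bFun (n := n)
  have e1 := integral_comp_ratio (k := k) (n := n) (by omega) (by omega)
    (Φ := fun w => 2 * k * (φ w / w) - bFun n φ w) (by fun_prop)
  have e2 := integral_ratio (k := k) (n := n) (by omega) (by omega) 1
    (Φ := fun w => 2 * φ w - φ w ^ 2 / w) (by fun_prop)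
  simp only [pow_one] at e2
  -- The weight v on the right-hand side becomes the factor (k + n)/(1 + w) against the unweighted
  -- ratio density.
  have e3 := ratioConst_succ (k := k) (n := n) (by omega) 0
  rw [zero_add] at e3
  rw [e1, e2, e3]
  have e4 : ∫ w in Ioi (0 : ℝ), ratioDensity k n 1 w * (2 * φ w - φ w ^ 2 / w) =
      ∫ w in Ioi (0 : ℝ), ratioDensity k n 0 w * ((2 * φ w - φ w ^ 2 / w) / (1 + w)) := by
    refine setIntegral_congr_fun measurableSet_Ioi fun w hw => ?_
    have := ratioDensity_succ k n 0 (w := w) hw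
    rw [zero_add] at this
    rw [this]
    ring
  have i1 := integrableOn_ratioDensity_mul (k := k) (n := n) hk hn
    (Φ := fun w => 2 * k * (φ w / w) - bFun n φ w) (by fun_prop)
    (B := 2 * k * C + (4 * C + (n + 2) * C ^ 2 + 4 * K + 4 * C * K)) (by
      intro w hw
      refine (abs_sub _ _).trans ?_
      rw [abs_mul, abs_of_nonneg (show (0 : ℝ) ≤ 2 * k by positivity), add_mul, mul_assoc _ C]
      exact add_le_add (by gcongr; exact h.abs_div_le hw) (h.abs_bFun_le n hw))
  have i2 := integrableOn_ratioDensity_mul (k := k) (n := n) hk hn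
    (Φ := fun w => (2 * φ w - φ w ^ 2 / w) / (1 + w)) (by fun_prop)
    (B := 2 * C + C ^ 2) (by
      intro w hw
      have b1 := h.bound w hw
      have b2 := h.sq_le hw
      have hw1 : 0 < 1 / w := by positivity
      rw [abs_div, abs_of_pos (show 0 < 1 + w by positivity)]
      refine (div_le_self (abs_nonneg _) (by linarith)).trans ((abs_sub _ _).trans ?_)
      rw [abs_mul, abs_div, abs_of_pos hw, abs_of_nonneg (sq_nonneg (φ w)),
        div_eq_mul_one_div (φ w ^ 2)]
      simp only [Nat.abs_ofNat]
      have b3 : φ w ^ 2 * (1 / w) ≤ C ^ 2 * (1 / w) := by gcongr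
      nlinarith [mul_nonneg hC hw1.le, sq_nonneg C])
  have key := integral_ratioDensity_parts (k := k) (n := n) h hk hn
  -- Pointwise algebra: the vanishing integrand is exactly 2kφ/w - b minus (k + n)(2φ - φ²/w)/(1 +
  -- w).
  have e5 : ∫ w in Ioi (0 : ℝ), ratioDensity k n 0 w *
      ((4 * deriv φ w + 4 * φ w * deriv φ w) + (4 * φ w + 2 * φ w ^ 2) *
        (((k : ℝ) / 2 - 1) / w - ((k : ℝ) + n) / 2 / (1 + w))) =
      ∫ w in Ioi (0 : ℝ), (ratioDensity k n 0 w * (2 * k * (φ w / w) - bFun n φ w) -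
        ((k : ℝ) + n) * (ratioDensity k n 0 w * ((2 * φ w - φ w ^ 2 / w) / (1 + w)))) := by
    refine setIntegral_congr_fun measurableSet_Ioi fun w hw => ?_
    have hw : 0 < w := hw
    have : 1 + w ≠ 0 := by positivity
    simp only [bFun]
    field_simp
    ring
  rw [e5, integral_sub i1 (i2.const_mul _), integral_const_mul, sub_eq_zero] at key
  rw [e4, key]
  push_cast
  ring

end Ratio

/-! ### Positivity of g₁ and its consequence for the mean of φ(W)/W -/

section Positivity

variable {φ : ℝ → ℝ} {C : ℝ} {K : ℝ≥0} {k n : ℕ}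

lemma norm_tail_integrand_le (hφ : ∀ w, 0 < w → |φ w| ≤ C) {t : ℝ} (ht : 0 < t) :
    ‖t ^ (-((n : ℝ) / 2)) * (h₁ φ t / t)‖ ≤ C * t ^ (-((n : ℝ) / 2) - 2) := by
  have h := hφ t ht
  rw [norm_mul, Real.norm_of_nonneg (by positivity), Real.norm_eq_abs, h₁, abs_div, abs_div,
    abs_of_pos ht, Real.rpow_sub ht, Real.rpow_two]
  calc _ = |φ t| * (t ^ (-((n : ℝ) / 2)) / t ^ 2) := by field_simp
    _ ≤ _ := by gcongr

lemma abs_tail_integral_le (hφ : ∀ w, 0 < w → |φ w| ≤ C) {w : ℝ} (hw : 0 < w) :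
    |∫ t in Ioi w, t ^ (-((n : ℝ) / 2)) * (h₁ φ t / t)| ≤ C * w ^ (-((n : ℝ) / 2) - 1) := by
  have hC : 0 ≤ C := (abs_nonneg _).trans (hφ 1 one_pos)
  have hn : (0 : ℝ) ≤ n / 2 := by positivity
  have hlt : -((n : ℝ) / 2) - 2 < -1 := by linarith
  have h1 : ‖∫ t in Ioi w, t ^ (-((n : ℝ) / 2)) * (h₁ φ t / t)‖ ≤
      ∫ t in Ioi w, C * t ^ (-((n : ℝ) / 2) - 2) := by
    refine norm_integral_le_of_norm_le ((integrableOn_Ioi_rpow_of_lt hlt hw).const_mul C) ?_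
    filter_upwards [ae_restrict_mem measurableSet_Ioi] with t ht
    exact norm_tail_integrand_le hφ (hw.trans ht)
  rw [integral_const_mul, integral_Ioi_rpow_of_lt hlt hw, Real.norm_eq_abs] at h1
  refine h1.trans ?_
  rw [show -((n : ℝ) / 2) - 2 + 1 = -((n : ℝ) / 2) - 1 by ring]
  gcongr
  rw [neg_div, ← div_neg]
  exact div_le_self (by positivity) (by linarith)

lemma abs_g₁_le (hφ : ∀ w, 0 < w → |φ w| ≤ C) {w : ℝ} (hw : 0 < w) :
    |g₁ n φ w| ≤ C / w := by
  rw [g₁, tailTransform, abs_mul, abs_of_nonneg (by positivity)]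
  calc _ ≤ w ^ ((n : ℝ) / 2) * (C * w ^ (-((n : ℝ) / 2) - 1)) := by
        gcongr
        exact abs_tail_integral_le hφ hw
    _ = C * (w ^ ((n : ℝ) / 2) * w ^ (-((n : ℝ) / 2) - 1)) := by ring
    _ = _ := by
      rw [← Real.rpow_add hw, show (n : ℝ) / 2 + (-(n / 2) - 1) = -1 by ring, Real.rpow_neg_one]
      rfl

/-- Since |g₁(w)| ≤ C/w, g₁ tends to 0 at infinity. A nonincreasing function with this limit cannot
be negative anywhere. -/
lemma g₁_pos (hφ : ∀ w, 0 < w → |φ w| ≤ C) (hg : AntitoneOn (g₁ n φ) (Ioi 0))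
    (hg₀ : ∀ w, 0 < w → g₁ n φ w ≠ 0) {w : ℝ} (hw : 0 < w) : 0 < g₁ n φ w := by
  by_contra hneg
  have hlt : g₁ n φ w < 0 := lt_of_le_of_ne (not_lt.1 hneg) (hg₀ w hw)
  have hC : 0 ≤ C := (abs_nonneg _).trans (hφ 1 one_pos)
  -- Chosen far enough out that C/t < -g₁(w), which contradicts g₁(t) ≤ g₁(w).
  set t := w + (C + 1) / (-g₁ n φ w) with ht
  have hpos : 0 < (C + 1) / (-g₁ n φ w) := div_pos (by linarith) (by linarith)
  have ht0 : 0 < t := by positivity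
  have h1 : g₁ n φ t ≤ g₁ n φ w := hg hw ht0 (by linarith)
  have h2 := (abs_le.1 (abs_g₁_le (n := n) hφ ht0)).1
  have h3 : C / t < -g₁ n φ w := by
    rw [div_lt_iff₀ ht0, ht, mul_add, mul_div_cancel₀ _ (by linarith)]
    nlinarith
  linarith

lemma IsShrinkageFn.integrableOn_tail (h : IsShrinkageFn φ C K) {w : ℝ} (hw : 0 < w) :
    IntegrableOn (fun t => t ^ (-((n : ℝ) / 2)) * (h₁ φ t / t)) (Ioi w) := by
  have hn : (0 : ℝ) ≤ n / 2 := by positivity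
  have hmeas := h.meas
  refine Integrable.mono' ((integrableOn_Ioi_rpow_of_lt
    (show -((n : ℝ) / 2) - 2 < -1 by linarith) hw).const_mul C) ?_ ?_
  · unfold h₁
    fun_prop
  · filter_upwards [ae_restrict_mem measurableSet_Ioi] with t ht
    exact norm_tail_integrand_le h.bound (hw.trans ht)

lemma IsShrinkageFn.hasDerivAt_tail (h : IsShrinkageFn φ C K) {w : ℝ} (hw : 0 < w) :
    HasDerivAt (fun w => ∫ t in Ioi w, t ^ (-((n : ℝ) / 2)) * (h₁ φ t / t))
      (-(w ^ (-((n : ℝ) / 2)) * (h₁ φ w / w))) w := by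
  set F := fun t : ℝ => t ^ (-((n : ℝ) / 2)) * (h₁ φ t / t) with hF
  have hmeas := h.meas
  have hcont : ContinuousAt F w := by
    have := h.lip.continuousOn.continuousAt (Ioi_mem_nhds hw)
    have hw0 := hw.ne'
    simp only [hF, h₁]
    exact (Real.continuousAt_rpow_const _ _ (Or.inl hw0)).mul
      ((this.div continuousAt_id hw0).div continuousAt_id hw0)
  have hFm : Measurable F := by
    simp only [hF, h₁]
    fun_prop
  have ha : 0 < w / 2 := by positivity
  have hint : IntegrableOn F (Ioi (w / 2)) := h.integrableOn_tail ha
  have hd := intervalIntegral.integral_hasDerivAt_right (a := w / 2) (b := w) (f := F)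
    ((intervalIntegrable_iff_integrableOn_Ioc_of_le (by linarith)).2
      (hint.mono_set fun x hx => hx.1)) hFm.stronglyMeasurable.stronglyMeasurableAtFilter hcont
  refine (hd.const_sub (∫ t in Ioi (w / 2), F t)).congr_of_eventuallyEq ?_
  filter_upwards [Ioi_mem_nhds (show w / 2 < w by linarith)] with x hx
  have hx : w / 2 < x := hx
  rw [eq_sub_iff_add_eq, add_comm]
  exact intervalIntegral.integral_interval_add_Ioi hint (hint.mono_set (Ioi_subset_Ioi hx.le))

/-- With H the tail integral in g₁ and r(w) = (w/(1+w))^((k+n)/2), φ(w)/w times the ratio density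
equals -H'(w)r(w). Integration by parts turns its integral into that of H·r', and H > 0 while r
increases. -/
lemma IsShrinkageFn.integral_div_nonneg (h : IsShrinkageFn φ C K) (hk : 3 ≤ k) (hn : 1 ≤ n)
    (hg : ∀ w, 0 < w → 0 < g₁ n φ w) :
    0 ≤ ∫ z : ℝ × ℝ, φ (z.1 / z.2) / (z.1 / z.2) ∂((chiSq k).prod (chiSq n)) := by
  have hC := h.nonneg
  have hmeas := h.meas
  rw [integral_comp_ratio (by omega) (by omega) (Φ := fun w => φ w / w) (by fun_prop)]
  refine mul_nonneg (ratioConst_pos (by omega) (by omega) 0).le ?_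
  set H : ℝ → ℝ := fun w => ∫ t in Ioi w, t ^ (-((n : ℝ) / 2)) * (h₁ φ t / t) with hH
  have hHpos : ∀ w, 0 < w → 0 < H w := by
    intro w hw
    have := hg w hw
    rw [g₁, tailTransform] at this
    exact (mul_pos_iff_of_pos_left (by positivity)).1 this
  set r : ℝ → ℝ := fun w => (w / (1 + w)) ^ (((k : ℝ) + n) / 2) with hr
  have hrm : ∀ w, 0 < w → r w * w ^ (-((n : ℝ) / 2) - 1) = ratioDensity k n 0 w := by
    intro w hw
    simp only [hr, ratioDensity]
    rw [Real.div_rpow hw.le (by positivity), Real.rpow_neg (show 0 ≤ 1 + w by positivity),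
      div_mul_eq_mul_div, ← Real.rpow_add hw, div_eq_mul_inv]
    congr 1
    · congr 1; ring
    · simp
  have hrpos : ∀ w, 0 < w → 0 ≤ r w := fun w hw => by positivity
  have hrd : ∀ w, 0 < w → HasDerivAt r ((1 / (1 + w) ^ 2) * (((k : ℝ) + n) / 2) *
      (w / (1 + w)) ^ (((k : ℝ) + n) / 2 - 1)) w := by
    intro w hw
    have h1 : HasDerivAt (fun w : ℝ => w / (1 + w)) (1 / (1 + w) ^ 2) w := by
      refine ((hasDerivAt_id w).div ((hasDerivAt_id w).const_add 1)
        (by simp only [id]; positivity)).congr_deriv ?_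
      simp
    exact h1.rpow_const (Or.inl (by positivity))
  have hPd : ∀ w, 0 < w → HasDerivAt (fun w => -(H w * r w))
      (-(-(w ^ (-((n : ℝ) / 2)) * (h₁ φ w / w)) * r w + H w * ((1 / (1 + w) ^ 2) *
        (((k : ℝ) + n) / 2) * (w / (1 + w)) ^ (((k : ℝ) + n) / 2 - 1)))) w := fun w hw =>
    ((h.hasDerivAt_tail hw).mul (hrd w hw)).neg
  have hint := integrableOn_ratioDensity_mul (k := k) (n := n) hk hn
    (Φ := fun w => φ w / w) (by fun_prop) (fun w hw => h.abs_div_le hw)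
  -- The boundary term is controlled by the ratio density, so it vanishes at both ends.
  have hbd : ∀ w, 0 < w → |(-(H w * r w))| ≤ C * ratioDensity k n 0 w := by
    intro w hw
    rw [abs_neg, abs_mul, abs_of_nonneg (hrpos w hw), ← hrm w hw, mul_comm (r w), ← mul_assoc]
    have := hrpos w hw
    gcongr
    exact abs_tail_integral_le h.bound hw
  have := le_integral_Ioi_of_tendsto (l₀ := 0) (l₁ := 0) hint (P := fun w => -(H w * r w))
    ?_ ?_ ?_
  · simpa using this
  · intro a b ha hab
    refine intervalIntegral.sub_le_integral_of_hasDeriv_right_of_le hab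
      (fun w hw => (hPd w (ha.trans_le hw.1)).continuousAt.continuousWithinAt)
      (fun w hw => (hPd w (ha.trans hw.1)).hasDerivWithinAt)
      (hint.mono_set fun w hw => ha.trans_le hw.1) ?_
    -- Dropping H·r' ≥ 0 from the derivative of -H·r leaves -H'·r, so only an inequality is needed
    -- and H·r' never has to be integrated.
    intro w hw
    have hw0 : 0 < w := ha.trans hw.1
    have e1 : 0 ≤ H w * ((1 / (1 + w) ^ 2) *
        (((k : ℝ) + n) / 2) * (w / (1 + w)) ^ (((k : ℝ) + n) / 2 - 1)) := by
      have := hHpos w hw0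
      positivity
    have e2 : ratioDensity k n 0 w * (φ w / w) =
        w ^ (-((n : ℝ) / 2)) * (h₁ φ w / w) * r w := by
      rw [← hrm w hw0, Real.rpow_sub_one hw0.ne', h₁]
      ring
    rw [e2]
    linarith
  · refine tendsto_zero_of_abs_le_mul (tendsto_ratioDensity_zero hk n) (B := C) ?_
    filter_upwards [self_mem_nhdsWithin] with w hw using hbd w hw
  · refine tendsto_zero_of_abs_le_mul (tendsto_ratioDensity_atTop k n) (B := C) ?_
    filter_upwards [eventually_gt_atTop 0] with w hw using hbd w hw

end Positivity

end ShrinkageMSE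

namespace ShrinkageMSE

/-! ### The quantities β⁽¹⁾(j) and β⁽²⁾(j) -/

section Beta

variable {φ : ℝ → ℝ} {C : ℝ} {K : ℝ≥0} {p n : ℕ}

/-- The expectation of `φ(W) / W` for `W = u / v` with independent `u ∼ χ²_k`, `v ∼ χ²_n`. -/
noncomputable def meanFactor (k n : ℕ) (φ : ℝ → ℝ) : ℝ :=
  ∫ z : ℝ × ℝ, φ (z.1 / z.2) / (z.1 / z.2) ∂((chiSq k).prod (chiSq n))

/-- The two b terms cancel, and the coefficients of φ(W)/W differ by 2(p + 2j - 1) - 2(p - 1) = 4j.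
This identity carries the sign of β⁽¹⁾ over to β⁽²⁾. -/
lemma IsShrinkageFn.betaOne_eq (h : IsShrinkageFn φ C K) (hp : 3 ≤ p) (hn : 1 ≤ n) (j : ℕ) :
    betaOne p n φ j = ((p : ℝ) + 2 * j - 1) * betaTwo p n φ j -
      4 * j * meanFactor (p + 2 * j) n φ := by
  have hk : (0 : ℝ) < (p : ℝ) + 2 * j := by
    have : (3 : ℝ) ≤ p := by exact_mod_cast hp
    positivity
  have i1 := h.integrable_betaTwo (k := p + 2 * j) (n := n) (by omega) hn 2 (1 / ((p : ℝ) + 2 * j))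
  have i2 := h.integrable_betaTwo (k := p + 2 * j) (n := n) (by omega) hn 1 0
  simp only [one_mul, zero_mul, sub_zero] at i2
  have e2 : betaTwo p n φ j = ∫ z : ℝ × ℝ, (2 * (φ (z.1 / z.2) / (z.1 / z.2)) -
      1 / ((p : ℝ) + 2 * j) * bFun n φ (z.1 / z.2)) ∂((chiSq (p + 2 * j)).prod (chiSq n)) := by
    unfold betaTwo
    congr 1
    ext z
    ring
  rw [e2, meanFactor, ← integral_const_mul, ← integral_const_mul,
    ← integral_sub (i1.const_mul _) (i2.const_mul _), betaOne]
  congr 1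
  ext z
  field_simp
  ring

/-- A real infimum over a family unbounded below is 0 by default. Only with this bound does a
nonnegative infimum say anything about the individual β⁽¹⁾(j). -/
lemma IsShrinkageFn.bddBelow_betaOne (h : IsShrinkageFn φ C K) (hp : 3 ≤ p) (hn : 1 ≤ n) :
    BddBelow (range (betaOne p n φ)) := by
  have hC := h.nonneg
  have hp' : (3 : ℝ) ≤ p := by exact_mod_cast hp
  set B := 4 * C + (n + 2) * C ^ 2 + 4 * K + 4 * C * K with hB
  have hB0 : 0 ≤ B := by positivity
  -- The integrand is at most a constant times 1 + v/u, and E[v/u] = n/(p + 2j - 2) ≤ n uniformly in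
  -- j.
  refine ⟨-((2 * (p - 1) * C + B) * (1 + n)), ?_⟩
  rintro _ ⟨j, rfl⟩
  have hk : (0 : ℝ) < (p : ℝ) + 2 * j := by positivity
  have := isProbabilityMeasure_chiSq (k := p + 2 * j) (by omega)
  have := isProbabilityMeasure_chiSq (k := n) hn
  refine (abs_le.1 ?_).1
  rw [betaOne, ← Real.norm_eq_abs]
  have hint := ((integrable_const (μ := (chiSq (p + 2 * j)).prod (chiSq n)) (1 : ℝ)).add
    (integrable_div_prod_chiSq (k := p + 2 * j) (n := n) (by omega) hn)).const_mul
      (2 * (p - 1) * C + B)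
  refine (norm_integral_le_of_norm_le hint ?_).trans ?_
  · filter_upwards [ae_pos_prod_chiSq (p + 2 * j) n] with z hz
    set w := z.1 / z.2 with hw
    have hw0 : 0 < w := div_pos hz.1 hz.2
    have e : z.2 / z.1 = 1 / w := by rw [hw, one_div_div]
    rw [Pi.add_apply, e, Real.norm_eq_abs]
    refine (abs_sub _ _).trans ?_
    have b1 : |2 * ((p : ℝ) - 1) * φ w / w| ≤ 2 * (p - 1) * C * (1 + 1 / w) := by
      rw [mul_div_assoc, abs_mul, abs_of_nonneg (by linarith), mul_assoc _ C]
      exact mul_le_mul_of_nonneg_left (h.abs_div_le hw0) (by linarith)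
    have b2 : |((p : ℝ) + 2 * j - 1) * bFun n φ w / ((p : ℝ) + 2 * j)| ≤ B * (1 + 1 / w) := by
      refine le_trans ?_ (h.abs_bFun_le n hw0)
      have hj : (0 : ℝ) ≤ j := by positivity
      rw [mul_div_right_comm, abs_mul, abs_of_nonneg (div_nonneg (by linarith) hk.le)]
      exact mul_le_of_le_one_left (abs_nonneg _) ((div_le_one hk).2 (by linarith))
    linarith
  · rw [integral_const_mul]
    refine mul_le_mul_of_nonneg_left ?_ (by nlinarith)
    have hint2 := integrable_div_prod_chiSq (k := p + 2 * j) (n := n) (by omega) hn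
    have : ∫ z, ((fun _ : ℝ × ℝ => (1 : ℝ)) + fun z : ℝ × ℝ => z.2 / z.1) z
        ∂((chiSq (p + 2 * j)).prod (chiSq n)) = 1 + n / (((p + 2 * j : ℕ) : ℝ) - 2) := by
      simp only [Pi.add_apply]
      rw [integral_add (integrable_const _) hint2,
        integral_div_prod_chiSq (by omega) hn]
      simp
    rw [this]
    have hj : (0 : ℝ) ≤ j := by positivity
    gcongr
    refine div_le_self (by positivity) ?_
    push_cast
    linarith

lemma IsShrinkageFn.betaOne_nonneg (h : IsShrinkageFn φ C K) (hp : 3 ≤ p) (hn : 1 ≤ n)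
    (hβ : 0 ≤ betaOneInf p n φ) (j : ℕ) : 0 ≤ betaOne p n φ j :=
  hβ.trans (ciInf_le (h.bddBelow_betaOne hp hn) j)

lemma IsShrinkageFn.betaTwo_nonneg (h : IsShrinkageFn φ C K) (hp : 3 ≤ p) (hn : 1 ≤ n)
    (hβ : 0 ≤ betaOneInf p n φ) (hg : ∀ w, 0 < w → 0 < g₁ n φ w) (j : ℕ) :
    0 ≤ betaTwo p n φ j := by
  have h1 := h.betaOne_nonneg hp hn hβ j
  have h2 : 0 ≤ meanFactor (p + 2 * j) n φ :=
    h.integral_div_nonneg (k := p + 2 * j) (n := n) (by omega) hn hg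
  rw [h.betaOne_eq hp hn] at h1
  have hp' : (3 : ℝ) ≤ p := by exact_mod_cast hp
  have hj : (0 : ℝ) ≤ j := by positivity
  refine nonneg_of_mul_nonneg_right (a := (p : ℝ) + 2 * j - 1) ?_ (by linarith)
  nlinarith [mul_nonneg hj h2]

/-- Expanding with w = u/v, (1 - φ/w)²u = u - v(2φ - φ²/w), and `integral_betaTwo` evaluates the
second term. This is how β⁽²⁾ enters the risk of the estimator. -/
lemma IsShrinkageFn.integral_sq_mul (h : IsShrinkageFn φ C K) (hp : 3 ≤ p) (hn : 1 ≤ n) (j : ℕ) :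
    ∫ z : ℝ × ℝ, (1 - φ (z.1 / z.2) / (z.1 / z.2)) ^ 2 * z.1
      ∂((chiSq (p + 2 * j)).prod (chiSq n)) =
    ((p : ℝ) + 2 * j) * (1 - betaTwo p n φ j) := by
  have hC := h.nonneg
  have hmeas := h.meas
  have hk : (0 : ℝ) < (p : ℝ) + 2 * j := by
    have : (3 : ℝ) ≤ p := by exact_mod_cast hp
    positivity
  have := isProbabilityMeasure_chiSq (k := p + 2 * j) (by omega)
  have := isProbabilityMeasure_chiSq (k := n) hn
  have e := h.integral_betaTwo (k := p + 2 * j) (n := n) (by omega) hn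
  have e2 : ((p : ℝ) + 2 * j) * betaTwo p n φ j =
      ∫ z : ℝ × ℝ, (2 * (p + 2 * j : ℕ) * (φ (z.1 / z.2) / (z.1 / z.2)) - bFun n φ (z.1 / z.2))
      ∂((chiSq (p + 2 * j)).prod (chiSq n)) := by
    rw [betaTwo, ← integral_const_mul]
    congr 1
    ext z
    push_cast
    field_simp
  have i1 : Integrable (fun z : ℝ × ℝ => z.1) ((chiSq (p + 2 * j)).prod (chiSq n)) :=
    (integrable_id_chiSq (k := p + 2 * j) (by omega)).comp_fst _
  have i2 : Integrable (fun z : ℝ × ℝ => z.2 * (2 * φ (z.1 / z.2) -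
      φ (z.1 / z.2) ^ 2 / (z.1 / z.2))) ((chiSq (p + 2 * j)).prod (chiSq n)) := by
    have j1 : Integrable (fun z : ℝ × ℝ => z.2) ((chiSq (p + 2 * j)).prod (chiSq n)) :=
      (integrable_id_chiSq (k := n) (by omega)).comp_snd _
    have j2 : Integrable (fun z : ℝ × ℝ => z.1⁻¹ * z.2 ^ 2)
        ((chiSq (p + 2 * j)).prod (chiSq n)) :=
      (integrable_inv_chiSq (k := p + 2 * j) (by omega)).mul_prod (by
        simpa using integrable_rpow_chiSq (k := n) (a := 2) (by positivity))
    refine Integrable.mono' ((j1.const_mul (2 * C)).add (j2.const_mul (C ^ 2))) (by fun_prop) ?_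
    filter_upwards [ae_pos_prod_chiSq (p + 2 * j) n] with z hz
    have hw0 : 0 < z.1 / z.2 := div_pos hz.1 hz.2
    have b1 := h.bound _ hw0
    have b2 := h.sq_le hw0
    have hz1 := hz.1
    have hz2 := hz.2
    rw [norm_mul, Real.norm_of_nonneg hz.2.le, Real.norm_eq_abs, Pi.add_apply]
    have b3 : |2 * φ (z.1 / z.2) - φ (z.1 / z.2) ^ 2 / (z.1 / z.2)| ≤
        2 * C + C ^ 2 / (z.1 / z.2) := by
      refine (abs_sub _ _).trans ?_
      rw [abs_mul, abs_div, abs_of_pos hw0, abs_of_nonneg (sq_nonneg (φ (z.1 / z.2)))]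
      simp only [Nat.abs_ofNat]
      gcongr
    calc _ ≤ z.2 * (2 * C + C ^ 2 / (z.1 / z.2)) := by gcongr
      _ = _ := by field_simp
  rw [mul_sub, e2, e, mul_one]
  have e3 : ∫ z : ℝ × ℝ, z.1 ∂((chiSq (p + 2 * j)).prod (chiSq n)) = (p : ℝ) + 2 * j := by
    have := integral_fun_fst (μ := chiSq (p + 2 * j)) (ν := chiSq n) (fun u : ℝ => u)
    rw [this, integral_id_chiSq (by omega)]
    simp
  rw [← e3, ← integral_sub i1 i2]
  refine integral_congr_ae ?_
  filter_upwards [ae_pos_prod_chiSq (p + 2 * j) n] with z hz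
  have hz1 := hz.1.ne'
  have hz2 := hz.2.ne'
  field_simp
  ring

/-- Weighting `χ²_k` with `u` adds two degrees of freedom. -/
lemma chiSq_add_two {k : ℕ} (hk : 0 < k) :
    chiSq (k + 2) = (chiSq k).withDensity (fun u => ENNReal.ofReal (u / k)) := by
  have hk' : (0 : ℝ) < k := by exact_mod_cast hk
  have hc := chiConst_pos hk
  rw [chiSq_eq_withDensity, chiSq_eq_withDensity,
    ← withDensity_mul _ (by fun_prop) (by fun_prop)]
  refine withDensity_congr_ae ?_
  filter_upwards [ae_restrict_mem measurableSet_Ioi] with u hu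
  have hu' : (0 : ℝ) < u := hu
  rw [Pi.mul_apply, ← ENNReal.ofReal_mul (by positivity)]
  congr 1
  have h1 : chiConst (k + 2) = chiConst k / k := by
    unfold chiConst
    push_cast
    have : Real.Gamma ((k : ℝ) / 2) ≠ 0 := (Real.Gamma_pos_of_pos (by positivity)).ne'
    rw [show ((k : ℝ) + 2) / 2 = k / 2 + 1 by ring, Real.Gamma_add_one (by positivity),
      Real.rpow_add_one (by norm_num)]
    field_simp
  have h2 : u ^ (((k + 2 : ℕ) : ℝ) / 2 - 1) = u ^ ((k : ℝ) / 2 - 1) * u := by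
    rw [← Real.rpow_add_one hu'.ne']
    congr 1
    push_cast
    ring
  rw [h1, h2]
  field_simp

lemma integral_prod_chiSq_add_two {k : ℕ} (hk : 0 < k) (κ : Measure ℝ) [SFinite κ]
    (f : ℝ × ℝ → ℝ) :
    ∫ z, f z ∂((chiSq (k + 2)).prod κ) = (1 / (k : ℝ)) * ∫ z, f z * z.1 ∂((chiSq k).prod κ) := by
  have hpos : ∀ᵐ z ∂((chiSq k).prod κ), 0 < z.1 :=
    Measure.quasiMeasurePreserving_fst.ae (ae_pos_chiSq k)
  rw [chiSq_add_two hk, prod_withDensity_left (by fun_prop),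
    integral_withDensity_eq_integral_toReal_smul (by fun_prop)
      (Filter.Eventually.of_forall fun _ => ENNReal.ofReal_lt_top), ← integral_const_mul]
  refine integral_congr_ae ?_
  filter_upwards [hpos] with z hz
  rw [ENNReal.toReal_ofReal (by positivity), smul_eq_mul]
  ring

end Beta

end ShrinkageMSE

namespace ShrinkageMSE

/-! ### Poisson mixture expansions of noncentral expectations -/

section Series

variable {p n : ℕ}

/-- The integrability criterion behind all later domination: the weight allows a pole 1/‖x‖² at the
origin, quadratic growth in ‖x‖ and s, and the exponential tilt. -/
lemma integrable_of_abs_le (hp : 3 ≤ p) (hn : 1 ≤ n)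
    {F : EuclideanSpace ℝ (Fin p) × ℝ → ℝ} {B c : ℝ}
    (hF : AEStronglyMeasurable F ((stdGaussian (EuclideanSpace ℝ (Fin p))).prod (chiSq n)))
    (hB : ∀ x s, x ≠ 0 → 0 < s → |F (x, s)| ≤
      B * ((1 + 1 / ‖x‖ ^ 2) * (1 + ‖x‖ ^ 2) * (1 + s ^ 2) * Real.exp (c * ‖x‖))) :
    Integrable F ((stdGaussian (EuclideanSpace ℝ (Fin p))).prod (chiSq n)) := by
  -- The extra 1 in the rate pays for 1 + ‖x‖² ≤ 2 exp ‖x‖.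
  refine Integrable.mono' ((integrable_envelope hp hn (c + 1)).const_mul (2 * |B|)) hF ?_
  filter_upwards [ae_prod_pos (p := p) (by omega) n] with z hz
  refine (hB z.1 z.2 hz.1 hz.2).trans ?_
  have hx : 0 ≤ ‖z.1‖ := norm_nonneg _
  have h1 : 1 + ‖z.1‖ ^ 2 ≤ 2 * Real.exp ‖z.1‖ := by
    have := Real.quadratic_le_exp_of_nonneg hx
    nlinarith
  have h2 : Real.exp ((c + 1) * ‖z.1‖) = Real.exp ‖z.1‖ * Real.exp (c * ‖z.1‖) := by
    rw [← Real.exp_add]; ring_nf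
  calc _ ≤ |B| * ((1 + 1 / ‖z.1‖ ^ 2) * (2 * Real.exp ‖z.1‖) * (1 + z.2 ^ 2) *
        Real.exp (c * ‖z.1‖)) := by
        gcongr
        exact le_abs_self B
    _ = _ := by
        rw [envelope, h2]
        ring

lemma map_neg_stdGaussian_prod (n : ℕ) :
    ((stdGaussian (EuclideanSpace ℝ (Fin p))).prod (chiSq n)).map (fun z => (-z.1, z.2)) =
      (stdGaussian (EuclideanSpace ℝ (Fin p))).prod (chiSq n) := by
  have h := stdGaussian_map (LinearIsometryEquiv.neg ℝ (E := EuclideanSpace ℝ (Fin p)))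
  have h2 := Measure.map_prod_map (stdGaussian (EuclideanSpace ℝ (Fin p))) (chiSq n)
    (f := fun x => -x) (g := id) (by fun_prop) measurable_id
  rw [Measure.map_id] at h2
  have h3 : (stdGaussian (EuclideanSpace ℝ (Fin p))).map (fun x => -x) =
    stdGaussian (EuclideanSpace ℝ (Fin p)) := h
  rw [h3] at h2
  exact h2.symm

lemma measurableEmbedding_neg_fst :
    MeasurableEmbedding (fun z : EuclideanSpace ℝ (Fin p) × ℝ => (-z.1, z.2)) :=
  (Homeomorph.neg _).measurableEmbedding.prodMap MeasurableEmbedding.id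

lemma exp_inner_smul (e : EuclideanSpace ℝ (Fin p)) (he : ‖e‖ = 1) (t : ℝ)
    (x : EuclideanSpace ℝ (Fin p)) :
    Real.exp (inner ℝ x (t • e) - ‖t • e‖ ^ 2 / 2) =
      Real.exp (-t ^ 2 / 2) * Real.exp (t * inner ℝ x e) := by
  rw [← Real.exp_add, real_inner_smul_right, norm_smul, he, mul_one, Real.norm_eq_abs, sq_abs]
  ring_nf

/-- Symmetrisation of the expectation of a function of `‖x‖²`, `⟨x, e⟩` and `s`. -/
lemma integral_model_symm {e : EuclideanSpace ℝ (Fin p)} (he : ‖e‖ = 1) (t : ℝ)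
    {k : ℝ × ℝ → ℝ} {f : ℝ → ℝ}
    (hint : Integrable (fun z => k (‖z.1‖ ^ 2, z.2) *
      (f (inner ℝ z.1 e) * Real.exp (t * inner ℝ z.1 e)))
      ((stdGaussian (EuclideanSpace ℝ (Fin p))).prod (chiSq n))) :
    Integrable (fun z => k (‖z.1‖ ^ 2, z.2) * ((fun y => (f y * Real.exp (t * y) +
      f (-y) * Real.exp (-(t * y))) / 2) (inner ℝ z.1 e)))
        ((stdGaussian (EuclideanSpace ℝ (Fin p))).prod (chiSq n)) ∧
    ∫ z, f (inner ℝ z.1 e) * k (‖z.1‖ ^ 2, z.2) ∂(model n (t • e) 1) = Real.exp (-t ^ 2 / 2) *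
      ∫ z, k (‖z.1‖ ^ 2, z.2) * ((fun y => (f y * Real.exp (t * y) +
      f (-y) * Real.exp (-(t * y))) / 2) (inner ℝ z.1 e))
        ∂((stdGaussian (EuclideanSpace ℝ (Fin p))).prod (chiSq n)) := by
  set G : EuclideanSpace ℝ (Fin p) × ℝ → ℝ := fun z => k (‖z.1‖ ^ 2, z.2) *
      (f (inner ℝ z.1 e) * Real.exp (t * inner ℝ z.1 e)) with hG
  have hint' : Integrable (fun z : EuclideanSpace ℝ (Fin p) × ℝ => G (-z.1, z.2))
      ((stdGaussian (EuclideanSpace ℝ (Fin p))).prod (chiSq n)) := by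
    have := hint
    rw [← map_neg_stdGaussian_prod, measurableEmbedding_neg_fst.integrable_map_iff] at this
    exact this
  have heq : ∫ z, G (-z.1, z.2) ∂((stdGaussian (EuclideanSpace ℝ (Fin p))).prod (chiSq n)) =
      ∫ z, G z ∂((stdGaussian (EuclideanSpace ℝ (Fin p))).prod (chiSq n)) := by
    conv_rhs => rw [← map_neg_stdGaussian_prod, measurableEmbedding_neg_fst.integral_map]
  have hpt : (fun z : EuclideanSpace ℝ (Fin p) × ℝ => k (‖z.1‖ ^ 2, z.2) *
      ((fun y => (f y * Real.exp (t * y) + f (-y) * Real.exp (-(t * y))) / 2) (inner ℝ z.1 e))) =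
      fun z => (1 / 2) * (G z + G (-z.1, z.2)) := by
    ext z
    simp only [hG, inner_neg_left, norm_neg, mul_neg]
    ring
  rw [hpt]
  refine ⟨(hint.add hint').const_mul _, ?_⟩
  rw [integral_const_mul, integral_add hint hint', heq, integral_model_one,
    ← integral_add hint hint, ← integral_const_mul, ← integral_const_mul]
  congr 1
  ext z
  rw [exp_inner_smul e he, smul_eq_mul]
  simp only [hG]
  ring

lemma _root_.HasSum.congr_terms {f g : ℕ → ℝ} {a : ℝ} (h : HasSum f a) (hfg : ∀ j, f j = g j) :
    HasSum g a :=
  funext hfg ▸ h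

/-- The Poisson weight of the mixture representation of the noncentral model. -/
noncomputable def mixWeight (t : ℝ) (j : ℕ) : ℝ :=
  Real.exp (-t ^ 2 / 2) * (t ^ (2 * j) / (Nat.factorial (2 * j) : ℝ) * evenMoment j)

lemma mixWeight_nonneg (t : ℝ) (j : ℕ) : 0 ≤ mixWeight t j := by
  have h1 : 0 ≤ t ^ (2 * j) := (even_two_mul j).pow_nonneg t
  have h2 := evenMoment_nonneg j
  unfold mixWeight
  positivity

lemma mixWeight_zero_pos (t : ℝ) : 0 < mixWeight t 0 := by
  simp [mixWeight, Real.exp_pos]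

lemma abs_inner_le_norm_of_unit {e : EuclideanSpace ℝ (Fin p)} (he : ‖e‖ = 1)
    (x : EuclideanSpace ℝ (Fin p)) : |inner ℝ x e| ≤ ‖x‖ := by
  simpa [he] using abs_real_inner_le_norm x e

lemma exp_mul_inner_le {e : EuclideanSpace ℝ (Fin p)} (he : ‖e‖ = 1) (t : ℝ)
    (x : EuclideanSpace ℝ (Fin p)) :
    Real.exp (t * inner ℝ x e) ≤ Real.exp (|t| * ‖x‖) := by
  refine Real.exp_le_exp.2 ((le_abs_self _).trans ?_)
  rw [abs_mul]
  have := abs_inner_le_norm_of_unit he x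
  gcongr

/-- The noncentral chi-square law as a Poisson mixture. Averaged over x ↦ -x the tilt exp(t⟨x, e⟩)
becomes cosh, and its Taylor terms are even powers of ⟨x, e⟩ with nonnegative coefficients. -/
lemma hasSum_model_zero (hp : 3 ≤ p) (hn : 1 ≤ n) {e : EuclideanSpace ℝ (Fin p)} (he : ‖e‖ = 1)
    (t : ℝ) {k : ℝ × ℝ → ℝ} (hk : Measurable k) {B : ℝ}
    (hB : ∀ u s, 0 < u → 0 < s → |k (u, s)| ≤ B * ((1 + 1 / u) * (1 + u) * (1 + s ^ 2))) :
    HasSum (fun j => mixWeight t j * ∫ z, k z ∂((chiSq (p + 2 * j)).prod (chiSq n)))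
      (∫ z, k (‖z.1‖ ^ 2, z.2) ∂(model n (t • e) 1)) := by
  have hkm : Measurable fun z : EuclideanSpace ℝ (Fin p) × ℝ => k (‖z.1‖ ^ 2, z.2) :=
    hk.comp (by fun_prop)
  have hint : Integrable (fun z : EuclideanSpace ℝ (Fin p) × ℝ => k (‖z.1‖ ^ 2, z.2) *
      ((fun _ => (1 : ℝ)) (inner ℝ z.1 e) * Real.exp (t * inner ℝ z.1 e)))
      ((stdGaussian (EuclideanSpace ℝ (Fin p))).prod (chiSq n)) := by
    refine integrable_of_abs_le hp hn (B := B) (c := |t|) (by fun_prop) fun x s hx hs => ?_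
    have h1 := hB (‖x‖ ^ 2) s (by positivity) hs
    rw [one_mul, abs_mul, Real.abs_exp, ← mul_assoc]
    exact mul_le_mul h1 (exp_mul_inner_le he t x) (Real.exp_pos _).le ((abs_nonneg _).trans h1)
  obtain ⟨h1, h2⟩ := integral_model_symm he t (k := k) (f := fun _ => 1) hint
  have hs := hasSum_integral_even (p := p) (by omega) (κ := chiSq n) he
    (a := fun j => t ^ (2 * j) / (Nat.factorial (2 * j) : ℝ)) (m := fun j => j)
    (f := fun y => (1 * Real.exp (t * y) + 1 * Real.exp (-(t * y))) / 2)
    (fun j => div_nonneg ((even_two_mul j).pow_nonneg t) (by positivity))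
    (fun y => by
      have := Real.hasSum_cosh (t * y)
      rw [Real.cosh_eq] at this
      simpa [mul_pow, div_mul_eq_mul_div] using this) hk h1
  simp only [one_mul] at h2
  rw [h2]
  simpa [mixWeight, mul_assoc] using hs.mul_left (Real.exp (-t ^ 2 / 2))

/-- With the odd factor t⟨x, e⟩ the symmetrised tilt is y·sinh y at y = t⟨x, e⟩. Rewriting 1/(2j-1)!
as 2j/(2j)! produces the factor 2j. -/
lemma hasSum_model_one (hp : 3 ≤ p) (hn : 1 ≤ n) {e : EuclideanSpace ℝ (Fin p)} (he : ‖e‖ = 1)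
    (t : ℝ) {k : ℝ × ℝ → ℝ} (hk : Measurable k) {B : ℝ}
    (hB : ∀ u s, 0 < u → 0 < s → |k (u, s)| ≤ B * ((1 + 1 / u) * (1 + u) * (1 + s ^ 2))) :
    HasSum (fun j : ℕ => mixWeight t j * (2 * j) *
      ∫ z, k z ∂((chiSq (p + 2 * j)).prod (chiSq n)))
      (∫ z, (t * inner ℝ z.1 e) * k (‖z.1‖ ^ 2, z.2) ∂(model n (t • e) 1)) := by
  have hkm : Measurable fun z : EuclideanSpace ℝ (Fin p) × ℝ => k (‖z.1‖ ^ 2, z.2) :=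
    hk.comp (by fun_prop)
  have hint : Integrable (fun z : EuclideanSpace ℝ (Fin p) × ℝ => k (‖z.1‖ ^ 2, z.2) *
      ((fun y => t * y) (inner ℝ z.1 e) * Real.exp (t * inner ℝ z.1 e)))
      ((stdGaussian (EuclideanSpace ℝ (Fin p))).prod (chiSq n)) := by
    refine integrable_of_abs_le hp hn (B := B * |t|) (c := 1 + |t|) (by fun_prop)
      fun x s hx hs => ?_
    have h1 := hB (‖x‖ ^ 2) s (by positivity) hs
    have h2 : |t * inner ℝ x e| ≤ |t| * Real.exp ‖x‖ := by
      rw [abs_mul]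
      have := (abs_inner_le_norm_of_unit he x).trans
        ((by linarith : ‖x‖ ≤ ‖x‖ + 1).trans (Real.add_one_le_exp ‖x‖))
      gcongr
    have h3 : Real.exp ((1 + |t|) * ‖x‖) = Real.exp ‖x‖ * Real.exp (|t| * ‖x‖) := by
      rw [← Real.exp_add]; ring_nf
    rw [abs_mul, abs_mul, Real.abs_exp, h3]
    calc _ ≤ (B * ((1 + 1 / ‖x‖ ^ 2) * (1 + ‖x‖ ^ 2) * (1 + s ^ 2))) *
          ((|t| * Real.exp ‖x‖) * Real.exp (|t| * ‖x‖)) :=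
          mul_le_mul h1 (mul_le_mul h2 (exp_mul_inner_le he t x) (Real.exp_pos _).le
            (by positivity)) (by positivity) ((abs_nonneg _).trans h1)
      _ = _ := by ring
  obtain ⟨h1, h2⟩ := integral_model_symm he t (k := k) (f := fun y => t * y) hint
  have hs := hasSum_integral_even (p := p) (by omega) (κ := chiSq n) he
    (a := fun j => t ^ (2 * (j + 1)) / (Nat.factorial (2 * j + 1) : ℝ)) (m := fun j => j + 1)
    (f := fun y => (t * y * Real.exp (t * y) + t * -y * Real.exp (-(t * y))) / 2)
    (fun j => div_nonneg ((even_two_mul _).pow_nonneg t) (by positivity))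
    (fun y => by
      have := (Real.hasSum_sinh (t * y)).mul_left (t * y)
      rw [Real.sinh_eq] at this
      have e1 : (fun j : ℕ => t * y * ((t * y) ^ (2 * j + 1) / (Nat.factorial (2 * j + 1) : ℝ))) =
          fun j => t ^ (2 * (j + 1)) / (Nat.factorial (2 * j + 1) : ℝ) * y ^ (2 * (j + 1)) := by
        ext j
        rw [mul_pow]
        ring
      rw [e1] at this
      have e2 : (t * y * Real.exp (t * y) + t * -y * Real.exp (-(t * y))) / 2 =
          t * y * ((Real.exp (t * y) - Real.exp (-(t * y))) / 2) := by ring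
      rw [e2]
      exact this) hk h1
  rw [h2]
  have hs2 := hs.mul_left (Real.exp (-t ^ 2 / 2))
  -- The sinh series begins at the power 2 of ⟨x, e⟩, so it is the claimed series from j = 1 on. The
  -- missing term j = 0 vanishes through the factor 2j.
  have hshift := (hasSum_nat_add_iff (f := fun j : ℕ => mixWeight t j * (2 * j) *
      ∫ z, k z ∂((chiSq (p + 2 * j)).prod (chiSq n))) 1).1 (by
    refine HasSum.congr_terms hs2 fun j => ?_
    have hf : (Nat.factorial (2 * (j + 1)) : ℝ) =
        2 * ((j : ℝ) + 1) * Nat.factorial (2 * j + 1) := by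
      rw [show 2 * (j + 1) = (2 * j + 1) + 1 by ring, Nat.factorial_succ]
      push_cast
      ring
    have hf0 : (Nat.factorial (2 * j + 1) : ℝ) ≠ 0 := by positivity
    have hj : (j : ℝ) + 1 ≠ 0 := by positivity
    simp only [mixWeight]
    rw [hf]
    push_cast
    field_simp)
  simpa using hshift

/-- The factor ⟨x, e⟩² raises each power in the cosh series by two. The moment recursion gives 2j +
1, and the two extra degrees of freedom are undone by the weight u/(p + 2j). -/
lemma hasSum_model_two (hp : 3 ≤ p) (hn : 1 ≤ n) {e : EuclideanSpace ℝ (Fin p)} (he : ‖e‖ = 1)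
    (t : ℝ) {k : ℝ × ℝ → ℝ} (hk : Measurable k) {B : ℝ}
    (hB : ∀ u s, 0 < u → 0 < s → |k (u, s)| * u ≤ B * ((1 + 1 / u) * (1 + u) * (1 + s ^ 2))) :
    HasSum (fun j : ℕ => mixWeight t j * ((2 * j + 1) / ((p : ℝ) + 2 * j)) *
      ∫ z, k z * z.1 ∂((chiSq (p + 2 * j)).prod (chiSq n)))
      (∫ z, (inner ℝ z.1 e) ^ 2 * k (‖z.1‖ ^ 2, z.2) ∂(model n (t • e) 1)) := by
  have hkm : Measurable fun z : EuclideanSpace ℝ (Fin p) × ℝ => k (‖z.1‖ ^ 2, z.2) :=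
    hk.comp (by fun_prop)
  have hint : Integrable (fun z : EuclideanSpace ℝ (Fin p) × ℝ => k (‖z.1‖ ^ 2, z.2) *
      ((fun y => y ^ 2) (inner ℝ z.1 e) * Real.exp (t * inner ℝ z.1 e)))
      ((stdGaussian (EuclideanSpace ℝ (Fin p))).prod (chiSq n)) := by
    refine integrable_of_abs_le hp hn (B := B) (c := |t|) (by fun_prop) fun x s hx hs => ?_
    have h1 := hB (‖x‖ ^ 2) s (by positivity) hs
    have h2 : (inner ℝ x e) ^ 2 ≤ ‖x‖ ^ 2 :=
      sq_le_sq' (abs_le.1 (abs_inner_le_norm_of_unit he x)).1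
        (abs_le.1 (abs_inner_le_norm_of_unit he x)).2
    have h3 : |k (‖x‖ ^ 2, s)| * (inner ℝ x e) ^ 2 ≤
        B * ((1 + 1 / ‖x‖ ^ 2) * (1 + ‖x‖ ^ 2) * (1 + s ^ 2)) := le_trans (by gcongr) h1
    rw [abs_mul, abs_mul, Real.abs_exp, abs_of_nonneg (sq_nonneg (inner ℝ x e)), ← mul_assoc,
      ← mul_assoc]
    exact mul_le_mul h3 (exp_mul_inner_le he t x) (Real.exp_pos _).le
      ((by positivity : (0 : ℝ) ≤ _).trans h3)
  obtain ⟨h1, h2⟩ := integral_model_symm he t (k := k) (f := fun y => y ^ 2) hint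
  have hs := hasSum_integral_even (p := p) (by omega) (κ := chiSq n) he
    (a := fun j => t ^ (2 * j) / (Nat.factorial (2 * j) : ℝ)) (m := fun j => j + 1)
    (f := fun y => (y ^ 2 * Real.exp (t * y) + (-y) ^ 2 * Real.exp (-(t * y))) / 2)
    (fun j => div_nonneg ((even_two_mul j).pow_nonneg t) (by positivity))
    (fun y => by
      have := (Real.hasSum_cosh (t * y)).mul_left (y ^ 2)
      rw [Real.cosh_eq] at this
      have e1 : (fun j : ℕ => y ^ 2 * ((t * y) ^ (2 * j) / (Nat.factorial (2 * j) : ℝ))) =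
          fun j => t ^ (2 * j) / (Nat.factorial (2 * j) : ℝ) * y ^ (2 * (j + 1)) := by
        ext j
        rw [mul_pow]
        ring
      rw [e1] at this
      have e2 : (y ^ 2 * Real.exp (t * y) + (-y) ^ 2 * Real.exp (-(t * y))) / 2 =
          y ^ 2 * ((Real.exp (t * y) + Real.exp (-(t * y))) / 2) := by ring
      rw [e2]
      exact this) hk h1
  rw [h2]
  refine HasSum.congr_terms (hs.mul_left (Real.exp (-t ^ 2 / 2))) fun j => ?_
  rw [show p + 2 * (j + 1) = (p + 2 * j) + 2 by ring,
    integral_prod_chiSq_add_two (by omega) (chiSq n) k, evenMoment_succ, mixWeight]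
  push_cast
  ring

end Series

end ShrinkageMSE

namespace ShrinkageMSE

/-! ### Mean squared error along a direction, and rotational symmetry -/

section DirectionalMSE

variable {p n : ℕ} {φ : ℝ → ℝ} {C : ℝ} {K : ℝ≥0}

lemma one_le_weight {u s : ℝ} (hu : 0 < u) : 1 ≤ (1 + 1 / u) * (1 + u) * (1 + s ^ 2) := by
  have h1 : 0 ≤ 1 / u := by positivity
  have h2 := sq_nonneg s
  exact one_le_mul_of_one_le_of_one_le
    (one_le_mul_of_one_le_of_one_le (by linarith) (by linarith)) (by linarith)

lemma add_div_le_weight {u s : ℝ} (hu : 0 < u) :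
    u + s ^ 2 / u ≤ (1 + 1 / u) * (1 + u) * (1 + s ^ 2) := by
  have e : (1 + 1 / u) * (1 + u) * (1 + s ^ 2) =
      u + s ^ 2 / u + (2 + 1 / u + (2 + u) * s ^ 2) := by
    field_simp
    ring
  have : 0 ≤ 2 + 1 / u + (2 + u) * s ^ 2 := by positivity
  linarith

lemma integrable_model_one_of_abs_le (hp : 3 ≤ p) (hn : 1 ≤ n) (θ : EuclideanSpace ℝ (Fin p))
    {F : EuclideanSpace ℝ (Fin p) × ℝ → ℝ} (hF : Measurable F) {B : ℝ}
    (hB : ∀ x s, x ≠ 0 → 0 < s → |F (x, s)| ≤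
      B * ((1 + 1 / ‖x‖ ^ 2) * (1 + ‖x‖ ^ 2) * (1 + s ^ 2))) :
    Integrable F (model n θ 1) := by
  rw [integrable_model_one_iff]
  refine integrable_of_abs_le hp hn (B := B) (c := ‖θ‖) (by fun_prop) fun x s hx hs => ?_
  have h1 := hB x s hx hs
  have h2 : Real.exp (inner ℝ x θ - ‖θ‖ ^ 2 / 2) ≤ Real.exp (‖θ‖ * ‖x‖) := by
    refine Real.exp_le_exp.2 ?_
    have := real_inner_le_norm x θ
    nlinarith [sq_nonneg ‖θ‖]
  rw [abs_mul, Real.abs_exp]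
  calc _ ≤ Real.exp (‖θ‖ * ‖x‖) * (B * ((1 + 1 / ‖x‖ ^ 2) * (1 + ‖x‖ ^ 2) * (1 + s ^ 2))) :=
        mul_le_mul h2 h1 (abs_nonneg _) (Real.exp_pos _).le
    _ = _ := by ring

lemma IsShrinkageFn.sq_factor_mul_le (h : IsShrinkageFn φ C K) {u s : ℝ} (hu : 0 < u)
    (hs : 0 < s) : (1 - φ (u / s) / (u / s)) ^ 2 * u ≤
      2 * (1 + C ^ 2) * ((1 + 1 / u) * (1 + u) * (1 + s ^ 2)) := by
  have h1 := h.sq_le (div_pos hu hs)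
  have h2 := add_div_le_weight (s := s) hu
  have h3 : (1 - φ (u / s) / (u / s)) ^ 2 * u ≤ 2 * (u + φ (u / s) ^ 2 * (s ^ 2 / u)) := by
    have e : φ (u / s) ^ 2 * (s ^ 2 / u) = (φ (u / s) / (u / s)) ^ 2 * u := by field_simp
    rw [e]
    nlinarith [mul_nonneg (sq_nonneg (1 + φ (u / s) / (u / s))) hu.le]
  have h4 : φ (u / s) ^ 2 * (s ^ 2 / u) ≤ C ^ 2 * (s ^ 2 / u) := by gcongr
  have h5 : 0 < s ^ 2 / u := by positivity
  calc _ ≤ 2 * (1 + C ^ 2) * (u + s ^ 2 / u) := by nlinarith [mul_nonneg (sq_nonneg C) hu.le]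
    _ ≤ _ := by gcongr

lemma IsShrinkageFn.abs_div_le_weight (h : IsShrinkageFn φ C K) {u s : ℝ} (hu : 0 < u)
    (hs : 0 < s) : |φ (u / s) / (u / s)| ≤ C * ((1 + 1 / u) * (1 + u) * (1 + s ^ 2)) := by
  have hC := h.nonneg
  have h1 := h.bound _ (div_pos hu hs)
  have h2 := add_div_le_weight (s := s) hu
  rw [abs_div, abs_of_pos (div_pos hu hs)]
  calc _ = |φ (u / s)| * (s / u) := by field_simp
    _ ≤ C * (s / u) := by gcongr
    _ ≤ _ := by
      gcongr
      refine le_trans ?_ (show (1 + 1 / u) * (1 + s ^ 2) ≤ _ by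
        have : 0 ≤ (1 + 1 / u) * (1 + s ^ 2) := by positivity
        nlinarith)
      have e : (1 + 1 / u) * (1 + s ^ 2) = s / u + (1 + s ^ 2 + (1 - s + s ^ 2) / u) := by
        field_simp
        ring
      have : 0 ≤ 1 - s + s ^ 2 := by nlinarith [sq_nonneg (s - 1)]
      have : 0 ≤ (1 - s + s ^ 2) / u := by positivity
      nlinarith

lemma measurable_shrink (hφ : Measurable φ) :
    Measurable fun z : EuclideanSpace ℝ (Fin p) × ℝ => shrink φ z.1 z.2 := by
  unfold shrink stat
  fun_prop

lemma IsShrinkageFn.integrable_sq_norm_sub (h : IsShrinkageFn φ C K) (hp : 3 ≤ p) (hn : 1 ≤ n)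
    (θ : EuclideanSpace ℝ (Fin p)) :
    Integrable (fun z => ‖shrink φ z.1 z.2 - θ‖ ^ 2) (model n θ 1) := by
  have hm := measurable_shrink (p := p) h.meas
  refine integrable_model_one_of_abs_le hp hn θ (by fun_prop)
    (B := 4 * (1 + C ^ 2) + 2 * ‖θ‖ ^ 2) fun x s hx hs => ?_
  have hu : 0 < ‖x‖ ^ 2 := by positivity
  have h1 := h.sq_factor_mul_le hu hs
  have h2 := one_le_weight (s := s) hu
  have h3 : ‖shrink φ x s‖ ^ 2 =
      (1 - φ (‖x‖ ^ 2 / s) / (‖x‖ ^ 2 / s)) ^ 2 * ‖x‖ ^ 2 := by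
    rw [shrink, norm_smul, mul_pow, Real.norm_eq_abs, sq_abs, stat]
  have h4 : ‖shrink φ x s - θ‖ ^ 2 ≤ 2 * ‖shrink φ x s‖ ^ 2 + 2 * ‖θ‖ ^ 2 := by
    have := norm_sub_le (shrink φ x s) θ
    nlinarith [norm_nonneg (shrink φ x s - θ), sq_nonneg (‖shrink φ x s‖ - ‖θ‖)]
  rw [abs_of_nonneg (sq_nonneg _)]
  nlinarith [mul_nonneg (sq_nonneg ‖θ‖) (sub_nonneg.2 h2)]

/-- The mean squared error of `⟨y, δ_φ⟩` as an estimator of `⟨y, θ⟩`, for unit variance. -/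
noncomputable def directionalMSE (n : ℕ) (φ : ℝ → ℝ) (θ y : EuclideanSpace ℝ (Fin p)) : ℝ :=
  ∫ z, (inner ℝ y (shrink φ z.1 z.2 - θ)) ^ 2 ∂(model n θ 1)

lemma IsShrinkageFn.integrable_inner_mul_inner (h : IsShrinkageFn φ C K) (hp : 3 ≤ p)
    (hn : 1 ≤ n) (θ a b : EuclideanSpace ℝ (Fin p)) :
    Integrable (fun z => inner ℝ a (shrink φ z.1 z.2 - θ) * inner ℝ b (shrink φ z.1 z.2 - θ))
      (model n θ 1) := by
  have hm := measurable_shrink (p := p) h.meas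
  refine Integrable.mono' ((h.integrable_sq_norm_sub hp hn θ).const_mul (‖a‖ * ‖b‖))
    (by fun_prop) (Filter.Eventually.of_forall fun z => ?_)
  rw [norm_mul]
  calc _ ≤ (‖a‖ * ‖shrink φ z.1 z.2 - θ‖) * (‖b‖ * ‖shrink φ z.1 z.2 - θ‖) :=
        mul_le_mul (norm_inner_le_norm _ _) (norm_inner_le_norm _ _) (norm_nonneg _)
          (by positivity)
    _ = _ := by ring

lemma IsShrinkageFn.integrable_inner_sq (h : IsShrinkageFn φ C K) (hp : 3 ≤ p)
    (hn : 1 ≤ n) (θ a : EuclideanSpace ℝ (Fin p)) :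
    Integrable (fun z => inner ℝ a (shrink φ z.1 z.2 - θ) ^ 2) (model n θ 1) := by
  simpa only [sq] using h.integrable_inner_mul_inner hp hn θ a a

lemma map_model_one_isometry (n : ℕ) {θ : EuclideanSpace ℝ (Fin p)}
    (R : EuclideanSpace ℝ (Fin p) ≃ₗᵢ[ℝ] EuclideanSpace ℝ (Fin p)) (hR : R θ = θ) :
    (model n θ 1).map (fun z => (R z.1, z.2)) = model n θ 1 := by
  have hmR : Measurable R := R.continuous.measurable
  have h2 := Measure.map_prod_map (stdGaussian (EuclideanSpace ℝ (Fin p))) (chiSq n)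
    (f := R) (g := id) hmR measurable_id
  rw [Measure.map_id, stdGaussian_map] at h2
  rw [model_eq_map n θ one_pos, Measure.map_map (by fun_prop) (by fun_prop)]
  conv_rhs => rw [h2]
  rw [Measure.map_map (by fun_prop) (by fun_prop)]
  congr 1
  ext z : 1
  simp [hR]

lemma shrink_isometry (φ : ℝ → ℝ)
    (R : EuclideanSpace ℝ (Fin p) ≃ₗᵢ[ℝ] EuclideanSpace ℝ (Fin p))
    (x : EuclideanSpace ℝ (Fin p)) (s : ℝ) : shrink φ (R x) s = R (shrink φ x s) := by
  simp [shrink, stat]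

lemma directionalMSE_isometry (n : ℕ) (φ : ℝ → ℝ) {θ : EuclideanSpace ℝ (Fin p)}
    (R : EuclideanSpace ℝ (Fin p) ≃ₗᵢ[ℝ] EuclideanSpace ℝ (Fin p)) (hR : R θ = θ)
    (y : EuclideanSpace ℝ (Fin p)) :
    directionalMSE n φ θ (R y) = directionalMSE n φ θ y := by
  have he : MeasurableEmbedding (fun z : EuclideanSpace ℝ (Fin p) × ℝ => (R z.1, z.2)) :=
    R.toHomeomorph.measurableEmbedding.prodMap MeasurableEmbedding.id
  rw [directionalMSE]
  conv_lhs => rw [← map_model_one_isometry n R hR, he.integral_map]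
  rw [directionalMSE]
  congr 1
  ext z
  rw [shrink_isometry]
  conv_lhs => rw [← hR, ← map_sub, R.inner_map_map]

/-- The reflection in the hyperplane orthogonal to y - y' exchanges y and y' and fixes θ, and the
estimator and the model with mean θ are equivariant under it. -/
lemma directionalMSE_eq_of_norm_eq (n : ℕ) (φ : ℝ → ℝ) {θ y y' : EuclideanSpace ℝ (Fin p)}
    (hy : ‖y‖ = ‖y'‖) (hθ : inner ℝ (y - y') θ = 0) :
    directionalMSE n φ θ y = directionalMSE n φ θ y' := by
  rw [← Submodule.reflection_sub hy]
  refine (directionalMSE_isometry n φ _ ?_ y).symm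
  refine Submodule.reflection_mem_subspace_eq_self ?_
  rwa [Submodule.mem_orthogonal_singleton_iff_inner_right]

lemma directionalMSE_smul (n : ℕ) (φ : ℝ → ℝ) (θ y : EuclideanSpace ℝ (Fin p)) (c : ℝ) :
    directionalMSE n φ θ (c • y) = c ^ 2 * directionalMSE n φ θ y := by
  rw [directionalMSE, directionalMSE, ← integral_const_mul]
  simp_rw [real_inner_smul_left, mul_pow]

lemma IsShrinkageFn.directionalMSE_parallelogram (h : IsShrinkageFn φ C K) (hp : 3 ≤ p)
    (hn : 1 ≤ n) (θ a b : EuclideanSpace ℝ (Fin p)) :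
    directionalMSE n φ θ (a + b) + directionalMSE n φ θ (a - b) =
      2 * directionalMSE n φ θ a + 2 * directionalMSE n φ θ b := by
  have hi := h.integrable_inner_sq hp hn θ
  simp only [directionalMSE]
  rw [← integral_add (hi _) (hi _), ← integral_const_mul, ← integral_const_mul,
    ← integral_add ((hi _).const_mul _) ((hi _).const_mul _)]
  congr 1
  ext z
  rw [inner_add_left, inner_sub_left]
  ring

/-- Reversing b leaves θ fixed, so a + b and a - b have the same error and the parallelogram law
shows that the cross term vanishes. This diagonalises M. -/
lemma IsShrinkageFn.directionalMSE_add (h : IsShrinkageFn φ C K) (hp : 3 ≤ p)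
    (hn : 1 ≤ n) {θ a b : EuclideanSpace ℝ (Fin p)} (hab : inner ℝ a b = 0)
    (hb : inner ℝ b θ = 0) :
    directionalMSE n φ θ (a + b) = directionalMSE n φ θ a + directionalMSE n φ θ b := by
  have h1 := h.directionalMSE_parallelogram hp hn θ a b
  have h2 : directionalMSE n φ θ (a + b) = directionalMSE n φ θ (a - b) := by
    refine directionalMSE_eq_of_norm_eq n φ ?_ ?_
    · exact (norm_sub_eq_norm_add (by rw [real_inner_comm, hab])).symm
    · rw [show a + b - (a - b) = (2 : ℝ) • b by rw [two_smul]; abel, real_inner_smul_left, hb,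
        mul_zero]
  linarith

lemma IsShrinkageFn.sum_directionalMSE (h : IsShrinkageFn φ C K) (hp : 3 ≤ p)
    (hn : 1 ≤ n) (θ : EuclideanSpace ℝ (Fin p))
    (b : OrthonormalBasis (Fin p) ℝ (EuclideanSpace ℝ (Fin p))) :
    ∑ i, directionalMSE n φ θ (b i) = ∫ z, ‖shrink φ z.1 z.2 - θ‖ ^ 2 ∂(model n θ 1) := by
  simp only [directionalMSE]
  rw [← integral_finsetSum _ fun i _ => h.integrable_inner_sq hp hn θ (b i)]
  simp_rw [b.sum_sq_inner_right]

lemma exists_orthonormalBasis_zero (hp : 0 < p) {e : EuclideanSpace ℝ (Fin p)} (he : ‖e‖ = 1) :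
    ∃ b : OrthonormalBasis (Fin p) ℝ (EuclideanSpace ℝ (Fin p)), b ⟨0, hp⟩ = e := by
  have ho : Orthonormal ℝ (({⟨0, hp⟩} : Set (Fin p)).domRestrict (fun _ => e)) := by
    refine ⟨fun _ => he, fun i j hij => ?_⟩
    exact absurd (Subsingleton.elim i j) hij
  obtain ⟨b, hb⟩ := ho.exists_orthonormalBasis_extension_of_card_eq (by simp)
  exact ⟨b, hb _ rfl⟩

/-- The mean squared error of the shrinkage estimator in the directions orthogonal to a unit
vector, in terms of those along and across the direction of the mean. -/
lemma IsShrinkageFn.directionalMSE_orthogonal (h : IsShrinkageFn φ C K) (hp : 3 ≤ p)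
    (hn : 1 ≤ n) {e : EuclideanSpace ℝ (Fin p)} (he : ‖e‖ = 1) (t : ℝ)
    {y : EuclideanSpace ℝ (Fin p)} (hy : ‖y‖ = 1) {lam : ℝ}
    (hlam : ∫ z, ‖shrink φ z.1 z.2 - t • e‖ ^ 2 ∂(model n (t • e) 1) =
      directionalMSE n φ (t • e) e + (p - 1) * lam) :
    ∫ z, ‖shrink φ z.1 z.2 - t • e‖ ^ 2 ∂(model n (t • e) 1) - directionalMSE n φ (t • e) y =
      (inner ℝ y e) ^ 2 * ((p - 1) * lam) +
        (1 - (inner ℝ y e) ^ 2) * (directionalMSE n φ (t • e) e + (p - 2) * lam) := by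
  have hp' : (3 : ℝ) ≤ p := by exact_mod_cast hp
  obtain ⟨b, hb⟩ := exists_orthonormalBasis_zero (by omega) he
  have hbn : ∀ i, ‖b i‖ = 1 := b.orthonormal.1
  have hbe : ∀ i, i ≠ ⟨0, by omega⟩ → inner ℝ (b i) e = 0 := fun i hi => by
    rw [← hb]; exact b.orthonormal.2 hi
  set i₁ : Fin p := ⟨1, by omega⟩ with hi₁
  have hi₁0 : i₁ ≠ ⟨0, by omega⟩ := by simp [hi₁]
  have hperp : ∀ f : EuclideanSpace ℝ (Fin p), inner ℝ f e = 0 →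
      directionalMSE n φ (t • e) f = ‖f‖ ^ 2 * directionalMSE n φ (t • e) (b i₁) := by
    intro f hf
    rw [← directionalMSE_smul]
    refine directionalMSE_eq_of_norm_eq n φ ?_ ?_
    · rw [norm_smul, hbn, mul_one, norm_norm]
    · rw [real_inner_smul_right, inner_sub_left, real_inner_smul_left, hf, hbe _ hi₁0]
      simp
  have hsum := h.sum_directionalMSE hp hn (t • e) b
  rw [← Finset.add_sum_erase _ _ (Finset.mem_univ (⟨0, by omega⟩ : Fin p)),
    Finset.sum_congr rfl (g := fun _ => directionalMSE n φ (t • e) (b i₁))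
      (fun i hi => by rw [hperp _ (hbe i (Finset.ne_of_mem_erase hi)), hbn]; ring), hb,
    Finset.sum_const, Finset.card_erase_of_mem (Finset.mem_univ _), Finset.card_univ,
    Fintype.card_fin, nsmul_eq_mul, Nat.cast_sub (by omega), Nat.cast_one, hlam] at hsum
  -- The total error splits over the basis as the part along e plus p - 1 equal parts across, which
  -- identifies lam as the transverse eigenvalue.
  have hl : directionalMSE n φ (t • e) (b i₁) = lam := by
    have : (p : ℝ) - 1 ≠ 0 := by linarith
    exact mul_left_cancel₀ this (by linarith)
  set α := inner ℝ y e with hα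
  have hf : inner ℝ (y - α • e) e = 0 := by
    rw [inner_sub_left, real_inner_smul_left, real_inner_self_eq_norm_sq, he]
    simp [hα]
  have hfn : ‖y - α • e‖ ^ 2 = 1 - α ^ 2 := by
    rw [norm_sub_sq_real, real_inner_smul_right, norm_smul, hy, he, mul_one, Real.norm_eq_abs,
      sq_abs, ← hα]
    ring
  have hQ : directionalMSE n φ (t • e) y =
      α ^ 2 * directionalMSE n φ (t • e) e + (1 - α ^ 2) * lam := by
    have h1 := h.directionalMSE_add (n := n) hp hn (θ := t • e) (a := α • e) (b := y - α • e)
      (by rw [real_inner_smul_left, real_inner_comm, hf, mul_zero])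
      (by rw [real_inner_smul_right, hf, mul_zero])
    rw [add_sub_cancel, directionalMSE_smul, hperp _ hf, hfn, hl] at h1
    exact h1
  rw [hlam, hQ]
  ring

end DirectionalMSE

end ShrinkageMSE

namespace ShrinkageMSE

/-! ### The bound on the error in a hyperplane -/

section MSEBound

variable {p n : ℕ} {φ : ℝ → ℝ} {C : ℝ} {K : ℝ≥0}

lemma integral_inner_model_one (hn : 1 ≤ n) {e : EuclideanSpace ℝ (Fin p)} (he : ‖e‖ = 1)
    (t : ℝ) : ∫ z, inner ℝ z.1 e ∂(model n (t • e) 1) = t := by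
  have := isProbabilityMeasure_chiSq (k := n) hn
  have h0 : ∫ x, inner ℝ x e ∂(stdGaussian (EuclideanSpace ℝ (Fin p))) = 0 := by
    have := integral_strongDual_stdGaussian (innerSL ℝ e)
    simpa [real_inner_comm] using this
  have hi : Integrable (fun x => inner ℝ x e) (stdGaussian (EuclideanSpace ℝ (Fin p))) :=
    (IsGaussian.integrable_id (μ := stdGaussian (EuclideanSpace ℝ (Fin p)))).inner_const e
  rw [model_eq_map n _ one_pos, integral_map (by fun_prop) (by fun_prop)]
  have h1 : ∀ z : EuclideanSpace ℝ (Fin p) × ℝ,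
      inner ℝ (t • e + √1 • z.1) e = t + inner ℝ z.1 e := fun z => by
    rw [inner_add_left, real_inner_smul_left, real_inner_self_eq_norm_sq, he]
    simp
  simp only [h1]
  have hi' : Integrable (fun z : EuclideanSpace ℝ (Fin p) × ℝ => (inner ℝ z.1 e : ℝ))
      ((stdGaussian (EuclideanSpace ℝ (Fin p))).prod (chiSq n)) := hi.comp_fst _
  rw [integral_add (integrable_const t) hi']
  have h2 := integral_fun_fst (μ := stdGaussian (EuclideanSpace ℝ (Fin p))) (ν := chiSq n)
    (fun x => (inner ℝ x e : ℝ))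
  rw [h2, h0]
  simp

lemma integrable_inner_model_one (hp : 3 ≤ p) (hn : 1 ≤ n) {e : EuclideanSpace ℝ (Fin p)}
    (he : ‖e‖ = 1) (θ : EuclideanSpace ℝ (Fin p)) :
    Integrable (fun z => (inner ℝ z.1 e : ℝ)) (model n θ 1) := by
  refine integrable_model_one_of_abs_le hp hn θ (by fun_prop) (B := 1) fun x s hx hs => ?_
  have hu : 0 < ‖x‖ ^ 2 := by positivity
  have h1 := abs_inner_le_norm_of_unit he x
  have h2 : (1 + ‖x‖ ^ 2) ≤ (1 + 1 / ‖x‖ ^ 2) * (1 + ‖x‖ ^ 2) * (1 + s ^ 2) := by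
    have : 1 ≤ (1 + 1 / ‖x‖ ^ 2) * (1 + s ^ 2) :=
      one_le_mul_of_one_le_of_one_le (by have : 0 < 1 / ‖x‖ ^ 2 := by positivity
                                         linarith) (by nlinarith)
    nlinarith
  nlinarith [sq_nonneg (‖x‖ - 1)]

lemma hasSum_mixWeight (hp : 3 ≤ p) (hn : 1 ≤ n) (t : ℝ) : HasSum (mixWeight t) 1 := by
  obtain ⟨e, he⟩ : ∃ e : EuclideanSpace ℝ (Fin p), ‖e‖ = 1 :=
    ⟨EuclideanSpace.single ⟨0, by omega⟩ 1, by simp⟩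
  have h := hasSum_model_zero hp hn he t (k := fun _ => 1) measurable_const (B := 1)
    fun u s hu _ => by simpa using one_le_weight (s := s) hu
  have := isProbabilityMeasure_chiSq (k := n) hn
  have := isProbabilityMeasure_model hn (t • e) one_pos
  have e1 : ∫ _, (1 : ℝ) ∂(model n (t • e) 1) = 1 := by simp
  simp only [e1] at h
  refine h.congr_terms fun j => ?_
  have := isProbabilityMeasure_chiSq (k := p + 2 * j) (by omega)
  simp

/-- Comes from t·E⟨X, e⟩ = t². It writes the term t² of the error as a mixture that can be compared
with the others term by term. -/
lemma hasSum_mixWeight_mul (hp : 3 ≤ p) (hn : 1 ≤ n) (t : ℝ) :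
    HasSum (fun j : ℕ => mixWeight t j * (2 * j)) (t ^ 2) := by
  obtain ⟨e, he⟩ : ∃ e : EuclideanSpace ℝ (Fin p), ‖e‖ = 1 :=
    ⟨EuclideanSpace.single ⟨0, by omega⟩ 1, by simp⟩
  have h := hasSum_model_one hp hn he t (k := fun _ => 1) measurable_const (B := 1)
    fun u s hu _ => by simpa using one_le_weight (s := s) hu
  have := isProbabilityMeasure_chiSq (k := n) hn
  simp only [mul_one, integral_const_mul, integral_inner_model_one hn he] at h
  refine (show t * t = t ^ 2 by ring) ▸ HasSum.congr_terms h fun j => ?_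
  have := isProbabilityMeasure_chiSq (k := p + 2 * j) (by omega)
  simp

lemma IsShrinkageFn.hasSum_sq_norm (h : IsShrinkageFn φ C K) (hp : 3 ≤ p) (hn : 1 ≤ n)
    {e : EuclideanSpace ℝ (Fin p)} (he : ‖e‖ = 1) (t : ℝ) :
    HasSum (fun j : ℕ => mixWeight t j * (((p : ℝ) + 2 * j) * (1 - betaTwo p n φ j)))
      (∫ z, (1 - φ (‖z.1‖ ^ 2 / z.2) / (‖z.1‖ ^ 2 / z.2)) ^ 2 * ‖z.1‖ ^ 2
        ∂(model n (t • e) 1)) := by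
  have hm := h.meas
  have := hasSum_model_zero hp hn he t
    (k := fun z => (1 - φ (z.1 / z.2) / (z.1 / z.2)) ^ 2 * z.1) (by fun_prop)
    (B := 2 * (1 + C ^ 2)) fun u s hu hs => by
      rw [abs_of_nonneg (by positivity)]
      exact h.sq_factor_mul_le hu hs
  exact this.congr_terms fun j => by rw [h.integral_sq_mul hp hn]

lemma IsShrinkageFn.hasSum_sq_inner (h : IsShrinkageFn φ C K) (hp : 3 ≤ p) (hn : 1 ≤ n)
    {e : EuclideanSpace ℝ (Fin p)} (he : ‖e‖ = 1) (t : ℝ) :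
    HasSum (fun j : ℕ => mixWeight t j * ((2 * j + 1) * (1 - betaTwo p n φ j)))
      (∫ z, (inner ℝ z.1 e) ^ 2 * (1 - φ (‖z.1‖ ^ 2 / z.2) / (‖z.1‖ ^ 2 / z.2)) ^ 2
        ∂(model n (t • e) 1)) := by
  have hm := h.meas
  have := hasSum_model_two hp hn he t
    (k := fun z => (1 - φ (z.1 / z.2) / (z.1 / z.2)) ^ 2) (by fun_prop)
    (B := 2 * (1 + C ^ 2)) fun u s hu hs => by
      rw [abs_of_nonneg (by positivity)]
      exact h.sq_factor_mul_le hu hs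
  refine this.congr_terms fun j => ?_
  have hk : (0 : ℝ) < (p : ℝ) + 2 * j := by
    have : (3 : ℝ) ≤ p := by exact_mod_cast hp
    positivity
  rw [h.integral_sq_mul hp hn]
  field_simp

lemma IsShrinkageFn.hasSum_mean (h : IsShrinkageFn φ C K) (hp : 3 ≤ p) (hn : 1 ≤ n)
    {e : EuclideanSpace ℝ (Fin p)} (he : ‖e‖ = 1) (t : ℝ) :
    HasSum (fun j : ℕ => mixWeight t j * (2 * j) * meanFactor (p + 2 * j) n φ)
      (∫ z, (t * inner ℝ z.1 e) * (φ (‖z.1‖ ^ 2 / z.2) / (‖z.1‖ ^ 2 / z.2))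
        ∂(model n (t • e) 1)) := by
  have hm := h.meas
  exact hasSum_model_one hp hn he t
    (k := fun z => φ (z.1 / z.2) / (z.1 / z.2)) (by fun_prop)
    (B := C) fun u s hu hs => h.abs_div_le_weight hu hs

lemma IsShrinkageFn.integrable_sq_norm (h : IsShrinkageFn φ C K) (hp : 3 ≤ p) (hn : 1 ≤ n)
    (θ : EuclideanSpace ℝ (Fin p)) :
    Integrable (fun z => (1 - φ (‖z.1‖ ^ 2 / z.2) / (‖z.1‖ ^ 2 / z.2)) ^ 2 * ‖z.1‖ ^ 2)
      (model n θ 1) := by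
  have hm := h.meas
  refine integrable_model_one_of_abs_le hp hn θ (by fun_prop)
    (B := 2 * (1 + C ^ 2)) fun x s hx hs => ?_
  rw [abs_of_nonneg (by positivity)]
  exact h.sq_factor_mul_le (by positivity) hs

lemma IsShrinkageFn.integrable_sq_inner (h : IsShrinkageFn φ C K) (hp : 3 ≤ p) (hn : 1 ≤ n)
    {e : EuclideanSpace ℝ (Fin p)} (he : ‖e‖ = 1) (θ : EuclideanSpace ℝ (Fin p)) :
    Integrable (fun z => (inner ℝ z.1 e) ^ 2 *
      (1 - φ (‖z.1‖ ^ 2 / z.2) / (‖z.1‖ ^ 2 / z.2)) ^ 2) (model n θ 1) := by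
  have hm := h.meas
  refine Integrable.mono' (h.integrable_sq_norm hp hn θ) (by fun_prop)
    (Filter.Eventually.of_forall fun z => ?_)
  have : (inner ℝ z.1 e) ^ 2 ≤ ‖z.1‖ ^ 2 := by
    rw [← sq_abs]
    gcongr
    exact abs_inner_le_norm_of_unit he z.1
  rw [Real.norm_of_nonneg (by positivity), mul_comm]
  gcongr

/-- The mean has no component across e, so the transverse error is E‖δ‖² - E⟨δ, e⟩². -/
lemma IsShrinkageFn.integral_sq_norm_sub (h : IsShrinkageFn φ C K) (hp : 3 ≤ p) (hn : 1 ≤ n)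
    {e : EuclideanSpace ℝ (Fin p)} (he : ‖e‖ = 1) (t : ℝ) :
    ∫ z, ‖shrink φ z.1 z.2 - t • e‖ ^ 2 ∂(model n (t • e) 1) =
      directionalMSE n φ (t • e) e +
      (∫ z, (1 - φ (‖z.1‖ ^ 2 / z.2) / (‖z.1‖ ^ 2 / z.2)) ^ 2 * ‖z.1‖ ^ 2 ∂(model n (t • e) 1) -
        ∫ z, (inner ℝ z.1 e) ^ 2 * (1 - φ (‖z.1‖ ^ 2 / z.2) / (‖z.1‖ ^ 2 / z.2)) ^ 2
          ∂(model n (t • e) 1)) := by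
  have hi : Integrable (fun z => (1 - φ (‖z.1‖ ^ 2 / z.2) / (‖z.1‖ ^ 2 / z.2)) ^ 2 * ‖z.1‖ ^ 2 -
      (inner ℝ z.1 e) ^ 2 * (1 - φ (‖z.1‖ ^ 2 / z.2) / (‖z.1‖ ^ 2 / z.2)) ^ 2)
      (model n (t • e) 1) :=
    (h.integrable_sq_norm hp hn _).sub (h.integrable_sq_inner hp hn he _)
  rw [directionalMSE, ← integral_sub (h.integrable_sq_norm hp hn _)
    (h.integrable_sq_inner hp hn he _), ← integral_add (h.integrable_inner_sq hp hn _ _) hi]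
  congr 1
  ext z
  rw [norm_sub_sq_real, inner_sub_right, shrink, real_inner_smul_left, real_inner_smul_right,
    real_inner_smul_right, real_inner_smul_right, real_inner_self_eq_norm_sq, he, norm_smul,
    norm_smul, he, mul_pow, mul_pow, Real.norm_eq_abs, Real.norm_eq_abs, sq_abs, sq_abs,
    real_inner_comm z.1 e, stat]
  ring

lemma IsShrinkageFn.integrable_inner_mul_div (h : IsShrinkageFn φ C K) (hp : 3 ≤ p) (hn : 1 ≤ n)
    {e : EuclideanSpace ℝ (Fin p)} (he : ‖e‖ = 1) (t : ℝ) (θ : EuclideanSpace ℝ (Fin p)) :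
    Integrable (fun z => (t * inner ℝ z.1 e) * (φ (‖z.1‖ ^ 2 / z.2) / (‖z.1‖ ^ 2 / z.2)))
      (model n θ 1) := by
  have hC := h.nonneg
  have hm := h.meas
  refine integrable_model_one_of_abs_le hp hn θ (by fun_prop) (B := |t| * C) fun x s hx hs => ?_
  have hu : 0 < ‖x‖ ^ 2 := by positivity
  have h1 := h.bound _ (div_pos hu hs)
  have h2 := abs_inner_le_norm_of_unit he x
  rw [abs_mul, abs_mul, abs_div, abs_of_pos (div_pos hu hs)]
  calc |t| * |inner ℝ x e| * (|φ (‖x‖ ^ 2 / s)| / (‖x‖ ^ 2 / s)) ≤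
        |t| * ‖x‖ * (C / (‖x‖ ^ 2 / s)) := by gcongr
    _ = |t| * C * (s / ‖x‖) := by
      have : ‖x‖ ≠ 0 := by simpa using hx
      field_simp
    _ ≤ _ := by
      gcongr
      have h3 := add_div_le_weight (s := s) hu
      have h4 := one_le_weight (s := s) hu
      have h5 : s / ‖x‖ ≤ (1 + s ^ 2 / ‖x‖ ^ 2) / 2 := by
        rw [← div_pow]
        nlinarith [sq_nonneg (s / ‖x‖ - 1)]
      linarith

lemma IsShrinkageFn.directionalMSE_eq (h : IsShrinkageFn φ C K) (hp : 3 ≤ p) (hn : 1 ≤ n)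
    {e : EuclideanSpace ℝ (Fin p)} (he : ‖e‖ = 1) (t : ℝ) :
    directionalMSE n φ (t • e) e =
      ∫ z, (inner ℝ z.1 e) ^ 2 * (1 - φ (‖z.1‖ ^ 2 / z.2) / (‖z.1‖ ^ 2 / z.2)) ^ 2
        ∂(model n (t • e) 1) - t ^ 2 +
      2 * ∫ z, (t * inner ℝ z.1 e) * (φ (‖z.1‖ ^ 2 / z.2) / (‖z.1‖ ^ 2 / z.2))
        ∂(model n (t • e) 1) := by
  have := isProbabilityMeasure_model hn (t • e) one_pos
  have i1 := h.integrable_sq_inner hp hn he (t • e)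
  have i2 := (h.integrable_inner_mul_div hp hn he t (t • e)).const_mul 2
  have i3 : Integrable (fun z => t ^ 2 - 2 * t * inner ℝ z.1 e) (model n (t • e) 1) :=
    (integrable_const (t ^ 2)).sub ((integrable_inner_model_one hp hn he (t • e)).const_mul (2 * t))
  -- The part of the square (⟨δ, e⟩ - t)² that does not involve φ and is at most linear in x; its
  -- value uses E⟨X, e⟩ = t.
  have e3 : ∫ z, (t ^ 2 - 2 * t * inner ℝ z.1 e) ∂(model n (t • e) 1) = - t ^ 2 := by
    rw [integral_sub (integrable_const _)
      ((integrable_inner_model_one hp hn he (t • e)).const_mul (2 * t)), integral_const_mul,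
      integral_inner_model_one hn he]
    simp
    ring
  have i13 : Integrable (fun z => (inner ℝ z.1 e) ^ 2 *
      (1 - φ (‖z.1‖ ^ 2 / z.2) / (‖z.1‖ ^ 2 / z.2)) ^ 2 + (t ^ 2 - 2 * t * inner ℝ z.1 e))
      (model n (t • e) 1) := i1.add i3
  rw [sub_eq_add_neg, ← e3, ← integral_const_mul, ← integral_add i1 i3,
    ← integral_add i13 i2, directionalMSE]
  congr 1
  ext z
  rw [inner_sub_right, shrink, real_inner_smul_right, real_inner_smul_right,
    real_inner_self_eq_norm_sq, he, real_inner_comm z.1 e, stat]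
  ring

/-- The total mean squared error in the directions orthogonal to a unit vector. -/
theorem IsShrinkageFn.integral_sub_directionalMSE_le (h : IsShrinkageFn φ C K) (hp : 3 ≤ p)
    (hn : 1 ≤ n) (hβ : ∀ j, 0 ≤ betaOne p n φ j) (hβ' : ∀ j, 0 ≤ betaTwo p n φ j)
    (θ : EuclideanSpace ℝ (Fin p)) {y : EuclideanSpace ℝ (Fin p)} (hy : ‖y‖ = 1) :
    ∫ z, ‖shrink φ z.1 z.2 - θ‖ ^ 2 ∂(model n θ 1) - directionalMSE n φ θ y ≤ p - 1 := by
  have hp' : (3 : ℝ) ≤ p := by exact_mod_cast hp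
  obtain ⟨e, t, he, rfl⟩ : ∃ (e : EuclideanSpace ℝ (Fin p)) (t : ℝ), ‖e‖ = 1 ∧ θ = t • e := by
    by_cases hθ : θ = 0
    -- At θ = 0 there is no preferred axis and any unit vector serves.
    · exact ⟨y, 0, hy, by simp [hθ]⟩
    · have : ‖θ‖ ≠ 0 := by simpa using hθ
      exact ⟨‖θ‖⁻¹ • θ, ‖θ‖, by simp [norm_smul, this], by simp [smul_smul, this]⟩
  have hw := mixWeight_nonneg t
  have s0 := hasSum_mixWeight hp hn t
  have s1 := h.hasSum_sq_norm hp hn he t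
  have s2 := h.hasSum_sq_inner hp hn he t
  have s3 := h.hasSum_mean hp hn he t
  have s4 := hasSum_mixWeight_mul hp hn t
  have hT := h.integral_sq_norm_sub hp hn he t
  have hQ := h.directionalMSE_eq hp hn he t
  set T := ∫ z, ‖shrink φ z.1 z.2 - t • e‖ ^ 2 ∂(model n (t • e) 1) with hTdef
  set T1 := ∫ z, (1 - φ (‖z.1‖ ^ 2 / z.2) / (‖z.1‖ ^ 2 / z.2)) ^ 2 * ‖z.1‖ ^ 2
    ∂(model n (t • e) 1)
  set T2 := ∫ z, (inner ℝ z.1 e) ^ 2 * (1 - φ (‖z.1‖ ^ 2 / z.2) / (‖z.1‖ ^ 2 / z.2)) ^ 2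
    ∂(model n (t • e) 1)
  set T3 := ∫ z, (t * inner ℝ z.1 e) * (φ (‖z.1‖ ^ 2 / z.2) / (‖z.1‖ ^ 2 / z.2))
    ∂(model n (t • e) 1)
  have hp1 : (0 : ℝ) < p - 1 := by linarith
  have hlam : T = directionalMSE n φ (t • e) e + (p - 1) * ((T1 - T2) / (p - 1)) := by
    rw [hT]
    field_simp
  have hmain := h.directionalMSE_orthogonal hp hn he t hy hlam
  rw [← hTdef] at hmain
  rw [hmain]
  have hα : (inner ℝ y e) ^ 2 ≤ 1 := by
    have := abs_inner_le_norm_of_unit he y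
    rw [hy] at this
    rwa [sq_le_one_iff_abs_le_one]
  -- The j-th term has coefficient (p + 2j) - (2j + 1) = p - 1 in front of 1 - β⁽²⁾(j).
  have b1 : T1 - T2 ≤ p - 1 := by
    have hl := s1.sub s2
    have hr := s0.mul_left ((p : ℝ) - 1)
    rw [mul_one] at hr
    refine hasSum_le (fun j => ?_) hl hr
    have := mul_nonneg (mul_nonneg (hw j) hp1.le) (hβ' j)
    nlinarith
  -- Multiplied by p - 1 to clear the denominator of λ₁. The j-th term collapses to (p - 1)(p - 1 -
  -- β⁽¹⁾(j)), which is what β⁽¹⁾ is designed for.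
  have b2 : (p - 1) * directionalMSE n φ (t • e) e + (p - 2) * (T1 - T2) ≤
      ((p : ℝ) - 1) ^ 2 := by
    have hl := (((s2.sub s4).add (s3.mul_left 2)).mul_left ((p : ℝ) - 1)).add
      ((s1.sub s2).mul_left ((p : ℝ) - 2))
    have hr := s0.mul_left (((p : ℝ) - 1) ^ 2)
    rw [mul_one] at hr
    rw [hQ]
    refine hasSum_le (fun j => ?_) hl hr
    have hb := mul_nonneg (mul_nonneg (hw j) hp1.le) (hβ j)
    rw [h.betaOne_eq hp hn] at hb
    linarith
  have b3 : directionalMSE n φ (t • e) e + (p - 2) * ((T1 - T2) / (p - 1)) ≤ p - 1 := by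
    have : directionalMSE n φ (t • e) e + (p - 2) * ((T1 - T2) / (p - 1)) =
        ((p - 1) * directionalMSE n φ (t • e) e + (p - 2) * (T1 - T2)) / (p - 1) := by
      field_simp
    rw [this, div_le_iff₀ hp1]
    linarith
  have b4 : ((p : ℝ) - 1) * ((T1 - T2) / (p - 1)) ≤ p - 1 := by
    rw [mul_div_cancel₀ _ hp1.ne']
    exact b1
  -- The quantity is a convex combination, with weights ⟨y, e⟩² and 1 - ⟨y, e⟩², of the two numbers
  -- just bounded.
  nlinarith [sq_nonneg (inner ℝ y e : ℝ), mul_nonneg (sq_nonneg (inner ℝ y e : ℝ))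
    (sub_nonneg.2 b4), mul_nonneg (sub_nonneg.2 hα) (sub_nonneg.2 b3)]

end MSEBound

end ShrinkageMSE

namespace ShrinkageMSE

/-! ### The dilation identity and its sign under the noncentral model -/

section Truncation

variable {p n : ℕ} {D : ℝ → ℝ} {B : ℝ}

lemma integrable_mul_comp_ratio {k : ℕ} (hk : 0 < k) (hn : 1 ≤ n) (hD : Measurable D)
    (hB : ∀ w, 0 < w → |D w| ≤ B) :
    Integrable (fun z => z.2 * D (z.1 / z.2)) ((chiSq k).prod (chiSq n)) := by
  have := isProbabilityMeasure_chiSq hk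
  have hi : Integrable (fun z : ℝ × ℝ => z.2) ((chiSq k).prod (chiSq n)) :=
    (integrable_id_chiSq (k := n) hn).comp_snd _
  refine Integrable.mono' (hi.mul_const B) (by fun_prop) ?_
  filter_upwards [ae_pos_prod_chiSq k n] with z hz
  rw [norm_mul, Real.norm_of_nonneg hz.2.le, Real.norm_eq_abs]
  exact mul_le_mul_of_nonneg_left (hB _ (div_pos hz.1 hz.2)) hz.2.le

lemma integral_mul_comp_ratio_nonneg {k : ℕ} (h0 : ∀ w, 0 < w → 0 ≤ D w) :
    0 ≤ ∫ z, z.2 * D (z.1 / z.2) ∂((chiSq k).prod (chiSq n)) := by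
  refine integral_nonneg_of_ae ?_
  filter_upwards [ae_pos_prod_chiSq k n] with z hz
  exact mul_nonneg hz.2.le (h0 _ (div_pos hz.1 hz.2))

lemma integral_mul_comp_ratio_pos {k : ℕ} (hk : 0 < k) (hn : 1 ≤ n) (hD : Measurable D)
    (hB : ∀ w, 0 < w → |D w| ≤ B) (h0 : ∀ w, 0 < w → 0 ≤ D w) {a b : ℝ} (ha : 0 < a)
    (hab : a < b) (hpos : ∀ w ∈ Ioo a b, 0 < D w) :
    0 < ∫ z, z.2 * D (z.1 / z.2) ∂((chiSq k).prod (chiSq n)) := by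
  have h1 := integral_ratio hk hn 1 hD
  have h2 := (integrable_ratio_iff hk hn 1 hD).1
    (by simpa using integrable_mul_comp_ratio hk hn hD hB)
  simp only [pow_one] at h1
  rw [h1]
  refine mul_pos (ratioConst_pos hk hn 1) ?_
  rw [setIntegral_pos_iff_support_of_nonneg_ae ?_ h2]
  · refine lt_of_lt_of_le ?_ (measure_mono (s := Ioo a b) fun w hw => ?_)
    · rw [Real.volume_Ioo]
      simpa using hab
    · have hw0 : 0 < w := ha.trans hw.1
      exact ⟨(mul_pos (ratioDensity_pos k n 1 hw0) (hpos w hw)).ne', hw0⟩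
  · filter_upwards [ae_restrict_mem measurableSet_Ioi] with w hw
    exact mul_nonneg (ratioDensity_nonneg k n 1 hw) (h0 w hw)

/-- Since u + v = v(1 + w), the extra factor raises the weight v to v². The factor 1 + w cancels in
the ratio density, and the constants have quotient k + n + 2. -/
lemma integral_dilation {k : ℕ} (hk : 0 < k) (hn : 1 ≤ n) (hD : Measurable D)
    {c : ℝ} (hB : ∀ w, 0 < w → |D w| ≤ B) :
    ∫ z, z.2 * D (z.1 / z.2) * (z.1 + z.2 - c) ∂((chiSq k).prod (chiSq n)) =
      (k + n + 2 - c) * ∫ z, z.2 * D (z.1 / z.2) ∂((chiSq k).prod (chiSq n)) := by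
  have hm : Measurable fun w => (1 + w) * D w := by fun_prop
  have hden : ∀ w ∈ Ioi (0 : ℝ), ratioDensity k n (1 + 1) w * ((1 + w) * D w) =
      ratioDensity k n 1 w * D w := by
    intro w hw
    have hw' : (0 : ℝ) < w := hw
    rw [ratioDensity_succ k n 1 hw]
    field_simp
  have i1 := integrable_mul_comp_ratio hk hn hD hB
  have i2 : Integrable (fun z => z.2 ^ (1 + 1) * ((1 + z.1 / z.2) * D (z.1 / z.2)))
      ((chiSq k).prod (chiSq n)) := by
    rw [integrable_ratio_iff hk hn _ hm, integrableOn_congr_fun hden measurableSet_Ioi,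
      ← integrable_ratio_iff hk hn _ hD]
    simpa using i1
  have e2 : ∫ z, z.2 ^ (1 + 1) * ((1 + z.1 / z.2) * D (z.1 / z.2)) ∂((chiSq k).prod (chiSq n)) =
      (k + n + 2) * ∫ z, z.2 * D (z.1 / z.2) ∂((chiSq k).prod (chiSq n)) := by
    have e1 := integral_ratio hk hn 1 hD
    simp only [pow_one] at e1
    rw [integral_ratio hk hn (1 + 1) hm, setIntegral_congr_fun measurableSet_Ioi hden, e1,
      ratioConst_succ hk 1]
    push_cast
    ring
  rw [sub_mul, ← e2, ← integral_const_mul, ← integral_sub i2 (i1.const_mul c)]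
  refine integral_congr_ae ?_
  filter_upwards [ae_pos_prod_chiSq k n] with z hz
  have := hz.2.ne'
  field_simp
  ring

lemma mul_add_le_weight {c : ℝ} (hc : 0 ≤ c) {u s : ℝ} (hu : 0 < u) :
    s * (u + s + c) ≤ (1 + c) * ((1 + 1 / u) * (1 + u) * (1 + s ^ 2)) := by
  have a1 : s ≤ 1 + s ^ 2 := by nlinarith [sq_nonneg (s - 1)]
  have a2 : u * s ≤ u * (1 + s ^ 2) := by gcongr
  have a3 : c * s ≤ c * (1 + s ^ 2) := by gcongr
  have a4 : 0 ≤ c * (u * (1 + s ^ 2)) := by positivity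
  have a5 : 0 ≤ (1 + c) * ((1 + u) * (1 + s ^ 2)) * (1 / u) := by positivity
  nlinarith

lemma abs_dilation_le (hB : ∀ w, 0 < w → |D w| ≤ B) {c : ℝ} (hc : 0 ≤ c) {u s : ℝ} (hu : 0 < u)
    (hs : 0 < s) : |s * D (u / s) * (u + s - c)| ≤
      (B * (1 + c)) * ((1 + 1 / u) * (1 + u) * (1 + s ^ 2)) := by
  have h1 := hB _ (div_pos hu hs)
  have hB0 : 0 ≤ B := (abs_nonneg _).trans h1
  have h2 : |u + s - c| ≤ u + s + c := abs_le.2 ⟨by linarith, by linarith⟩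
  rw [abs_mul, abs_mul, abs_of_pos hs]
  calc s * |D (u / s)| * |u + s - c| ≤ s * B * (u + s + c) := by gcongr
    _ = B * (s * (u + s + c)) := by ring
    _ ≤ B * ((1 + c) * ((1 + 1 / u) * (1 + u) * (1 + s ^ 2))) :=
      mul_le_mul_of_nonneg_left (mul_add_le_weight hc hu) hB0
    _ = _ := by ring

lemma exists_unit_smul (hp : 0 < p) (θ : EuclideanSpace ℝ (Fin p)) :
    ∃ (e : EuclideanSpace ℝ (Fin p)) (t : ℝ), ‖e‖ = 1 ∧ θ = t • e := by
  by_cases hθ : θ = 0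
  · exact ⟨EuclideanSpace.single ⟨0, hp⟩ 1, 0, by simp, by simp [hθ]⟩
  · have : ‖θ‖ ≠ 0 := by simpa using hθ
    exact ⟨‖θ‖⁻¹ • θ, ‖θ‖, by simp [norm_smul, this], by simp [smul_smul, this]⟩

/-- With k = p + 2j and c = n + p + 1 the dilation factor is 2j + 1. This is what the denominator n
+ p + 1 of the truncation level achieves: every factor, also that of j = 0, is positive. -/
lemma hasSum_dilation (hp : 3 ≤ p) (hn : 1 ≤ n) (hD : Measurable D)
    (hB : ∀ w, 0 < w → |D w| ≤ B) {e : EuclideanSpace ℝ (Fin p)} (he : ‖e‖ = 1) (t : ℝ) :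
    HasSum (fun j : ℕ => mixWeight t j * ((2 * j + 1) *
        ∫ z, z.2 * D (z.1 / z.2) ∂((chiSq (p + 2 * j)).prod (chiSq n))))
      (∫ z, z.2 * D (stat z.1 z.2) * (‖z.1‖ ^ 2 + z.2 - (n + p + 1)) ∂(model n (t • e) 1)) := by
  have := hasSum_model_zero hp hn he t
    (k := fun z => z.2 * D (z.1 / z.2) * (z.1 + z.2 - (n + p + 1))) (by fun_prop)
    (B := B * (1 + (n + p + 1))) fun u s hu hs => abs_dilation_le hB (by positivity) hu hs
  refine this.congr_terms fun j => ?_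
  rw [integral_dilation (by omega) hn hD hB]
  push_cast
  ring

lemma integral_dilation_model_nonneg (hp : 3 ≤ p) (hn : 1 ≤ n) (hD : Measurable D)
    (hB : ∀ w, 0 < w → |D w| ≤ B) (h0 : ∀ w, 0 < w → 0 ≤ D w)
    (θ : EuclideanSpace ℝ (Fin p)) :
    0 ≤ ∫ z, z.2 * D (stat z.1 z.2) * (‖z.1‖ ^ 2 + z.2 - (n + p + 1)) ∂(model n θ 1) := by
  obtain ⟨e, t, he, rfl⟩ := exists_unit_smul (by omega) θ
  refine (hasSum_dilation hp hn hD hB he t).nonneg fun j => ?_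
  have := integral_mul_comp_ratio_nonneg (k := p + 2 * j) (n := n) h0
  exact mul_nonneg (mixWeight_nonneg t j) (by positivity)

lemma integral_dilation_model_pos (hp : 3 ≤ p) (hn : 1 ≤ n) (hD : Measurable D)
    (hB : ∀ w, 0 < w → |D w| ≤ B) (h0 : ∀ w, 0 < w → 0 ≤ D w) {a b : ℝ} (ha : 0 < a)
    (hab : a < b) (hpos : ∀ w ∈ Ioo a b, 0 < D w)
    (θ : EuclideanSpace ℝ (Fin p)) :
    0 < ∫ z, z.2 * D (stat z.1 z.2) * (‖z.1‖ ^ 2 + z.2 - (n + p + 1)) ∂(model n θ 1) := by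
  obtain ⟨e, t, he, rfl⟩ := exists_unit_smul (by omega) θ
  -- The term j = 0 is enough: its Poisson weight is positive for every t.
  refine lt_of_lt_of_le ?_ (le_hasSum (hasSum_dilation hp hn hD hB he t) 0 fun j _ => ?_)
  · have := integral_mul_comp_ratio_pos (k := p + 2 * 0) (by omega) hn hD hB h0 ha hab hpos
    exact mul_pos (mixWeight_zero_pos t) (by positivity)
  · have := integral_mul_comp_ratio_nonneg (k := p + 2 * j) (n := n) h0
    exact mul_nonneg (mixWeight_nonneg t j) (by positivity)

lemma stat_scale {σ2 : ℝ} (hσ : 0 < σ2) (x : EuclideanSpace ℝ (Fin p)) (s : ℝ) :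
    stat (√σ2 • x) (σ2 * s) = stat x s := by
  rw [stat, stat, norm_smul, mul_pow, Real.norm_eq_abs, sq_abs, Real.sq_sqrt hσ.le,
    mul_div_mul_left _ _ hσ.ne']

lemma integral_dilation_scale {σ2 : ℝ} (hσ : 0 < σ2) (D : ℝ → ℝ)
    (θ : EuclideanSpace ℝ (Fin p)) (c : ℝ) :
    ∫ z, z.2 * D (stat z.1 z.2) * (‖z.1‖ ^ 2 + z.2 - c * σ2) ∂(model n θ σ2) =
      σ2 ^ 2 * ∫ z, z.2 * D (stat z.1 z.2) * (‖z.1‖ ^ 2 + z.2 - c)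
        ∂(model n ((√σ2)⁻¹ • θ) 1) := by
  rw [model_eq_map_model_one n θ hσ, (measurableEmbedding_scale hσ).integral_map,
    ← integral_const_mul]
  congr 1
  ext z
  rw [stat_scale hσ, norm_smul, mul_pow, Real.norm_eq_abs, sq_abs, Real.sq_sqrt hσ.le]
  ring

lemma integrable_scale_iff {σ2 : ℝ} (hσ : 0 < σ2) (θ : EuclideanSpace ℝ (Fin p))
    (F : EuclideanSpace ℝ (Fin p) × ℝ → ℝ) :
    Integrable F (model n θ σ2) ↔
      Integrable (fun z => F (√σ2 • z.1, σ2 * z.2)) (model n ((√σ2)⁻¹ • θ) 1) := by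
  rw [model_eq_map_model_one n θ hσ, (measurableEmbedding_scale hσ).integrable_map_iff]
  rfl

end Truncation

/-! ### From directional errors to traces of the MSE matrix -/

section MatrixBound

variable {p n : ℕ} {φ : ℝ → ℝ} {C : ℝ} {K : ℝ≥0}

lemma mseMatrix_shrink_scale (n : ℕ) (φ : ℝ → ℝ) (θ : EuclideanSpace ℝ (Fin p)) {σ2 : ℝ}
    (hσ : 0 < σ2) :
    mseMatrix n (shrink φ) θ σ2 = σ2 • mseMatrix n (shrink φ) ((√σ2)⁻¹ • θ) 1 := by
  have hs : √σ2 ≠ 0 := (Real.sqrt_pos.2 hσ).ne'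
  ext i j
  simp only [mseMatrix, Matrix.of_apply, Matrix.smul_apply, smul_eq_mul]
  rw [model_eq_map_model_one n θ hσ, (measurableEmbedding_scale hσ).integral_map,
    ← integral_const_mul]
  congr 1
  ext z
  have e : ∀ i, shrink φ (√σ2 • z.1) (σ2 * z.2) i - θ i =
      √σ2 * (shrink φ z.1 z.2 i - ((√σ2)⁻¹ • θ) i) := by
    intro i
    simp only [shrink, stat_scale hσ, PiLp.smul_apply, smul_eq_mul]
    field_simp
  rw [e, e]
  calc _ = √σ2 * √σ2 * ((shrink φ z.1 z.2 i - ((√σ2)⁻¹ • θ) i) *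
        (shrink φ z.1 z.2 j - ((√σ2)⁻¹ • θ) j)) := by ring
    _ = _ := by rw [Real.mul_self_sqrt hσ.le]

lemma IsShrinkageFn.integrable_mul_apply (h : IsShrinkageFn φ C K) (hp : 3 ≤ p) (hn : 1 ≤ n)
    (θ : EuclideanSpace ℝ (Fin p)) (i j : Fin p) :
    Integrable (fun z => (shrink φ z.1 z.2 i - θ i) * (shrink φ z.1 z.2 j - θ j))
      (model n θ 1) := by
  have := h.integrable_inner_mul_inner hp hn θ (EuclideanSpace.single i 1)
    (EuclideanSpace.single j 1)
  simpa [EuclideanSpace.inner_single_left] using this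

lemma IsShrinkageFn.trace_mseMatrix (h : IsShrinkageFn φ C K) (hp : 3 ≤ p) (hn : 1 ≤ n)
    (θ : EuclideanSpace ℝ (Fin p)) :
    (mseMatrix n (shrink φ) θ 1).trace = ∫ z, ‖shrink φ z.1 z.2 - θ‖ ^ 2 ∂(model n θ 1) := by
  simp only [Matrix.trace, Matrix.diag, mseMatrix, Matrix.of_apply]
  rw [← integral_finsetSum _ fun i _ => h.integrable_mul_apply hp hn θ i i]
  congr 1
  ext z
  rw [EuclideanSpace.real_norm_sq_eq]
  simp [sq]

lemma IsShrinkageFn.trace_dirProj_mul (h : IsShrinkageFn φ C K) (hp : 3 ≤ p) (hn : 1 ≤ n)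
    (θ x : EuclideanSpace ℝ (Fin p)) :
    (dirProj x * mseMatrix n (shrink φ) θ 1).trace = directionalMSE n φ θ (‖x‖⁻¹ • x) := by
  simp only [Matrix.trace, Matrix.diag, Matrix.mul_apply, mseMatrix, dirProj, Matrix.of_apply,
    directionalMSE]
  simp_rw [← integral_const_mul]
  have hi := fun i j : Fin p => h.integrable_mul_apply hp hn θ i j
  simp_rw [← integral_finsetSum Finset.univ fun j (_ : j ∈ Finset.univ) =>
    (hi j _).const_mul _]
  rw [← integral_finsetSum _ fun i _ => integrable_finsetSum _ fun j _ => (hi j i).const_mul _]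
  congr 1
  ext z
  rw [real_inner_smul_left, PiLp.inner_apply, mul_pow, sq (Finset.sum _ _), Finset.sum_mul_sum,
    Finset.mul_sum]
  refine Finset.sum_congr rfl fun i _ => ?_
  rw [Finset.mul_sum]
  refine Finset.sum_congr rfl fun j _ => ?_
  simp
  ring

/-- The trace is the total error minus the error in the direction x/‖x‖, with x a fixed vector
unrelated to the sample defining M. Scaling brings it to unit variance. -/
lemma IsShrinkageFn.trace_compl_dirProj_mul_le (h : IsShrinkageFn φ C K) (hp : 3 ≤ p)
    (hn : 1 ≤ n) (hβ : 0 ≤ betaOneInf p n φ) (hg : ∀ w, 0 < w → 0 < g₁ n φ w)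
    (θ : EuclideanSpace ℝ (Fin p)) {σ2 : ℝ} (hσ : 0 < σ2) {x : EuclideanSpace ℝ (Fin p)}
    (hx : x ≠ 0) :
    ((1 - dirProj x) * mseMatrix n (shrink φ) θ σ2).trace ≤ (p - 1) * σ2 := by
  have h1 := h.integral_sub_directionalMSE_le hp hn (h.betaOne_nonneg hp hn hβ)
    (h.betaTwo_nonneg hp hn hβ hg) ((√σ2)⁻¹ • θ) (y := ‖x‖⁻¹ • x)
    (by simp [norm_smul, hx])
  rw [mseMatrix_shrink_scale n φ θ hσ, Matrix.mul_smul, Matrix.trace_smul, Matrix.sub_mul,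
    Matrix.one_mul, Matrix.trace_sub, h.trace_mseMatrix hp hn, h.trace_dirProj_mul hp hn,
    smul_eq_mul, mul_comm]
  gcongr

end MatrixBound

end ShrinkageMSE

namespace ShrinkageMSE

/-! ### Comparing possibly infinite risks through an integrable difference -/

section Lintegral

variable {α : Type*} [MeasurableSpace α] {μ : Measure α} {f g : α → ℝ}

/-- f + (g - f)⁺ = g + (g - f)⁻ avoids subtraction in [0, ∞]. Only the parts of the difference have
to be finite, so they can be cancelled even if both risks are infinite. -/
lemma lintegral_ofReal_add_posPart (hf : ∀ z, 0 ≤ f z) (hg : ∀ z, 0 ≤ g z)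
    (hi : Integrable (fun z => g z - f z) μ) :
    ∫⁻ z, ENNReal.ofReal (f z) ∂μ + ∫⁻ z, ENNReal.ofReal (g z - f z) ∂μ =
      ∫⁻ z, ENNReal.ofReal (g z) ∂μ + ∫⁻ z, ENNReal.ofReal (-(g z - f z)) ∂μ := by
  have hneg : AEMeasurable (fun z => -(g z - f z)) μ := hi.aemeasurable.neg
  rw [← lintegral_add_right' _ hi.aemeasurable.ennreal_ofReal,
    ← lintegral_add_right' _ hneg.ennreal_ofReal]
  refine lintegral_congr fun z => ?_
  rcases le_total (f z) (g z) with h | h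
  · rw [← ENNReal.ofReal_add (hf z) (by linarith),
      ENNReal.ofReal_of_nonpos (p := -(g z - f z)) (by linarith)]
    simp
  · rw [← ENNReal.ofReal_add (hg z) (by linarith),
      ENNReal.ofReal_of_nonpos (p := g z - f z) (by linarith)]
    simp

lemma lintegral_ofReal_le_of_integral_sub_nonneg (hf : ∀ z, 0 ≤ f z) (hg : ∀ z, 0 ≤ g z)
    (hi : Integrable (fun z => g z - f z) μ) (h0 : 0 ≤ ∫ z, (g z - f z) ∂μ) :
    ∫⁻ z, ENNReal.ofReal (f z) ∂μ ≤ ∫⁻ z, ENNReal.ofReal (g z) ∂μ := by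
  have h := lintegral_ofReal_add_posPart hf hg hi
  have hp := hi.lintegral_lt_top.ne
  have hn : ∫⁻ z, ENNReal.ofReal (-(g z - f z)) ∂μ ≠ ∞ := hi.neg.lintegral_lt_top.ne
  rw [integral_eq_lintegral_pos_part_sub_lintegral_neg_part hi, sub_nonneg,
    ENNReal.toReal_le_toReal hn hp] at h0
  refine (ENNReal.add_le_add_iff_right hp).1 ?_
  rw [h]
  gcongr

lemma lintegral_ofReal_lt_of_integral_sub_pos (hf : ∀ z, 0 ≤ f z) (hg : ∀ z, 0 ≤ g z)
    (hi : Integrable (fun z => g z - f z) μ) (h0 : 0 < ∫ z, (g z - f z) ∂μ)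
    (hfin : ∫⁻ z, ENNReal.ofReal (g z) ∂μ ≠ ∞) :
    ∫⁻ z, ENNReal.ofReal (f z) ∂μ < ∫⁻ z, ENNReal.ofReal (g z) ∂μ := by
  have h := lintegral_ofReal_add_posPart hf hg hi
  have hp := hi.lintegral_lt_top.ne
  have hn : ∫⁻ z, ENNReal.ofReal (-(g z - f z)) ∂μ ≠ ∞ := hi.neg.lintegral_lt_top.ne
  rw [integral_eq_lintegral_pos_part_sub_lintegral_neg_part hi, sub_pos,
    ENNReal.toReal_lt_toReal hn hp] at h0
  refine (ENNReal.add_lt_add_iff_right hp).1 ?_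
  rw [h]
  exact ENNReal.add_lt_add_left hfin h0

end Lintegral

/-! ### The loss as a quadratic function of the entry l₁ -/

section Loss

variable {p n : ℕ} {φ : ℝ → ℝ}

lemma trace_dirProj {x : EuclideanSpace ℝ (Fin p)} (hx : x ≠ 0) : (dirProj x).trace = 1 := by
  have h : ‖x‖ ^ 2 ≠ 0 := by simpa using hx
  simp only [Matrix.trace, Matrix.diag, dirProj, Matrix.of_apply]
  rw [← Finset.sum_div, div_eq_one_iff_eq h, EuclideanSpace.real_norm_sq_eq]
  simp [sq]

lemma dirProj_mul_self {x : EuclideanSpace ℝ (Fin p)} (hx : x ≠ 0) :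
    dirProj x * dirProj x = dirProj x := by
  have h : ‖x‖ ^ 2 ≠ 0 := by simpa using hx
  ext i j
  simp only [Matrix.mul_apply, dirProj, Matrix.of_apply]
  have e : ∀ k, x i * x k / ‖x‖ ^ 2 * (x k * x j / ‖x‖ ^ 2) =
      x i * x j / (‖x‖ ^ 2) ^ 2 * (x k) ^ 2 := fun k => by field_simp
  simp_rw [e]
  rw [← Finset.mul_sum, ← EuclideanSpace.real_norm_sq_eq]
  field_simp

lemma dirProj_transpose (x : EuclideanSpace ℝ (Fin p)) : (dirProj x).transpose = dirProj x := by
  ext i j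
  simp [dirProj, mul_comm]

lemma mseMatrix_transpose (n : ℕ)
    (δ : EuclideanSpace ℝ (Fin p) → ℝ → EuclideanSpace ℝ (Fin p))
    (θ : EuclideanSpace ℝ (Fin p)) (σ2 : ℝ) :
    (mseMatrix n δ θ σ2).transpose = mseMatrix n δ θ σ2 := by
  ext i j
  simp [mseMatrix, mul_comm]

/-- For a symmetric matrix the trace of the square is the sum of the squared entries. Nonnegativity
ensures that `ENNReal.ofReal` in the risk loses nothing. -/
lemma loss_nonneg_of_transpose_eq (θ : EuclideanSpace ℝ (Fin p)) (σ2 : ℝ)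
    {A : Matrix (Fin p) (Fin p) ℝ} (hA : A.transpose = A) : 0 ≤ loss n φ θ σ2 A := by
  set X := A - mseMatrix n (shrink φ) θ σ2 with hX
  have hXt : X.transpose = X := by
    rw [hX, Matrix.transpose_sub, hA, mseMatrix_transpose]
  rw [loss, ← hX, sq]
  nth_rewrite 1 [← hXt]
  simp only [Matrix.trace, Matrix.diag, Matrix.mul_apply, Matrix.transpose_apply]
  exact Finset.sum_nonneg fun i _ => Finset.sum_nonneg fun j _ => mul_self_nonneg _

lemma loss_mHat_nonneg (θ : EuclideanSpace ℝ (Fin p)) (σ2 : ℝ) (ξ η : ℝ → ℝ)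
    (x : EuclideanSpace ℝ (Fin p)) (s : ℝ) : 0 ≤ loss n φ θ σ2 (mHat n φ ξ η x s) := by
  refine loss_nonneg_of_transpose_eq θ σ2 ?_
  simp [mHat, dirProj_transpose]

/-- The loss saved by changing the entry `l₁` of the estimator. -/
lemma loss_mHat_sub (θ : EuclideanSpace ℝ (Fin p)) (σ2 : ℝ) (ξ ξ' η : ℝ → ℝ)
    {x : EuclideanSpace ℝ (Fin p)} (hx : x ≠ 0) (s : ℝ) :
    loss n φ θ σ2 (mHat n φ ξ η x s) - loss n φ θ σ2 (mHat n φ ξ' η x s) =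
      s * (ell₁ n φ ξ (stat x s) - ell₁ n φ ξ' (stat x s)) *
        ((p - 1) * s * (ell₁ n φ ξ (stat x s) + ell₁ n φ ξ' (stat x s)) -
          2 * ((1 - dirProj x) * mseMatrix n (shrink φ) θ σ2).trace) := by
  have hP := dirProj_mul_self hx
  have htr := trace_dirProj hx
  set P := dirProj x
  set M := mseMatrix n (shrink φ) θ σ2
  set Q := 1 - P with hQ
  have hQQ : Q * Q = Q := by
    rw [hQ, Matrix.sub_mul, Matrix.one_mul, Matrix.mul_sub, Matrix.mul_one, hP, sub_self, sub_zero]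
  have hQP : Q * P = 0 := by rw [hQ, Matrix.sub_mul, Matrix.one_mul, hP, sub_self]
  have htrQ : Q.trace = p - 1 := by rw [hQ, Matrix.trace_sub, htr]; simp
  set c := ell₀ n φ η (stat x s)
  -- Because QP = 0 there is no term mixing a and c, so the remainder with c cancels in the
  -- difference.
  have key : ∀ a : ℝ, ((s • (a • Q + c • P) - M) ^ 2).trace =
      s ^ 2 * a ^ 2 * (p - 1) - 2 * s * a * (Q * M).trace + ((s • c • P - M) ^ 2).trace := by
    intro a
    have e : s • (a • Q + c • P) - M = (s * a) • Q + (s • c • P - M) := by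
      rw [smul_add, smul_smul]; abel
    set N := s • c • P - M with hN
    have hQN : (Q * N).trace = -(Q * M).trace := by
      rw [hN, Matrix.mul_sub, Matrix.mul_smul, Matrix.mul_smul, hQP]
      simp
    rw [e, sq, Matrix.add_mul, Matrix.mul_add, Matrix.mul_add, Matrix.trace_add, Matrix.trace_add,
      Matrix.trace_add, Matrix.smul_mul, Matrix.mul_smul, hQQ, Matrix.mul_smul, Matrix.smul_mul, sq N]
    simp only [Matrix.trace_smul, Matrix.trace_mul_comm N Q, smul_eq_mul, hQN, htrQ]
    ring
  rw [loss, loss, mHat, mHat, key, key]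
  ring

lemma abs_trace_compl_dirProj_mul_le (x : EuclideanSpace ℝ (Fin p))
    (M : Matrix (Fin p) (Fin p) ℝ) :
    |((1 - dirProj x) * M).trace| ≤ ∑ i, ∑ j, 2 * |M j i| := by
  simp only [Matrix.trace, Matrix.diag, Matrix.mul_apply]
  refine (Finset.abs_sum_le_sum_abs _ _).trans (Finset.sum_le_sum fun i _ =>
    (Finset.abs_sum_le_sum_abs _ _).trans (Finset.sum_le_sum fun j _ => ?_))
  rw [abs_mul]
  gcongr
  have h1 : |(1 : Matrix (Fin p) (Fin p) ℝ) i j| ≤ 1 := by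
    rw [Matrix.one_apply]
    split_ifs <;> simp
  have h2 : |dirProj x i j| ≤ 1 := by
    rw [dirProj, Matrix.of_apply, abs_div, abs_mul, abs_of_nonneg (sq_nonneg ‖x‖)]
    refine div_le_one_of_le₀ ?_ (sq_nonneg _)
    rw [sq]
    exact mul_le_mul (PiLp.norm_apply_le x i) (PiLp.norm_apply_le x j) (abs_nonneg _)
      (norm_nonneg _)
  calc _ ≤ |(1 : Matrix (Fin p) (Fin p) ℝ) i j| + |dirProj x i j| := abs_sub _ _
    _ ≤ 2 := by linarith

lemma measurable_trace_compl_dirProj_mul (M : Matrix (Fin p) (Fin p) ℝ) :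
    Measurable fun x : EuclideanSpace ℝ (Fin p) => ((1 - dirProj x) * M).trace := by
  simp only [Matrix.trace, Matrix.diag, Matrix.mul_apply, Matrix.sub_apply, dirProj,
    Matrix.of_apply]
  fun_prop

end Loss

/-! ### Dependence on φ through its values on (0, ∞) only -/

section Congr

variable {p n : ℕ} {φ ψ : ℝ → ℝ}

lemma g₁_congr (h : EqOn φ ψ (Ioi 0)) {w : ℝ} (hw : 0 < w) : g₁ n φ w = g₁ n ψ w := by
  rw [g₁, g₁, tailTransform, tailTransform]
  congr 1
  refine setIntegral_congr_fun measurableSet_Ioi fun t ht => ?_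
  simp only [h₁]
  rw [h (hw.trans ht)]

lemma bFun_congr (h : EqOn φ ψ (Ioi 0)) {w : ℝ} (hw : 0 < w) : bFun n φ w = bFun n ψ w := by
  have hd : deriv φ w = deriv ψ w :=
    (Filter.eventuallyEq_of_mem (Ioi_mem_nhds hw) h).deriv_eq
  rw [bFun, bFun, hd, h hw]

lemma betaOne_congr (h : EqOn φ ψ (Ioi 0)) : betaOne p n φ = betaOne p n ψ := by
  ext j
  refine integral_congr_ae ?_
  filter_upwards [ae_pos_prod_chiSq (p + 2 * j) n] with z hz
  have hw := div_pos hz.1 hz.2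
  rw [bFun_congr h hw, h hw]

lemma betaTwo_congr (h : EqOn φ ψ (Ioi 0)) : betaTwo p n φ = betaTwo p n ψ := by
  ext j
  refine integral_congr_ae ?_
  filter_upwards [ae_pos_prod_chiSq (p + 2 * j) n] with z hz
  have hw := div_pos hz.1 hz.2
  rw [bFun_congr h hw, h hw]

lemma stat_pos {x : EuclideanSpace ℝ (Fin p)} {s : ℝ} (hx : x ≠ 0) (hs : 0 < s) :
    0 < stat x s := by
  have := norm_pos_iff.2 hx
  unfold stat
  positivity

lemma mseMatrix_congr (hp : 1 ≤ p) (h : EqOn φ ψ (Ioi 0)) (θ : EuclideanSpace ℝ (Fin p))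
    {σ2 : ℝ} (hσ : 0 < σ2) :
    mseMatrix n (shrink φ) θ σ2 = mseMatrix n (shrink ψ) θ σ2 := by
  ext i j
  refine integral_congr_ae ?_
  filter_upwards [ae_model_pos hp n θ hσ] with z hz
  rw [shrink, shrink, h (stat_pos hz.1 hz.2)]

/-- The values of φ off the positive half line are arbitrary and may spoil measurability; a global
Lipschitz extension repairs this. -/
lemma exists_isShrinkageFn_eqOn {C : ℝ} {K : ℝ≥0} (hφ : ∀ w, 0 < w → |φ w| ≤ C)
    (hφ' : LipschitzOnWith K φ (Ioi 0)) : ∃ ψ, IsShrinkageFn ψ C K ∧ EqOn φ ψ (Ioi 0) := by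
  obtain ⟨ψ, hψ, heq⟩ := hφ'.extend_real
  exact ⟨ψ, ⟨hψ.continuous.measurable, fun w hw => heq hw ▸ hφ w hw, hψ.lipschitzOnWith⟩, heq⟩

end Congr

/-! ### The gain from truncation -/

section Main

variable {p n : ℕ} {φ ξ : ℝ → ℝ} {C κ : ℝ} {K : ℝ≥0}

/-- The change of `l₁` under truncation when `g₁ ξ = min g₁ κ`. On the positive half-line
`exp (log w) = w`, and this form is measurable as soon as `g₁` is monotone there. -/
noncomputable def truncGap (p n : ℕ) (φ : ℝ → ℝ) (κ w : ℝ) : ℝ :=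
  max 0 (1 / (n : ℝ) - (1 + w) / ((n : ℝ) + p + 1) - min (g₁ n φ (Real.exp (Real.log w))) κ)

lemma truncGap_nonneg (w : ℝ) : 0 ≤ truncGap p n φ κ w := le_max_left _ _

lemma truncGap_of_pos {w : ℝ} (hw : 0 < w) : truncGap p n φ κ w =
    max 0 (1 / (n : ℝ) - (1 + w) / ((n : ℝ) + p + 1) - min (g₁ n φ w) κ) := by
  rw [truncGap, Real.exp_log hw]

lemma measurable_truncGap (hg : AntitoneOn (g₁ n φ) (Ioi 0)) :
    Measurable (truncGap p n φ κ) := by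
  have h1 : Antitone fun w => g₁ n φ (Real.exp w) := fun a b hab =>
    hg (Real.exp_pos a) (Real.exp_pos b) (Real.exp_le_exp.2 hab)
  have h2 : Measurable fun w => g₁ n φ (Real.exp (Real.log w)) :=
    h1.measurable.comp Real.measurable_log
  unfold truncGap
  fun_prop

/-- With min(g₁, κ) ≥ 0 the gap is at most 1/n. Its boundedness makes the saved loss integrable
whether or not the risks are finite. -/
lemma truncGap_le_one (hn : 1 ≤ n) (hκ : 0 ≤ κ) (hg : ∀ w, 0 < w → 0 < g₁ n φ w) {w : ℝ}
    (hw : 0 < w) : truncGap p n φ κ w ≤ 1 := by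
  rw [truncGap_of_pos hw]
  refine max_le zero_le_one ?_
  have h1 : (0 : ℝ) ≤ (1 + w) / ((n : ℝ) + p + 1) := by positivity
  have h2 : 0 ≤ min (g₁ n φ w) κ := le_min (hg w hw).le hκ
  have h3 : 1 / (n : ℝ) ≤ 1 := by
    rw [div_le_one (by positivity)]
    exact_mod_cast hn
  linarith

lemma ell₁_sub_truncXi {w : ℝ} (hw : 0 < w) (hg : 0 < g₁ n φ w)
    (hξ : g₁ n φ w * ξ w = min (g₁ n φ w) κ) :
    ell₁ n φ ξ w - ell₁ n φ (truncXi p n φ ξ) w = truncGap p n φ κ w := by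
  have hl : g₁ n φ w * level p n φ w = 1 / (n : ℝ) - (1 + w) / ((n : ℝ) + p + 1) := by
    rw [level]
    field_simp
  rw [ell₁, ell₁, truncXi, mul_max_of_nonneg _ _ hg.le, hl, hξ, truncGap_of_pos hw]
  rcases le_total (min (g₁ n φ w) κ) (1 / (n : ℝ) - (1 + w) / ((n : ℝ) + p + 1)) with h | h
  · rw [max_eq_right h, max_eq_right (by linarith)]
    ring
  · rw [max_eq_left h, max_eq_left (by linarith)]
    ring

/-- Where the gap is nonzero the truncated entry equals (1 + w)/(n + p + 1); elsewhere both sides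
are 0. Multiplying by the gap removes the case distinction from the loss. -/
lemma truncGap_mul_ell₁ {w : ℝ} (hw : 0 < w) (hg : 0 < g₁ n φ w)
    (hξ : g₁ n φ w * ξ w = min (g₁ n φ w) κ) :
    truncGap p n φ κ w * ell₁ n φ (truncXi p n φ ξ) w =
      truncGap p n φ κ w * ((1 + w) / ((n : ℝ) + p + 1)) := by
  have hl : g₁ n φ w * level p n φ w = 1 / (n : ℝ) - (1 + w) / ((n : ℝ) + p + 1) := by
    rw [level]
    field_simp
  rw [ell₁, truncXi, mul_max_of_nonneg _ _ hg.le, hl, hξ, truncGap_of_pos hw]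
  rcases le_total (min (g₁ n φ w) κ) (1 / (n : ℝ) - (1 + w) / ((n : ℝ) + p + 1)) with h | h
  · rw [max_eq_right h]
    ring
  · rw [max_eq_left (by linarith : 1 / (n : ℝ) - (1 + w) / ((n : ℝ) + p + 1) -
      min (g₁ n φ w) κ ≤ 0)]
    ring

/-- The loss saved by truncation, in closed form. -/
noncomputable def lossGain (n : ℕ) (φ : ℝ → ℝ) (κ : ℝ) (θ : EuclideanSpace ℝ (Fin p)) (σ2 : ℝ)
    (z : EuclideanSpace ℝ (Fin p) × ℝ) : ℝ :=
  z.2 * truncGap p n φ κ (stat z.1 z.2) *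
    ((p - 1) * (2 * ((‖z.1‖ ^ 2 + z.2) / ((n : ℝ) + p + 1)) +
      z.2 * truncGap p n φ κ (stat z.1 z.2)) -
      2 * ((1 - dirProj z.1) * mseMatrix n (shrink φ) θ σ2).trace)

lemma loss_sub_eq_lossGain (θ : EuclideanSpace ℝ (Fin p)) (σ2 : ℝ) (η : ℝ → ℝ)
    (hg : ∀ w, 0 < w → 0 < g₁ n φ w)
    (hξ : ∀ w, 0 < w → g₁ n φ w * ξ w = min (g₁ n φ w) κ)
    {z : EuclideanSpace ℝ (Fin p) × ℝ} (hz : z.1 ≠ 0 ∧ 0 < z.2) :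
    loss n φ θ σ2 (mHat n φ ξ η z.1 z.2) -
      loss n φ θ σ2 (mHat n φ (truncXi p n φ ξ) η z.1 z.2) = lossGain n φ κ θ σ2 z := by
  have hw := stat_pos hz.1 hz.2
  have h1 := ell₁_sub_truncXi (p := p) hw (hg _ hw) (hξ _ hw)
  have h2 := truncGap_mul_ell₁ (p := p) hw (hg _ hw) (hξ _ hw)
  have h3 : z.2 * (1 + stat z.1 z.2) = ‖z.1‖ ^ 2 + z.2 := by
    have := hz.2.ne'
    rw [stat]
    field_simp
    ring
  rw [loss_mHat_sub θ σ2 ξ (truncXi p n φ ξ) η hz.1, lossGain, ← h3, h1,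
    eq_add_of_sub_eq h1]
  linear_combination 2 * ((p : ℝ) - 1) * z.2 ^ 2 * h2

lemma integrable_lossGain (hp : 3 ≤ p) (hn : 1 ≤ n) (hκ : 0 ≤ κ)
    (hg : ∀ w, 0 < w → 0 < g₁ n φ w) (hanti : AntitoneOn (g₁ n φ) (Ioi 0))
    (θ : EuclideanSpace ℝ (Fin p)) {σ2 : ℝ} (hσ : 0 < σ2) :
    Integrable (lossGain n φ κ θ σ2) (model n θ σ2) := by
  have hp' : (3 : ℝ) ≤ p := by exact_mod_cast hp
  have hm := measurable_truncGap (p := p) (κ := κ) hanti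
  have hτ : Measurable fun z : EuclideanSpace ℝ (Fin p) × ℝ =>
      ((1 - dirProj z.1) * mseMatrix n (shrink φ) θ σ2).trace :=
    (measurable_trace_compl_dirProj_mul _).comp measurable_fst
  have hmeas : Measurable (lossGain n φ κ θ σ2) := by
    unfold lossGain stat
    fun_prop
  rw [integrable_scale_iff hσ]
  -- A bound for the trace term uniform in x, valid for any matrix because the entries of I - P are
  -- at most 2 in absolute value.
  set T := ∑ i, ∑ j, 2 * |mseMatrix n (shrink φ) θ σ2 j i| with hT
  have hT0 : 0 ≤ T := by positivity
  refine integrable_model_one_of_abs_le hp hn _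
    (hmeas.comp (measurableEmbedding_scale hσ).measurable)
    (B := σ2 * (3 * (p - 1) * σ2 + 2 * T) * 2) fun x s hx hs => ?_
  have hu : 0 < ‖x‖ ^ 2 := by positivity
  have h0 := truncGap_nonneg (p := p) (n := n) (φ := φ) (κ := κ) (stat x s)
  have h1 := truncGap_le_one (p := p) hn hκ hg (stat_pos hx hs)
  have h2 := abs_trace_compl_dirProj_mul_le (√σ2 • x) (mseMatrix n (shrink φ) θ σ2)
  rw [← hT] at h2
  have hp1 : (0 : ℝ) ≤ p - 1 := by linarith
  have hw := mul_add_le_weight (c := 1) (s := s) zero_le_one hu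
  simp only [lossGain, stat_scale hσ, norm_smul, mul_pow, Real.norm_eq_abs, sq_abs,
    Real.sq_sqrt hσ.le]
  set D := truncGap p n φ κ (stat x s)
  set τ := ((1 - dirProj (√σ2 • x)) * mseMatrix n (shrink φ) θ σ2).trace
  have hc : (σ2 * ‖x‖ ^ 2 + σ2 * s) / ((n : ℝ) + p + 1) ≤ σ2 * (‖x‖ ^ 2 + s) := by
    rw [div_le_iff₀ (by positivity)]
    have : (1 : ℝ) ≤ (n : ℝ) + p + 1 := by linarith [(Nat.cast_nonneg n : (0 : ℝ) ≤ n)]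
    have h4 : 0 ≤ σ2 * (‖x‖ ^ 2 + s) := by positivity
    nlinarith
  have hD : σ2 * s * D ≤ σ2 * s := mul_le_of_le_one_right (by positivity) h1
  have hA0 : 0 ≤ (p - 1) * (2 * ((σ2 * ‖x‖ ^ 2 + σ2 * s) / ((n : ℝ) + p + 1)) + σ2 * s * D) := by
    positivity
  have hA : (p - 1) * (2 * ((σ2 * ‖x‖ ^ 2 + σ2 * s) / ((n : ℝ) + p + 1)) + σ2 * s * D) ≤
      (p - 1) * (3 * (σ2 * (‖x‖ ^ 2 + s + 1))) := by
    gcongr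
    have : 0 ≤ σ2 * ‖x‖ ^ 2 := by positivity
    linarith
  rw [abs_mul, abs_of_nonneg (by positivity : 0 ≤ σ2 * s * D)]
  calc _ ≤ σ2 * s * ((p - 1) * (3 * (σ2 * (‖x‖ ^ 2 + s + 1))) + 2 * T * (‖x‖ ^ 2 + s + 1)) := by
        refine mul_le_mul hD ?_ (abs_nonneg _) (by positivity)
        refine (abs_sub _ _).trans ?_
        rw [abs_of_nonneg hA0, abs_mul, abs_two]
        have : T ≤ T * (‖x‖ ^ 2 + s + 1) := le_mul_of_one_le_right hT0 (by linarith)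
        linarith
    _ = σ2 * (3 * (p - 1) * σ2 + 2 * T) * (s * (‖x‖ ^ 2 + s + 1)) := by ring
    _ ≤ σ2 * (3 * (p - 1) * σ2 + 2 * T) *
        ((1 + 1) * ((1 + 1 / ‖x‖ ^ 2) * (1 + ‖x‖ ^ 2) * (1 + s ^ 2))) := by gcongr
    _ = _ := by ring

lemma integrable_dilation_scale (hp : 3 ≤ p) (hn : 1 ≤ n) {D : ℝ → ℝ} {B : ℝ}
    (hD : Measurable D) (hB : ∀ w, 0 < w → |D w| ≤ B) (θ : EuclideanSpace ℝ (Fin p)) {σ2 : ℝ}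
    (hσ : 0 < σ2) {c : ℝ} (hc : 0 ≤ c) :
    Integrable (fun z => z.2 * D (stat z.1 z.2) * (‖z.1‖ ^ 2 + z.2 - c * σ2)) (model n θ σ2) := by
  rw [integrable_scale_iff hσ]
  simp only [stat_scale hσ, norm_smul, mul_pow, Real.norm_eq_abs, sq_abs, Real.sq_sqrt hσ.le]
  have h : Integrable (fun z => z.2 * D (stat z.1 z.2) * (‖z.1‖ ^ 2 + z.2 - c))
      (model n ((√σ2)⁻¹ • θ) 1) := by
    refine integrable_model_one_of_abs_le hp hn _ (by unfold stat; fun_prop) (B := B * (1 + c))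
      fun x s hx hs => abs_dilation_le hB hc (by positivity) hs
  refine (h.const_mul (σ2 ^ 2)).congr (Filter.Eventually.of_forall fun z => ?_)
  ring

/-- Pointwise, the trace is replaced by its bound (p - 1)σ² and the nonnegative term quadratic in
the gap is dropped. What remains is a multiple of the dilation integrand. -/
lemma integral_dilation_le_integral_lossGain (hp : 3 ≤ p) (hn : 1 ≤ n) (hκ : 0 ≤ κ)
    (hg : ∀ w, 0 < w → 0 < g₁ n φ w) (hanti : AntitoneOn (g₁ n φ) (Ioi 0))
    (θ : EuclideanSpace ℝ (Fin p)) {σ2 : ℝ} (hσ : 0 < σ2)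
    (hM : ∀ x : EuclideanSpace ℝ (Fin p), x ≠ 0 →
      ((1 - dirProj x) * mseMatrix n (shrink φ) θ σ2).trace ≤ (p - 1) * σ2) :
    2 * (p - 1) / ((n : ℝ) + p + 1) * (σ2 ^ 2 * ∫ z, z.2 * truncGap p n φ κ (stat z.1 z.2) *
      (‖z.1‖ ^ 2 + z.2 - (n + p + 1)) ∂(model n ((√σ2)⁻¹ • θ) 1)) ≤
      ∫ z, lossGain n φ κ θ σ2 z ∂(model n θ σ2) := by
  have hp' : (3 : ℝ) ≤ p := by exact_mod_cast hp
  have hc : (0 : ℝ) < (n : ℝ) + p + 1 := by positivity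
  rw [← integral_dilation_scale hσ, ← integral_const_mul]
  refine integral_mono_ae ((integrable_dilation_scale hp hn (measurable_truncGap hanti) (B := 1)
    (fun w hw => ?_) θ hσ hc.le).const_mul _) (integrable_lossGain hp hn hκ hg hanti θ hσ) ?_
  · rw [abs_of_nonneg (truncGap_nonneg w)]
    exact truncGap_le_one hn hκ hg hw
  · filter_upwards [ae_model_pos (by omega) n θ hσ] with z hz
    have h1 := hM z.1 hz.1
    have h2 := truncGap_nonneg (p := p) (n := n) (φ := φ) (κ := κ) (stat z.1 z.2)
    rw [lossGain]
    set D := truncGap p n φ κ (stat z.1 z.2)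
    set τ := ((1 - dirProj z.1) * mseMatrix n (shrink φ) θ σ2).trace
    have h3 : 0 ≤ z.2 * D := mul_nonneg hz.2.le h2
    have h4 : 0 ≤ (p - 1) * (z.2 * D) := mul_nonneg (by linarith) h3
    have e : 2 * (p - 1) / ((n : ℝ) + p + 1) * (z.2 * D *
        (‖z.1‖ ^ 2 + z.2 - (n + p + 1) * σ2)) =
        z.2 * D * ((p - 1) * (2 * ((‖z.1‖ ^ 2 + z.2) / ((n : ℝ) + p + 1))) -
          2 * ((p - 1) * σ2)) := by
      field_simp
    rw [e]
    refine mul_le_mul_of_nonneg_left ?_ h3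
    linarith

/-- To the right of w₀ the term min(g₁, κ) can only decrease, so a strict gap at w₀ persists for as
long as the linear term has not consumed it. -/
lemma exists_Ioo_truncGap_pos (hanti : AntitoneOn (g₁ n φ) (Ioi 0))
    (hg : ∀ w, 0 < w → 0 < g₁ n φ w)
    (hξ : ∀ w, 0 < w → g₁ n φ w * ξ w = min (g₁ n φ w) κ)
    {w₀ : ℝ} (hw₀ : 0 < w₀) (hlt : ξ w₀ < level p n φ w₀) :
    ∃ b, w₀ < b ∧ ∀ w ∈ Ioo w₀ b, 0 < truncGap p n φ κ w := by
  have hc : (0 : ℝ) < (n : ℝ) + p + 1 := by positivity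
  have hl : g₁ n φ w₀ * level p n φ w₀ = 1 / (n : ℝ) - (1 + w₀) / ((n : ℝ) + p + 1) := by
    have := (hg w₀ hw₀).ne'
    rw [level]
    field_simp
  have h0 := mul_lt_mul_of_pos_left hlt (hg w₀ hw₀)
  rw [hl, hξ w₀ hw₀] at h0
  set d := 1 / (n : ℝ) - (1 + w₀) / ((n : ℝ) + p + 1) - min (g₁ n φ w₀) κ with hd
  have hd0 : 0 < d := by linarith
  -- The point at which (1 + w)/(n + p + 1) has grown by the initial gap d.
  refine ⟨w₀ + ((n : ℝ) + p + 1) * d, by have := mul_pos hc hd0; linarith, fun w hw => ?_⟩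
  have hw0 : 0 < w := hw₀.trans hw.1
  rw [truncGap_of_pos hw0]
  refine lt_max_of_lt_right ?_
  have h1 : min (g₁ n φ w) κ ≤ min (g₁ n φ w₀) κ :=
    min_le_min_right _ (hanti hw₀ hw0 hw.1.le)
  have h2 : (1 + w) / ((n : ℝ) + p + 1) < (1 + w₀) / ((n : ℝ) + p + 1) + d := by
    rw [div_add' _ _ _ hc.ne', div_lt_div_iff_of_pos_right hc]
    linarith [hw.2]
  linarith

/-- Truncation at `level` improves the estimator whenever `g₁ ξ = min g₁ κ`. -/
theorem truncXi_improves (hp : 3 ≤ p) (hn : 1 ≤ n) (hφ : ∀ w, 0 < w → |φ w| ≤ C)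
    (hφ' : LipschitzOnWith K φ (Ioi 0)) (hanti : AntitoneOn (g₁ n φ) (Ioi 0))
    (hg : ∀ w, 0 < w → 0 < g₁ n φ w) (hβ : 0 ≤ betaOneInf p n φ) (hκ : 0 ≤ κ)
    (hξ : ∀ w, 0 < w → g₁ n φ w * ξ w = min (g₁ n φ w) κ) (η : ℝ → ℝ) :
    ImprovesOn (p := p) n φ (mHat n φ (truncXi p n φ ξ) η) (mHat n φ ξ η) ∧
      ({w | 0 < w ∧ ξ w < level p n φ w}.Nonempty →
        StrictlyImprovesOn (p := p) n φ (mHat n φ (truncXi p n φ ξ) η) (mHat n φ ξ η)) := by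
  have hp' : (3 : ℝ) ≤ p := by exact_mod_cast hp
  obtain ⟨ψ, hψ, heq⟩ := exists_isShrinkageFn_eqOn hφ hφ'
  have hM : ∀ (θ : EuclideanSpace ℝ (Fin p)) (σ2 : ℝ), 0 < σ2 →
      ∀ x : EuclideanSpace ℝ (Fin p), x ≠ 0 →
      ((1 - dirProj x) * mseMatrix n (shrink φ) θ σ2).trace ≤ (p - 1) * σ2 := by
    intro θ σ2 hσ x hx
    rw [mseMatrix_congr (by omega) heq θ hσ]
    refine hψ.trace_compl_dirProj_mul_le hp hn ?_ (fun w hw => ?_) θ hσ hx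
    · rwa [betaOneInf, ← betaOne_congr heq]
    · rw [← g₁_congr heq hw]
      exact hg w hw
  have hae : ∀ (θ : EuclideanSpace ℝ (Fin p)) (σ2 : ℝ), 0 < σ2 →
      (fun z => loss n φ θ σ2 (mHat n φ ξ η z.1 z.2) -
        loss n φ θ σ2 (mHat n φ (truncXi p n φ ξ) η z.1 z.2)) =ᵐ[model n θ σ2]
      lossGain n φ κ θ σ2 := by
    intro θ σ2 hσ
    filter_upwards [ae_model_pos (by omega) n θ hσ] with z hz
    exact loss_sub_eq_lossGain θ σ2 η hg hξ hz
  have hint : ∀ (θ : EuclideanSpace ℝ (Fin p)) (σ2 : ℝ), 0 < σ2 →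
      Integrable (fun z => loss n φ θ σ2 (mHat n φ ξ η z.1 z.2) -
        loss n φ θ σ2 (mHat n φ (truncXi p n φ ξ) η z.1 z.2)) (model n θ σ2) :=
    fun θ σ2 hσ => (integrable_lossGain hp hn hκ hg hanti θ hσ).congr (hae θ σ2 hσ).symm
  have hle := fun (θ : EuclideanSpace ℝ (Fin p)) (σ2 : ℝ) (hσ : 0 < σ2) =>
    (integral_dilation_le_integral_lossGain hp hn hκ hg hanti θ hσ (hM θ σ2 hσ)).trans_eq
      (integral_congr_ae (hae θ σ2 hσ)).symm
  have hm := measurable_truncGap (p := p) (κ := κ) hanti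
  have hB : ∀ w, 0 < w → |truncGap p n φ κ w| ≤ 1 := fun w hw => by
    rw [abs_of_nonneg (truncGap_nonneg w)]
    exact truncGap_le_one hn hκ hg hw
  have hp1 : (0 : ℝ) < p - 1 := by linarith
  refine ⟨fun θ σ2 hσ => ?_, fun ⟨w₀, hw₀, hlt⟩ θ σ2 hσ => ?_⟩
  · refine lintegral_ofReal_le_of_integral_sub_nonneg (fun z => loss_mHat_nonneg _ _ _ _ _ _)
      (fun z => loss_mHat_nonneg _ _ _ _ _ _) (hint θ σ2 hσ) (le_trans ?_ (hle θ σ2 hσ))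
    have := integral_dilation_model_nonneg hp hn hm hB (fun w _ => truncGap_nonneg w)
      ((√σ2)⁻¹ • θ)
    positivity
  · obtain ⟨b, hb, hpos⟩ := exists_Ioo_truncGap_pos (p := p) hanti hg hξ hw₀ hlt
    have hD := integral_dilation_model_pos hp hn hm hB (fun w _ => truncGap_nonneg w) hw₀ hb hpos
      ((√σ2)⁻¹ • θ)
    have hgain := lt_of_lt_of_le (by positivity) (hle θ σ2 hσ)
    exact ⟨hint θ σ2 hσ, hgain, fun hfin => lintegral_ofReal_lt_of_integral_sub_pos
      (fun z => loss_mHat_nonneg _ _ _ _ _ _) (fun z => loss_mHat_nonneg _ _ _ _ _ _)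
      (hint θ σ2 hσ) hgain hfin⟩

lemma betaTwoSup_nonneg (hp : 3 ≤ p) (hn : 1 ≤ n) (hφ : ∀ w, 0 < w → |φ w| ≤ C)
    (hφ' : LipschitzOnWith K φ (Ioi 0)) (hg : ∀ w, 0 < w → 0 < g₁ n φ w)
    (hβ : 0 ≤ betaOneInf p n φ) : 0 ≤ betaTwoSup p n φ := by
  obtain ⟨ψ, hψ, heq⟩ := exists_isShrinkageFn_eqOn hφ hφ'
  rw [betaTwoSup, betaTwo_congr heq]
  -- No upper bound on the family is needed: an unbounded real supremum is 0 by default.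
  refine Real.iSup_nonneg (hψ.betaTwo_nonneg hp hn ?_ fun w hw => ?_)
  · rwa [betaOneInf, ← betaOne_congr heq]
  · rw [← g₁_congr heq hw]
    exact hg w hw

lemma mul_xiOne (Wξ : ℝ) {w : ℝ} (hg : 0 < g₁ n φ w) : g₁ n φ w * xiOne p n φ Wξ w =
    min (g₁ n φ w) ((1 + Wξ) / ((n : ℝ) + p + 2) * betaTwoSup p n φ) := by
  rw [xiOne, mul_min_of_nonneg _ _ hg.le, mul_one]
  congr 1
  field_simp

lemma mul_xiTwo {w : ℝ} (hg : 0 < g₁ n φ w) : g₁ n φ w * xiTwo p n φ w =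
    min (g₁ n φ w) (betaTwoSup p n φ / ((n : ℝ) + 2)) := by
  rw [xiTwo, mul_min_of_nonneg _ _ hg.le, mul_one]
  congr 1
  field_simp

end Main

end ShrinkageMSE
theorem mainTheorem9 (p n : ℕ) (hp : 3 ≤ p) (hn : 1 ≤ n) (φ : ℝ → ℝ)
    -- `φ` is bounded and locally absolutely continuous with bounded derivative on `(0, ∞)`
    (C : ℝ) (hφ : ∀ w, 0 < w → |φ w| ≤ C)
    (K : ℝ≥0) (hφ' : LipschitzOnWith K φ (Ioi 0))
    -- the shrinkage estimator improves on `X` under squared error loss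
    (hδ : ∀ (θ : EuclideanSpace ℝ (Fin p)) (σ2 : ℝ), 0 < σ2 →
      mse n (shrink φ) θ σ2 ≤ mse n (fun x _ => x) θ σ2)
    (hg : AntitoneOn (g₁ n φ) (Ioi 0)) (hg₀ : ∀ w, 0 < w → g₁ n φ w ≠ 0)
    (hβ : 0 ≤ betaOneInf p n φ) :
    -- `i = 1`; where `g₃ ≥ g₁` everywhere, `η₁ = 1` and no root `W^η` is needed
    (∀ Wξ Wη : ℝ, IsXiRoot p n φ Wξ →
      (IsEtaRoot p n φ Wη ∨ (0 < Wη ∧ ∀ w, 0 < w → g₁ n φ w ≤ g₃ n φ w)) →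
      {w | 0 < w ∧ truncXi p n φ (xiOne p n φ Wξ) w = level p n φ w}.Nonempty →
        ImprovesOn (p := p) n φ
          (mHat n φ (truncXi p n φ (xiOne p n φ Wξ)) (etaOne p n φ Wη))
          (mHat n φ (xiOne p n φ Wξ) (etaOne p n φ Wη)) ∧
        ({w | 0 < w ∧ xiOne p n φ Wξ w < level p n φ w}.Nonempty →
          StrictlyImprovesOn (p := p) n φ
            (mHat n φ (truncXi p n φ (xiOne p n φ Wξ)) (etaOne p n φ Wη))
            (mHat n φ (xiOne p n φ Wξ) (etaOne p n φ Wη)))) ∧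
    -- `i = 2`
    ({w | 0 < w ∧ truncXi p n φ (xiTwo p n φ) w = level p n φ w}.Nonempty →
      ImprovesOn (p := p) n φ
        (mHat n φ (truncXi p n φ (xiTwo p n φ)) (etaTwo p n φ))
        (mHat n φ (xiTwo p n φ) (etaTwo p n φ)) ∧
      ({w | 0 < w ∧ xiTwo p n φ w < level p n φ w}.Nonempty →
        StrictlyImprovesOn (p := p) n φ
          (mHat n φ (truncXi p n φ (xiTwo p n φ)) (etaTwo p n φ))
          (mHat n φ (xiTwo p n φ) (etaTwo p n φ)))) := by
  have hg' : ∀ w, 0 < w → 0 < g₁ n φ w := fun w hw => g₁_pos hφ hg hg₀ hw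
  have hβ' := betaTwoSup_nonneg hp hn hφ hφ' hg' hβ
  refine ⟨fun Wξ Wη hξ _ _ => ?_, fun _ => ?_⟩
  -- Positivity of the root Wξ makes κ = (1 + Wξ)/(n + p + 2)·β⁽²⁾ nonnegative; for i = 2 the
  -- constant is κ = β⁽²⁾/(n + 2).
  · have := hξ.1
    exact truncXi_improves hp hn hφ hφ' hg hg' hβ (by positivity)
      (fun w hw => mul_xiOne Wξ (hg' w hw)) _
  · exact truncXi_improves hp hn hφ hφ' hg hg' hβ (by positivity)
      (fun w hw => mul_xiTwo (hg' w hw)) _
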